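/- Let $d\in\{2,3\}$. For $h\in(0,1]$ with $K=\pi/h\in\mathbb N$ and for $R\in\mathbb N$, consider the finite lattice $$\Omega=\{x\in h\mathbb Z^d:\ -\pi R\le x_j\le \pi R\ \text{for all } j\},\qquad \partial\Omega=\{x\in\Omega:\ x_j=\pm\pi R\ \text{for some } j\}.$$ On functions $f:\Omega\to\mathbb C$ with $f|_{\partial\Omega}=0$, let $\Delta_\Omega$ be the discrete Dirichlet Laplacian, defined by $$\Delta_\Omega f(x)=\frac1{h^2}\sum_{j=1}^d\bigl(f(x+he_j)+f(x-he_j)-2f(x)\bigr)\quad(x\in\Omega\setminus\partial\Omega),\qquad \Delta_\Omega f(x)=0\quad(x\in\partial\Omega).$$ It is self-adjoint and nonpositive; $e^{it\Delta_\Omega}$ and $(1-\Delta_\Omega)^{s/2}$ are defined by the functional calculus. Put $\|f\|_{L^p(\Omega)}=\bigl(h^d\sum_{x\in\Omega}|f(x)|^p\bigr)^{1/p}$ for $1\le p<\infty$ and $\|f\|_{L^\infty(\Omega)}=\max_{x\in\Omega}|f(x)|$. Let $\alpha\ge 0$ and $c_1,c_2>0$, let $2\le q,r\le\infty$ satisfy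 $$\frac3q+\frac dr=\frac d2,\qquad (q,r,d)\ne(2,\infty,3),$$ and let $s\in\mathbb R$ be such that $s>\frac1q$ if $\alpha\ge1$, $s=\frac{2-\alpha}q$ if $0<\alpha<1$, and $s>\frac2q$ if $\alpha=0$ (with $\frac1\infty=0$). Then there is a constant $C>0$, depending only on $d,\alpha,c_1,c_2,q,r,s$, such that for all $h\in(0,1]$ and $K,R\in\mathbb N$ with $K=\pi/h$ and $c_1h^{-\alpha}\le R\le c_2h^{-\alpha}$, and for all $w_0:\Omega\to\mathbb C$ with $w_0|_{\partial\Omega}=0$, $$\bigl\|e^{it\Delta_\Omega}w_0\bigr\|_{L^q_t([0,1];L^r(\Omega))}\le C\,\bigl\|(1-\Delta_\Omega)^{s/2}w_0\bigr\|_{L^2(\Omega)}.$$ -/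

import Mathlib

open scoped ENNReal

noncomputable section

namespace FiniteLattice

/-- The finite cubic lattice `Ω = {x ∈ hℤᵈ : -πR ≤ x_j ≤ πR}` with `h = π / K` and `M = K * R`.
The point `x = h m` is represented by its integer coordinates `m`, `-M ≤ m_j ≤ M`. -/
abbrev Site (d M : ℕ) : Type :=
  {m : Fin d → ℤ // m ∈ Finset.Icc (fun _ : Fin d => -(M : ℤ)) (fun _ : Fin d => (M : ℤ))}

/-- The boundary `∂Ω`: points with some coordinate `x_j = ± πR`, that is `m_j = ± M`. -/
def boundary (d M : ℕ) : Set (Site d M) :=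
  {x | ∃ j, x.1 j = (M : ℤ) ∨ x.1 j = -(M : ℤ)}

/-- The complex functions on `Ω` with zero boundary values, as a Hilbert space. (The inner product
is `∑ f(x) conj g(x)`; the weight `h ^ d` of the norm on `L²(Ω)` is put in `lpNorm`. A constant
weight changes neither adjoints nor functions of an operator.) -/
def zeroBoundary (d M : ℕ) : Submodule ℂ (EuclideanSpace ℂ (Site d M)) where
  carrier := {f | ∀ x ∈ boundary d M, f x = 0}
  add_mem' := by
    intro f g hf hg x hx
    simp [hf x hx, hg x hx]
  zero_mem' := by
    intro x _
    simp
  smul_mem' := by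
    intro c f hf x hx
    simp [hf x hx]

/-- The space of complex functions on `Ω` that vanish on `∂Ω`. -/
def DirichletFun (d M : ℕ) : Type := ↥(zeroBoundary d M)

instance instNormedAddCommGroup (d M : ℕ) : NormedAddCommGroup (DirichletFun d M) :=
  inferInstanceAs (NormedAddCommGroup ↥(zeroBoundary d M))

instance instInnerProductSpace (d M : ℕ) : InnerProductSpace ℂ (DirichletFun d M) :=
  inferInstanceAs (InnerProductSpace ℂ ↥(zeroBoundary d M))

instance instFiniteDimensional (d M : ℕ) : FiniteDimensional ℂ (DirichletFun d M) :=
  inferInstanceAs (FiniteDimensional ℂ ↥(zeroBoundary d M))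

instance instCompleteSpace (d M : ℕ) : CompleteSpace (DirichletFun d M) :=
  FiniteDimensional.complete ℂ (DirichletFun d M)

/-- The value of `f` at a point of `Ω`. -/
def DirichletFun.val {d M : ℕ} (f : DirichletFun d M) (x : Site d M) : ℂ :=
  (show ↥(zeroBoundary d M) from f).1 x

theorem val_add {d M : ℕ} (f g : DirichletFun d M) (x : Site d M) :
    (f + g).val x = f.val x + g.val x := rfl

theorem val_smul {d M : ℕ} (c : ℂ) (f : DirichletFun d M) (x : Site d M) :
    (c • f).val x = c * f.val x := rfl

theorem val_boundary {d M : ℕ} (f : DirichletFun d M) (x : Site d M) (hx : x ∈ boundary d M) :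
    f.val x = 0 := (show ↥(zeroBoundary d M) from f).2 x hx

theorem inner_eq_sum {d M : ℕ} (f g : DirichletFun d M) :
    inner ℂ f g = ∑ x : Site d M, g.val x * starRingEnd ℂ (f.val x) := rfl

theorem ext_val {d M : ℕ} {f g : DirichletFun d M} (hfg : ∀ x, f.val x = g.val x) : f = g :=
  Subtype.ext (PiLp.ext hfg)

/-- Extension by zero from `Ω` to the whole lattice `hℤᵈ`. -/
def extend {d M : ℕ} (f : DirichletFun d M) (m : Fin d → ℤ) : ℂ :=
  if hm : m ∈ Finset.Icc (fun _ : Fin d => -(M : ℤ)) (fun _ : Fin d => (M : ℤ)) then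
    f.val ⟨m, hm⟩ else 0

open Classical in
/-- The values of `Δ_Ω f`: the second difference quotient at the points of `Ω \ ∂Ω` (whose
neighbours all lie in `Ω`), and zero on `∂Ω`. -/
def lapValue {d M : ℕ} (h : ℝ) (f : DirichletFun d M) (x : Site d M) : ℂ :=
  if x ∈ boundary d M then 0 else
    ((h : ℂ) ^ 2)⁻¹ * ∑ j : Fin d,
      (extend f (x.1 + Pi.single j 1) + extend f (x.1 - Pi.single j 1) - 2 * f.val x)

theorem extend_add {d M : ℕ} (f g : DirichletFun d M) (m : Fin d → ℤ) :
    extend (f + g) m = extend f m + extend g m := by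
  unfold extend
  split_ifs <;> simp [val_add]

theorem extend_smul {d M : ℕ} (c : ℂ) (f : DirichletFun d M) (m : Fin d → ℤ) :
    extend (c • f) m = c * extend f m := by
  unfold extend
  split_ifs <;> simp [val_smul]

/-- The Dirichlet Laplacian `Δ_Ω` as a linear map on the functions with zero boundary values. -/
def lapLin (d M : ℕ) (h : ℝ) : DirichletFun d M →ₗ[ℂ] DirichletFun d M where
  toFun f := ⟨WithLp.toLp 2 (lapValue h f), fun x hx => by simp [lapValue, hx]⟩
  map_add' f g := ext_val fun x => by
    change lapValue h (f + g) x = lapValue h f x + lapValue h g x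
    by_cases hx : x ∈ boundary d M
    · simp [lapValue, hx]
    · simp only [lapValue, hx, if_false, extend_add, val_add]
      rw [← mul_add, ← Finset.sum_add_distrib]
      congr 1
      exact Finset.sum_congr rfl fun j _ => by ring
  map_smul' c f := ext_val fun x => by
    change lapValue h (c • f) x = c * lapValue h f x
    by_cases hx : x ∈ boundary d M
    · simp [lapValue, hx]
    · simp only [lapValue, hx, if_false, extend_smul, val_smul]
      rw [mul_left_comm c]
      refine congrArg _ ?_
      rw [Finset.mul_sum]
      exact Finset.sum_congr rfl fun j _ => by ring

/-- The Dirichlet Laplacian `Δ_Ω` as a bounded operator. -/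
def lap (d M : ℕ) (h : ℝ) : DirichletFun d M →L[ℂ] DirichletFun d M :=
  LinearMap.toContinuousLinearMap (lapLin d M h)

theorem lap_val {d M : ℕ} (h : ℝ) (f : DirichletFun d M) (x : Site d M) :
    (lap d M h f).val x = lapValue h f x := rfl

theorem extend_coe {d M : ℕ} (f : DirichletFun d M) (x : Site d M) :
    extend f x.1 = f.val x := by
  simp [extend, x.2]

theorem extend_eq_zero {d M : ℕ} (f : DirichletFun d M) {m : Fin d → ℤ}
    (hm : m ∉ Finset.Icc (fun _ : Fin d => -(M : ℤ)) (fun _ : Fin d => (M : ℤ))) :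
    extend f m = 0 := by
  simp only [extend, hm, dite_false]

theorem sum_extend_mul {d M : ℕ} (F : (Fin d → ℤ) → ℂ) (g : DirichletFun d M) :
    ∑ x : Site d M, F x.1 * starRingEnd ℂ (g.val x)
      = ∑' m : Fin d → ℤ, F m * starRingEnd ℂ (extend g m) := by
  rw [tsum_eq_sum (s := Finset.Icc (fun _ : Fin d => -(M : ℤ)) (fun _ : Fin d => (M : ℤ)))]
  · refine Eq.trans (Finset.sum_congr rfl fun x _ => ?_) (Finset.sum_coe_sort
      (Finset.Icc (fun _ : Fin d => -(M : ℤ)) (fun _ : Fin d => (M : ℤ)))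
      (fun m => F m * starRingEnd ℂ (extend g m)))
    rw [extend_coe]
  · intro m hm
    rw [extend_eq_zero g hm]
    simp

theorem sum_shift {d M : ℕ} (f g : DirichletFun d M) (e : Fin d → ℤ) :
    ∑ x : Site d M, extend f (x.1 + e) * starRingEnd ℂ (g.val x)
      = ∑ x : Site d M, f.val x * starRingEnd ℂ (extend g (x.1 - e)) := by
  have h2 := sum_extend_mul (fun m => extend g (m - e)) f
  apply_fun starRingEnd ℂ at h2
  rw [Complex.conj_tsum] at h2
  simp only [map_sum, map_mul, Complex.conj_conj] at h2
  rw [sum_extend_mul (fun m => extend f (m + e)) g,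
    ← (Equiv.subRight e).tsum_eq (fun m => extend f (m + e) * starRingEnd ℂ (extend g m))]
  simp only [Equiv.subRight_apply, sub_add_cancel]
  simp only [mul_comm (f.val _), mul_comm (extend f _)]
  exact h2.symm

theorem inner_lap {d M : ℕ} (h : ℝ) (f g : DirichletFun d M) :
    inner ℂ g (lap d M h f) = ((h : ℂ) ^ 2)⁻¹ * ∑ j : Fin d, ∑ x : Site d M,
      (extend f (x.1 + Pi.single j 1) + extend f (x.1 - Pi.single j 1) - 2 * f.val x)
        * starRingEnd ℂ (g.val x) := by
  rw [inner_eq_sum, Finset.sum_comm, Finset.mul_sum]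
  refine Finset.sum_congr rfl fun x _ => ?_
  rw [lap_val]
  by_cases hx : x ∈ boundary d M
  · simp [val_boundary g x hx]
  · simp only [lapValue, hx, if_false]
    rw [mul_assoc, Finset.sum_mul]

theorem isSelfAdjoint_lap (d M : ℕ) (h : ℝ) : IsSelfAdjoint (lap d M h) := by
  rw [ContinuousLinearMap.isSelfAdjoint_iff_isSymmetric]
  intro f g
  change inner ℂ (lap d M h f) g = inner ℂ f (lap d M h g)
  rw [← inner_conj_symm, inner_lap, inner_lap, map_mul, map_sum]
  congr 1
  · simp
  refine Finset.sum_congr rfl fun j _ => ?_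
  have h1 := sum_shift f g (Pi.single j 1)
  have h2 := sum_shift f g (-Pi.single j 1)
  apply_fun starRingEnd ℂ at h1 h2
  simp only [map_sum, map_mul, Complex.conj_conj, ← sub_eq_add_neg, sub_neg_eq_add] at h1 h2
  simp only [sub_mul, add_mul, Finset.sum_sub_distrib, Finset.sum_add_distrib, map_sub, map_add,
    map_sum, map_mul, Complex.conj_conj, map_ofNat]
  simp only [mul_comm _ (starRingEnd ℂ (f.val _))] at h1 h2 ⊢
  simp only [mul_comm _ (g.val _)] at h1 h2 ⊢
  rw [h1, h2, add_comm]
  congr 1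
  exact Finset.sum_congr rfl fun x _ => by ring

theorem isSelfAdjoint_one_sub_lap (d M : ℕ) (h : ℝ) : IsSelfAdjoint (1 - lap d M h) :=
  (IsSelfAdjoint.one _).sub (isSelfAdjoint_lap d M h)

/-- The linear Schrödinger propagator `e^{itΔ_Ω}` (operator exponential). -/
def propagator (d M : ℕ) (h t : ℝ) : DirichletFun d M →L[ℂ] DirichletFun d M :=
  NormedSpace.exp ((Complex.I * (t : ℂ)) • lap d M h)

/-- The Bessel potential `(1 - Δ_Ω)^{s/2}`, through the functional calculus of the self-adjoint
operator `1 - Δ_Ω`. -/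
def besselPotential (d M : ℕ) (h s : ℝ) : DirichletFun d M →L[ℂ] DirichletFun d M :=
  cfc (fun x : ℝ => x ^ (s / 2)) (1 - lap d M h)

/-- The norm of `L^p(Ω)`: `(h^d ∑_{x ∈ Ω} |f(x)|^p)^{1/p}` for `p < ∞`, and the maximum of `|f|`
for `p = ∞`. -/
def lpNorm {d M : ℕ} (h : ℝ) (p : ℝ≥0∞) (f : DirichletFun d M) : ℝ :=
  if p = ∞ then ⨆ x : Site d M, ‖f.val x‖
  else (h ^ d * ∑ x : Site d M, ‖f.val x‖ ^ p.toReal) ^ (1 / p.toReal)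

/-- The norm of `L^q([0,1]; L^r(Ω))`. -/
def strichartzNorm {d M : ℕ} (h : ℝ) (q r : ℝ≥0∞) (w : ℝ → DirichletFun d M) : ℝ≥0∞ :=
  MeasureTheory.eLpNorm (fun t : ℝ => lpNorm h r (w t)) q
    (MeasureTheory.volume.restrict (Set.Icc (0 : ℝ) 1))

/-- Lattice-admissible pairs of exponents in dimension `d`. -/
def LatticeAdmissible (d : ℕ) (q r : ℝ≥0∞) : Prop :=
  2 ≤ q ∧ 2 ≤ r ∧ 3 / q + (d : ℝ≥0∞) / r = (d : ℝ≥0∞) / 2 ∧ ¬ (q = 2 ∧ r = ∞ ∧ d = 3)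

end FiniteLattice

end

/-!
The sine functions diagonalize `Δ_Ω`, so that `e^{itΔ_Ω}` and `(1 - Δ_Ω)^{s/2}` are explicit
multipliers on the sine coefficients (`propagator_mode`, `inner_mode_besselPotential`). The flow is
studied on data with frequencies `1 ≤ k_i ≤ R N`, where `N ≥ 1` is dyadic; these waves have group
velocity `O(N)`, and cross the cube in a time of order `R / N`.

*Dispersion.* The kernel of the localized flow factors into one-dimensional exponential sums with
phase `2 t (K / π)² cos (π k / (2 K R)) + θ k`. Its increments are monotone on each half of the
spectrum, and up to the crossing time they can approach only one multiple of `2π`. The frequencies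
at which they are close to it are counted, and the others are handled by the Kuzmin–Landau inequality
(`norm_sum_exp_le_of_increments`, `norm_sum_exp_le_of_sublevel`). Near the inflection point `k = K R`
of the dispersion relation the phase is only cubic, but there `N` is of the order of `K`. The result
is the decay `(N / |t|)^{d/3}` of the kernel for `|t| N ≤ R` (`norm_kernel_le`).

*Strichartz estimates up to the crossing time.* Interpolation of the decay with unitarity
(`sum_norm_rpow_le_of_bounds`), the Hardy–Littlewood–Sobolev inequality in time
(`lintegral_lintegral_mul_rpow_le`) and the `TT*` argument (`lintegral_rpow_le_of_inner`) give the
estimate with loss `N^{1/q}` on time intervals of length `R / N`, for every admissible pair with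
`q ≠ ∞` (`exists_lintegral_flow_le`, `exists_lintegral_flow_iSup_le`). Such pairs have `q > 2`, since
the endpoint `(2, ∞)` in dimension three is excluded; hence no endpoint argument is needed.

*Unit time.* The interval `[0, 1]` is covered by at most `1 + N / R` crossing times, which for the
frequencies of size `R N` with `N = 2 ^ j` costs the factor `2^{j/q} (1 + 2^j / R)^{1/q}`, while
`(1 - Δ_Ω)^{s/2}` gains `2^{-js}` (`exists_strichartzNorm_blockPart_le`). Since `2^j` is at most a
multiple of `1 / h` and `R` is of the order of `h^{-α}`, these numbers have sums bounded uniformly in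
`h`, `K` and `R` in each of the three ranges of `α` (`exists_sum_loss_le`). Even for `0 < α < 1`,
where `s` is critical, they are bounded by two geometric progressions, one decreasing from the lowest
frequencies and one increasing to the highest. So the triangle inequality in the dyadic decomposition
suffices, and no square function estimate is used. The case `q = ∞` is the unitarity of the flow.
-/

noncomputable section

namespace FiniteLattice

/-! ### Exponential sums with monotone phase increments -/

theorem inv_exp_sub_one {g : ℝ} (hg : Real.sin (g / 2) ≠ 0) :
    (-(1 / 2) - Complex.I * ((Real.cos (g / 2) / (2 * Real.sin (g / 2)) : ℝ) : ℂ)) *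
      (Complex.exp (g * Complex.I) - 1) = 1 := by
  have h1 : Complex.exp (g * Complex.I) =
      ((Real.cos (g / 2) : ℝ) + (Real.sin (g / 2) : ℝ) * Complex.I) ^ 2 := by
    rw [Complex.ofReal_cos, Complex.ofReal_sin, ← Complex.exp_mul_I, ← Complex.exp_nat_mul]
    congr 1
    push_cast
    ring
  have h2 : ((Real.sin (g / 2) : ℝ) : ℂ) ≠ 0 := by exact_mod_cast hg
  have h3 : ((Real.sin (g / 2) : ℝ) : ℂ) ^ 2 + ((Real.cos (g / 2) : ℝ) : ℂ) ^ 2 = 1 := by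
    exact_mod_cast Real.sin_sq_add_cos_sq (g / 2)
  rw [h1]
  generalize Real.sin (g / 2) = s at *
  generalize Real.cos (g / 2) = c at *
  push_cast
  field_simp
  have hI : Complex.I ^ 2 = -1 := Complex.I_sq
  have h4 : (c : ℂ) ^ 2 = 1 - s ^ 2 := by rw [← h3]; ring
  linear_combination (-(s : ℂ) ^ 3 - Complex.I * s ^ 2 * c - 2 * s * c ^ 2) * hI +
    ((s : ℂ) - Complex.I * c) * h4

theorem cot_half_le {x y : ℝ} (hxy : x ≤ y) (hπ : y - x ≤ Real.pi)
    (hs : 0 < Real.sin x * Real.sin y) :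
    Real.cos y / (2 * Real.sin y) ≤ Real.cos x / (2 * Real.sin x) := by
  have hx : Real.sin x ≠ 0 := by rintro h; simp [h] at hs
  have hy : Real.sin y ≠ 0 := by rintro h; simp [h] at hs
  rw [← sub_nonneg]
  have : Real.cos x / (2 * Real.sin x) - Real.cos y / (2 * Real.sin y) =
      Real.sin (y - x) / (2 * (Real.sin x * Real.sin y)) := by
    rw [Real.sin_sub]
    field_simp
  rw [this]
  have := Real.sin_nonneg_of_nonneg_of_le_pi (sub_nonneg.2 hxy) hπ
  positivity

/-- Summation by parts behind the Kuzmin–Landau inequality: writing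
`e^{iF(k)} = z_k (e^{iF(k+1)} - e^{iF(k)})`, the numbers `z_k` have constant real part, so that the
error is controlled by the variation of their imaginary parts. -/
theorem norm_sum_exp_sub_le (F Y : ℕ → ℝ) (z : ℕ → ℂ) (a n : ℕ)
    (hzY : ∀ k, z k = -(1 / 2) - Complex.I * (Y k : ℂ))
    (hz : ∀ k, a ≤ k → k ≤ a + n → z k * (Complex.exp ((F (k + 1) - F k : ℝ) * Complex.I) - 1) = 1)
    (hY : ∀ k, a ≤ k → k < a + n → Y k ≤ Y (k + 1)) :
    ‖∑ k ∈ Finset.Ico a (a + n + 1), Complex.exp (F k * Complex.I)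
        - z (a + n) * Complex.exp (F (a + n + 1) * Complex.I) + z a * Complex.exp (F a * Complex.I)‖
      ≤ Y (a + n) - Y a := by
  have key : ∀ k, a ≤ k → k ≤ a + n → Complex.exp (F k * Complex.I) =
      z k * (Complex.exp (F (k + 1) * Complex.I) - Complex.exp (F k * Complex.I)) := by
    intro k h1 h2
    have h3 := hz k h1 h2
    have h4 : Complex.exp (F (k + 1) * Complex.I) =
        Complex.exp ((F (k + 1) - F k : ℝ) * Complex.I) * Complex.exp (F k * Complex.I) := by
      rw [← Complex.exp_add]
      congr 1
      push_cast
      ring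
    rw [h4]
    linear_combination (-Complex.exp (F k * Complex.I)) * h3
  induction n with
  | zero =>
    have := key a le_rfl (by simp)
    simp only [add_zero, Nat.Ico_succ_singleton, Finset.sum_singleton, sub_self]
    rw [norm_le_zero_iff]
    linear_combination this
  | succ n ih =>
    have ih' := ih (fun k h1 h2 => hz k h1 (by omega)) (fun k h1 h2 => hY k h1 (by omega))
      (fun k h1 h2 => key k h1 (by omega))
    have hk := key (a + n + 1) (by omega) (by omega)
    have hYs := hY (a + n) (by omega) (by omega)
    have e1 : ∑ k ∈ Finset.Ico a (a + (n + 1) + 1), Complex.exp (F k * Complex.I)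
        - z (a + (n + 1)) * Complex.exp (F (a + (n + 1) + 1) * Complex.I)
        + z a * Complex.exp (F a * Complex.I) =
        (∑ k ∈ Finset.Ico a (a + n + 1), Complex.exp (F k * Complex.I)
        - z (a + n) * Complex.exp (F (a + n + 1) * Complex.I) + z a * Complex.exp (F a * Complex.I))
        + (z (a + n) - z (a + n + 1)) * Complex.exp (F (a + n + 1) * Complex.I) := by
      rw [← add_assoc, Finset.sum_Ico_succ_top (by omega)]
      linear_combination hk
    rw [e1]
    refine (norm_add_le _ _).trans ?_
    rw [norm_mul, Complex.norm_exp_ofReal_mul_I, mul_one]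
    have e2 : z (a + n) - z (a + n + 1)
        = Complex.I * ((Y (a + n + 1) - Y (a + n) : ℝ) : ℂ) := by
      rw [hzY, hzY]
      push_cast
      ring
    rw [e2, norm_mul, Complex.norm_I, one_mul, Complex.norm_real, Real.norm_eq_abs,
      abs_of_nonneg (by linarith), ← add_assoc]
    linarith

theorem div_five_le_sin {x : ℝ} (h0 : 0 ≤ x) (h1 : x ≤ 3 * Real.pi / 4) : x / 5 ≤ Real.sin x := by
  have hπ := Real.pi_gt_three
  have hπ' := Real.pi_lt_four
  rcases le_total x (Real.pi / 2) with h | h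
  · refine le_trans ?_ (Real.mul_le_sin h0 h)
    rw [div_eq_inv_mul]
    gcongr
    rw [inv_eq_one_div, div_le_div_iff₀ (by norm_num) (by linarith)]
    linarith
  · rw [← Real.sin_pi_sub]
    refine le_trans ?_ (Real.mul_le_sin (by linarith) (by linarith))
    rw [div_mul_eq_mul_div, div_le_div_iff₀ (by norm_num) (by linarith)]
    have hπ2 := Real.pi_lt_d2
    have h2 := mul_le_mul_of_nonneg_right h1 (show 0 ≤ 10 + Real.pi by linarith)
    nlinarith

/-- The Kuzmin–Landau inequality: an exponential sum whose phase increments decrease, have a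
constant sign and stay between `θ` and `3π / 2` in absolute value, is `O(1 / θ)`. -/
theorem norm_sum_exp_le_of_increments (F : ℕ → ℝ) (a b : ℕ) (θ : ℝ) (hθ : 0 < θ)
    (hanti : ∀ k l, a ≤ k → k ≤ l → l < b → F (l + 1) - F l ≤ F (k + 1) - F k)
    (hg : (∀ k, a ≤ k → k < b → θ ≤ F (k + 1) - F k ∧ F (k + 1) - F k ≤ 3 * Real.pi / 2) ∨
      (∀ k, a ≤ k → k < b → F (k + 1) - F k ≤ -θ ∧ -(3 * Real.pi / 2) ≤ F (k + 1) - F k)) :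
    ‖∑ k ∈ Finset.Ico a b, Complex.exp (F k * Complex.I)‖ ≤ 20 / θ := by
  rcases Nat.lt_or_ge a b with hab | hab
  swap
  · rw [Finset.Ico_eq_empty_of_le hab]
    simp only [Finset.sum_empty, norm_zero]
    positivity
  obtain ⟨n, rfl⟩ : ∃ n, b = a + n + 1 := ⟨b - a - 1, by omega⟩
  set g : ℕ → ℝ := fun k => F (k + 1) - F k with hgdef
  set Y : ℕ → ℝ := fun k => Real.cos (g k / 2) / (2 * Real.sin (g k / 2)) with hYdef
  have hπ := Real.pi_pos
  -- the increments have a constant sign, and so do the sines of their halves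
  have hpair : ∀ k l, a ≤ k → k < a + n + 1 → a ≤ l → l < a + n + 1 →
      0 < Real.sin (g k / 2) * Real.sin (g l / 2) ∧ |g k - g l| ≤ 2 * Real.pi ∧
        θ / 10 ≤ |Real.sin (g k / 2)| := by
    intro k l hk hk' hl hl'
    rcases hg with hg | hg
    · have h1 := hg k hk hk'
      have h2 := hg l hl hl'
      change θ ≤ g k ∧ g k ≤ _ at h1
      change θ ≤ g l ∧ g l ≤ _ at h2
      have s1 := div_five_le_sin (x := g k / 2) (by linarith) (by linarith)
      have s2 := div_five_le_sin (x := g l / 2) (by linarith) (by linarith)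
      refine ⟨mul_pos (by linarith) (by linarith), ?_, ?_⟩
      · rw [abs_le]; constructor <;> linarith
      · exact le_trans (by linarith) (le_abs_self _)
    · have h1 := hg k hk hk'
      have h2 := hg l hl hl'
      change g k ≤ -θ ∧ _ ≤ g k at h1
      change g l ≤ -θ ∧ _ ≤ g l at h2
      have s1 := div_five_le_sin (x := -(g k / 2)) (by linarith) (by linarith)
      have s2 := div_five_le_sin (x := -(g l / 2)) (by linarith) (by linarith)
      rw [Real.sin_neg] at s1 s2
      refine ⟨mul_pos_of_neg_of_neg (by linarith) (by linarith), ?_, ?_⟩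
      · rw [abs_le]; constructor <;> linarith
      · exact le_trans (by linarith) (neg_le_abs _)
  have hne : ∀ k, a ≤ k → k < a + n + 1 → Real.sin (g k / 2) ≠ 0 := by
    intro k h1 h2 h3
    have := (hpair k k h1 h2 h1 h2).1
    simp [h3] at this
  have hbound : ∀ k, a ≤ k → k < a + n + 1 → |Y k| ≤ 5 / θ := by
    intro k h1 h2
    have h3 := (hpair k k h1 h2 h1 h2).2.2
    rw [hYdef]
    simp only [abs_div, abs_mul, abs_two]
    have h4 := abs_pos.2 (hne k h1 h2)
    rw [div_le_div_iff₀ (by positivity) hθ]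
    nlinarith [Real.abs_cos_le_one (g k / 2)]
  have hzbound : ∀ k, a ≤ k → k < a + n + 1 →
      ‖(-(1 / 2) - Complex.I * (Y k : ℂ) : ℂ)‖ ≤ 5 / θ := by
    intro k h1 h2
    have h3 := (hpair k k h1 h2 h1 h2).2.2
    have h4 := inv_exp_sub_one (hne k h1 h2)
    have h5 : Real.sin (g k / 2) ≠ 0 := hne k h1 h2
    have h6 : ‖(-(1 / 2) - Complex.I * (Y k : ℂ) : ℂ)‖ * (2 * |Real.sin (g k / 2)|) ≤ 1 := by
      have h7 : (2 * (Real.sin (g k / 2) : ℂ)) * (-(1 / 2) - Complex.I * (Y k : ℂ)) =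
          -(Complex.I * Complex.exp ((-(g k / 2) : ℝ) * Complex.I)) := by
        rw [hYdef, Complex.exp_mul_I, ← Complex.ofReal_cos, ← Complex.ofReal_sin, Real.cos_neg,
          Real.sin_neg]
        have h8 : ((Real.sin (g k / 2) : ℝ) : ℂ) ≠ 0 := by exact_mod_cast h5
        simp only [Complex.ofReal_div, Complex.ofReal_mul, Complex.ofReal_neg, Complex.ofReal_ofNat]
          at h8 ⊢
        field_simp
        linear_combination (-((Real.sin (g k / 2) : ℝ) : ℂ)) * Complex.I_sq
      have h9 := congrArg norm h7
      rw [norm_neg, norm_mul, norm_mul, norm_mul, Complex.norm_exp_ofReal_mul_I, Complex.norm_I,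
        Complex.norm_real, Real.norm_eq_abs] at h9
      simp only [Complex.norm_ofNat] at h9
      rw [mul_comm]
      linarith
    rw [le_div_iff₀ hθ]
    nlinarith [norm_nonneg (-(1 / 2) - Complex.I * (Y k : ℂ) : ℂ)]
  have hmain := norm_sum_exp_sub_le F Y (fun k => -(1 / 2) - Complex.I * (Y k : ℂ)) a n
    (fun k => rfl) (fun k h1 h2 => inv_exp_sub_one (hne k h1 (by omega)))
    (by
      intro k h1 h2
      have h3 := hpair (k + 1) k (by omega) (by omega) h1 (by omega)
      have h4 : g (k + 1) ≤ g k := hanti k (k + 1) h1 (by omega) (by omega)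
      have h5 := abs_le.1 h3.2.1
      exact cot_half_le (by linarith) (by linarith) h3.1)
  have hb1 := hbound a le_rfl (by omega)
  have hb2 := hbound (a + n) (by omega) (by omega)
  have hz1 := hzbound a le_rfl (by omega)
  have hz2 := hzbound (a + n) (by omega) (by omega)
  set S := ∑ k ∈ Finset.Ico a (a + n + 1), Complex.exp (F k * Complex.I)
  set w1 := (-(1 / 2) - Complex.I * (Y (a + n) : ℂ)) * Complex.exp (F (a + n + 1) * Complex.I)
    with hw1
  set w2 := (-(1 / 2) - Complex.I * (Y a : ℂ)) * Complex.exp (F a * Complex.I) with hw2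
  have n1 : ‖w1‖ ≤ 5 / θ := by
    rw [hw1, norm_mul, Complex.norm_exp_ofReal_mul_I, mul_one]; exact hz2
  have n2 : ‖w2‖ ≤ 5 / θ := by
    rw [hw2, norm_mul, Complex.norm_exp_ofReal_mul_I, mul_one]; exact hz1
  have e : S = (S - w1 + w2) + w1 - w2 := by ring
  have e2 : (20 : ℝ) / θ = 5 / θ + 5 / θ + 5 / θ + 5 / θ := by ring
  rw [e]
  have t1 := norm_sub_le ((S - w1 + w2) + w1) w2
  have t2 := norm_add_le (S - w1 + w2) w1
  have t3 := abs_le.1 hb1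
  have t4 := abs_le.1 hb2
  linarith

theorem exists_threshold {P : ℕ → Prop} {a b : ℕ} (hab : a ≤ b)
    (hP : ∀ k l, a ≤ k → k ≤ l → l < b → P l → P k) :
    ∃ p, a ≤ p ∧ p ≤ b ∧ (∀ k, a ≤ k → k < p → P k) ∧ ∀ k, p ≤ k → k < b → ¬P k := by
  classical
  have hex : ∃ p, a ≤ p ∧ (p = b ∨ ¬P p) := ⟨b, hab, Or.inl rfl⟩
  have hle : Nat.find hex ≤ b := Nat.find_min' hex ⟨hab, Or.inl rfl⟩
  refine ⟨Nat.find hex, (Nat.find_spec hex).1, hle, ?_, ?_⟩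
  · intro k h1 h2
    have := Nat.find_min hex h2
    tauto
  · intro k h1 h2 h3
    rcases (Nat.find_spec hex).2 with h | h
    · omega
    · exact h (hP _ k (Nat.find_spec hex).1 h1 h2 h3)

/-- An exponential sum with decreasing phase increments is bounded through the length `m` of the
range on which the increments are smaller than `θ`. -/
theorem norm_sum_exp_le_of_sublevel (F : ℕ → ℝ) (a b : ℕ) (θ m : ℝ) (hθ : 0 < θ) (hm : 0 ≤ m)
    (hanti : ∀ k l, a ≤ k → k ≤ l → l < b → F (l + 1) - F l ≤ F (k + 1) - F k)
    (hg : ∀ k, a ≤ k → k < b → |F (k + 1) - F k| ≤ 3 * Real.pi / 2)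
    (hcount : ∀ k l, a ≤ k → k ≤ l → l < b → |F (k + 1) - F k| < θ → |F (l + 1) - F l| < θ →
      (l : ℝ) - k ≤ m) :
    ‖∑ k ∈ Finset.Ico a b, Complex.exp (F k * Complex.I)‖ ≤ 40 / θ + (m + 1) := by
  rcases Nat.lt_or_ge a b with hab | hab
  swap
  · rw [Finset.Ico_eq_empty_of_le hab]
    simp only [Finset.sum_empty, norm_zero]
    positivity
  obtain ⟨p, hp1, hp2, hp3, hp4⟩ := exists_threshold (P := fun k => θ ≤ F (k + 1) - F k) hab.le
    (fun k l h1 h2 h3 h4 => le_trans h4 (hanti k l h1 h2 h3))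
  obtain ⟨q, hq1, hq2, hq3, hq4⟩ := exists_threshold (P := fun k => -θ < F (k + 1) - F k) hp2
    (fun k l h1 h2 h3 h4 => lt_of_lt_of_le h4 (hanti k l (by omega) h2 h3))
  rw [← Finset.sum_Ico_consecutive _ hp1 hp2, ← Finset.sum_Ico_consecutive _ hq1 hq2]
  have b1 := norm_sum_exp_le_of_increments F a p θ hθ
    (fun k l h1 h2 h3 => hanti k l h1 h2 (by omega))
    (Or.inl fun k h1 h2 => ⟨hp3 k h1 h2, (le_abs_self _).trans (hg k h1 (by omega))⟩)
  have b3 := norm_sum_exp_le_of_increments F q b θ hθ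
    (fun k l h1 h2 h3 => hanti k l (by omega) h2 (by omega))
    (Or.inr fun k h1 h2 => ⟨not_lt.1 (hq4 k h1 h2), (abs_le.1 (hg k (by omega) h2)).1⟩)
  have b2 : ‖∑ k ∈ Finset.Ico p q, Complex.exp (F k * Complex.I)‖ ≤ m + 1 := by
    refine (norm_sum_le _ _).trans ?_
    simp only [Complex.norm_exp_ofReal_mul_I, Finset.sum_const, Nat.card_Ico, nsmul_eq_mul, mul_one]
    rcases Nat.lt_or_ge p q with hpq | hpq
    · have habs : ∀ k, p ≤ k → k < q → |F (k + 1) - F k| < θ := fun k h1 h2 =>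
        abs_lt.2 ⟨hq3 k h1 h2, not_le.1 (hp4 k h1 (by omega))⟩
      have := hcount p (q - 1) hp1 (by omega) (by omega) (habs p le_rfl hpq)
        (habs (q - 1) (by omega) (by omega))
      rw [Nat.cast_sub (by omega)] at this
      rw [Nat.cast_sub hpq.le]
      push_cast at this
      linarith
    · rw [Nat.sub_eq_zero_of_le hpq]
      simp only [Nat.cast_zero]
      positivity
  refine (norm_add_le _ _).trans ?_
  have := norm_add_le (∑ k ∈ Finset.Ico p q, Complex.exp (F k * Complex.I))
    (∑ k ∈ Finset.Ico q b, Complex.exp (F k * Complex.I))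
  have e2 : (40 : ℝ) / θ = 20 / θ + 20 / θ := by ring
  linarith

/-! ### Exponential sums of the lattice dispersion relation -/

theorem sq_div_le_sin_sub_sin {x y X : ℝ} (hx : 0 ≤ x) (hxy : x ≤ y) (hyX : y ≤ X) (hX : 0 < X)
    (hX2 : X ≤ Real.pi / 2) : (y - x) ^ 2 / (Real.pi * X) ≤ Real.sin y - Real.sin x := by
  have hπ := Real.pi_pos
  rw [Real.sin_sub_sin]
  have h1 : (y - x) / Real.pi ≤ Real.sin ((y - x) / 2) := by
    refine le_trans (le_of_eq ?_) (Real.mul_le_sin (by linarith) (by linarith))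
    field_simp
  have h2 : (y - x) / (2 * X) ≤ Real.cos ((y + x) / 2) := by
    refine le_trans ?_ (Real.one_sub_mul_le_cos (by linarith) (by linarith))
    have h3 : (y + x) / 2 ≤ X - (y - x) / 2 := by linarith
    have h4 : 1 - 2 / Real.pi * (X - (y - x) / 2) ≤ 1 - 2 / Real.pi * ((y + x) / 2) := by gcongr
    refine le_trans ?_ h4
    have h5 : 1 - 2 / Real.pi * (X - (y - x) / 2) - (y - x) / (2 * X) =
        (Real.pi - 2 * X) * (2 * X - (y - x)) / (2 * X * Real.pi) := by
      field_simp
      ring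
    have h6 : 0 ≤ (Real.pi - 2 * X) * (2 * X - (y - x)) / (2 * X * Real.pi) :=
      div_nonneg (mul_nonneg (by linarith) (by linarith)) (by positivity)
    linarith
  calc (y - x) ^ 2 / (Real.pi * X) = 2 * ((y - x) / Real.pi) * ((y - x) / (2 * X)) := by
        field_simp
    _ ≤ 2 * Real.sin ((y - x) / 2) * Real.cos ((y + x) / 2) := by
        have : 0 ≤ (y - x) / Real.pi := div_nonneg (by linarith) hπ.le
        have : 0 ≤ (y - x) / (2 * X) := div_nonneg (by linarith) (by linarith)
        have : 0 ≤ Real.sin ((y - x) / 2) := by linarith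
        gcongr

/-- The phase increments of the lattice dispersion relation. -/
theorem cos_phase_increment (θ T L : ℝ) (k : ℕ) :
    (θ * ((k + 1 : ℕ) : ℝ) + T * Real.cos (Real.pi * ((k + 1 : ℕ) : ℝ) / L)) -
      (θ * (k : ℝ) + T * Real.cos (Real.pi * (k : ℝ) / L)) =
    θ - 2 * T * Real.sin (Real.pi / L / 2) * Real.sin (Real.pi / L * (k + 1 / 2)) := by
  have := Real.cos_sub_cos (Real.pi * ((k + 1 : ℕ) : ℝ) / L) (Real.pi * (k : ℝ) / L)
  have e1 : (Real.pi * ((k + 1 : ℕ) : ℝ) / L + Real.pi * (k : ℝ) / L) / 2 =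
    Real.pi / L * (k + 1 / 2) := by push_cast; ring
  have e2 : (Real.pi * ((k + 1 : ℕ) : ℝ) / L - Real.pi * (k : ℝ) / L) / 2 =
    Real.pi / L / 2 := by push_cast; ring
  rw [e1, e2] at this
  push_cast at this ⊢
  linear_combination T * this

theorem one_le_mul_rpow_third {R N t : ℝ} (hR : 1 ≤ R) (hN : 1 ≤ N) (ht : 0 < t)
    (htN : t * N ≤ 2 * R) : 1 ≤ 2 * (R * (N / t) ^ ((1 : ℝ) / 3)) := by
  set ρ : ℝ := (N / t) ^ ((1 : ℝ) / 3) with hρ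
  have hρ0 : 0 < ρ := by positivity
  have hρ3 : ρ ^ 3 = N / t := by
    rw [hρ, ← Real.rpow_natCast, ← Real.rpow_mul (by positivity)]
    norm_num
  have hρt : t * ρ ^ 3 = N := by rw [hρ3]; field_simp
  have h1 : t ≤ 2 * R := by nlinarith
  have h2 : 1 ≤ (2 * (R * ρ)) ^ 3 := by
    have h3 : t ≤ t * (2 * (R * ρ)) ^ 3 := by
      have e : t * (2 * (R * ρ)) ^ 3 = 8 * R ^ 3 * N := by rw [← hρt]; ring
      rw [e]
      nlinarith [pow_le_pow_right₀ hR (show 1 ≤ 3 by norm_num), pow_pos (by linarith : 0 < R) 3]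
    exact le_of_mul_le_mul_left (by linarith) ht
  by_contra hlt
  push Not at hlt
  have := pow_lt_one₀ (by positivity) hlt (show 3 ≠ 0 by norm_num)
  linarith

/-- Over a range of `m` frequencies up to `b` the sine in the phase increments varies by at least
`(δ m) ^ 2 / (π δ b)`; if the increments vary by at most `2 / (R ρ)`, then `m` is `O(R ρ)`. -/
theorem sublevel_length_le {R ρ b δ t T B N m : ℝ} (hR : 0 < R) (hρ : 0 < ρ) (hb : 0 < b)
    (hδ : 0 < δ) (ht : 0 < t) (hTδ : T * δ ^ 2 = t / (2 * R ^ 2)) (hB : 2 * T * δ / Real.pi ≤ B)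
    (hbN : b ≤ R * N) (hρt : t * ρ ^ 3 = N)
    (h : B * ((δ * m) ^ 2 / (Real.pi * (δ * b))) ≤ 2 * (1 / (R * ρ))) : m ≤ 5 * (R * ρ) := by
  have hπ := Real.pi_pos
  have hπ3 := Real.pi_gt_three
  have h3 : t * m ^ 2 / (Real.pi ^ 2 * R ^ 2 * b) ≤ 2 * (1 / (R * ρ)) := by
    refine le_trans (le_of_eq ?_) (le_trans (mul_le_mul_of_nonneg_right hB (by positivity)) h)
    have e : t = 2 * R ^ 2 * (T * δ ^ 2) := by rw [hTδ]; field_simp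
    rw [e]
    field_simp
  have h5 : t * m ^ 2 ≤ 2 * (1 / (R * ρ)) * (Real.pi ^ 2 * R ^ 2 * b) := by
    rwa [div_le_iff₀ (by positivity)] at h3
  have h6 : 2 * (1 / (R * ρ)) * (Real.pi ^ 2 * R ^ 2 * b) ≤
      2 * (1 / (R * ρ)) * (Real.pi ^ 2 * R ^ 2 * (R * N)) := by gcongr
  have h7 : 2 * (1 / (R * ρ)) * (Real.pi ^ 2 * R ^ 2 * (R * N)) =
      t * (2 * Real.pi ^ 2 * (R * ρ) ^ 2) := by
    rw [← hρt]; field_simp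
  have h8 : m ^ 2 ≤ 2 * Real.pi ^ 2 * (R * ρ) ^ 2 :=
    le_of_mul_le_mul_left (by linarith) ht
  have h9 : Real.pi ^ 2 ≤ 12 := by nlinarith [Real.pi_lt_d2]
  have h4 : m ^ 2 ≤ (5 * (R * ρ)) ^ 2 := by nlinarith [sq_nonneg (R * ρ)]
  exact (le_abs_self m).trans (abs_le_of_sq_le_sq h4 (by positivity))

/-- Bound for the exponential sum over frequencies at most `R N` in the lower half of the spectrum.
The increments of the phase are decreasing; the terms at which they are within
`(t / N) ^ (1 / 3) / R` of a multiple of `2π` are counted trivially, and this level balances the two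
contributions. -/
theorem norm_sum_cos_phase_half_le (K R a b : ℕ) (hK : 0 < K) (hR : 0 < R) (N t θ : ℝ) (hN : 1 ≤ N)
    (hb : b ≤ K * R) (hbN : (b : ℝ) ≤ R * N) (ht : 0 < t) (htN : t * N ≤ 2 * R) :
    ‖∑ k ∈ Finset.Ico a b, Complex.exp (((θ * k + 2 * t * K ^ 2 / Real.pi ^ 2 *
        Real.cos (Real.pi * k / (2 * K * R)) : ℝ) : ℂ) * Complex.I)‖
      ≤ 47 * (R * (N / t) ^ ((1 : ℝ) / 3)) := by
  have hπ := Real.pi_pos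
  have hπ3 := Real.pi_gt_three
  have hK' : (0 : ℝ) < K := by exact_mod_cast hK
  have hR' : (0 : ℝ) < R := by exact_mod_cast hR
  have hR1 : (1 : ℝ) ≤ R := by exact_mod_cast hR
  set ρ : ℝ := (N / t) ^ ((1 : ℝ) / 3) with hρ
  have hρ0 : 0 < ρ := by positivity
  have hρ3 : ρ ^ 3 = N / t := by
    rw [hρ, ← Real.rpow_natCast, ← Real.rpow_mul (by positivity)]
    norm_num
  have hρt : t * ρ ^ 3 = N := by rw [hρ3]; field_simp
  have hone : 1 ≤ 2 * (R * ρ) := one_le_mul_rpow_third hR1 hN ht htN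
  rcases Nat.lt_or_ge a b with hab | hab
  swap
  · rw [Finset.Ico_eq_empty_of_le hab]
    simp only [Finset.sum_empty, norm_zero]
    positivity
  have hb0 : (0 : ℝ) < b := by exact_mod_cast (by omega : 0 < b)
  set L : ℝ := 2 * K * R with hL
  have hL0 : 0 < L := by positivity
  set T : ℝ := 2 * t * K ^ 2 / Real.pi ^ 2 with hT
  have hT0 : 0 < T := by positivity
  set δ : ℝ := Real.pi / L with hδ
  have hδ0 : 0 < δ := by positivity
  have hδb : δ * b ≤ Real.pi / 2 := by
    have : (b : ℝ) ≤ K * R := by exact_mod_cast hb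
    rw [hδ, hL, div_mul_eq_mul_div, div_le_div_iff₀ (by positivity) (by norm_num)]
    nlinarith
  have hδ2 : δ / 2 ≤ Real.pi / 2 := by
    have : (1 : ℝ) ≤ b := by exact_mod_cast (by omega : 1 ≤ b)
    nlinarith
  have hTδ : T * δ ^ 2 = t / (2 * R ^ 2) := by
    rw [hT, hδ, hL]
    field_simp
  set B : ℝ := 2 * T * Real.sin (δ / 2) with hB
  have hB1 : B ≤ T * δ := by
    have := Real.sin_le (show 0 ≤ δ / 2 by positivity)
    rw [hB]
    nlinarith
  have hB2 : 2 * T * δ / Real.pi ≤ B := by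
    have := Real.mul_le_sin (show 0 ≤ δ / 2 by positivity) hδ2
    calc 2 * T * δ / Real.pi = 2 * T * (2 / Real.pi * (δ / 2)) := by field_simp
      _ ≤ B := by rw [hB]; gcongr
  have hB0 : 0 < B := lt_of_lt_of_le (by positivity) hB2
  -- translate `θ` by a multiple of `2π` into `[-π, π]`
  set j : ℤ := round (θ / (2 * Real.pi)) with hj
  set θ' : ℝ := θ - 2 * Real.pi * j with hθ'
  have hθ'abs : |θ'| ≤ Real.pi := by
    have h1 := abs_sub_round (θ / (2 * Real.pi))
    have e : θ' = 2 * Real.pi * (θ / (2 * Real.pi) - round (θ / (2 * Real.pi))) := by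
      rw [hθ', hj]; field_simp
    rw [e, abs_mul, abs_of_pos (by positivity)]
    nlinarith
  set F : ℕ → ℝ := fun k => θ' * k + T * Real.cos (Real.pi * k / L) with hF
  have hsum : ∑ k ∈ Finset.Ico a b, Complex.exp (((θ * k + T * Real.cos (Real.pi * k / L) : ℝ) : ℂ)
      * Complex.I) = ∑ k ∈ Finset.Ico a b, Complex.exp (F k * Complex.I) := by
    refine Finset.sum_congr rfl fun k _ => ?_
    have e : ((θ * k + T * Real.cos (Real.pi * k / L) : ℝ) : ℂ) * Complex.I =
        F k * Complex.I + ((j * k : ℤ) : ℂ) * (2 * Real.pi * Complex.I) := by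
      rw [hF, hθ']
      push_cast
      ring
    rw [e, Complex.exp_add, Complex.exp_int_mul_two_pi_mul_I, mul_one]
  rw [hsum]
  have hincr : ∀ k, F (k + 1) - F k = θ' - B * Real.sin (δ * (k + 1 / 2)) := fun k =>
    cos_phase_increment θ' T L k
  clear_value F B T δ ρ θ'
  have hrange : ∀ k : ℕ, k < b → δ * (k + 1 / 2) ≤ δ * b := by
    intro k hk
    have : (k : ℝ) + 1 ≤ b := by exact_mod_cast hk
    gcongr
    linarith
  have hmono : ∀ k l : ℕ, k ≤ l → δ * (k + 1 / 2) ≤ δ * (l + 1 / 2) := by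
    intro k l hkl
    have : (k : ℝ) ≤ l := by exact_mod_cast hkl
    gcongr
  refine (norm_sum_exp_le_of_sublevel F a b (1 / (R * ρ)) (5 * (R * ρ)) (by positivity)
    (by positivity) ?_ ?_ ?_).trans ?_
  · intro k l _ hkl hl
    rw [hincr, hincr]
    have := Real.sin_le_sin_of_le_of_le_pi_div_two
      (show -(Real.pi / 2) ≤ δ * ((k : ℝ) + 1 / 2) by
        have : 0 ≤ δ * ((k : ℝ) + 1 / 2) := by positivity
        linarith) ((hrange l hl).trans hδb) (hmono k l hkl)
    have := mul_le_mul_of_nonneg_left this hB0.le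
    linarith
  · intro k _ hk
    rw [hincr]
    have h0 : 0 ≤ δ * ((k : ℝ) + 1 / 2) := by positivity
    have h1 := (hrange k hk)
    have h2 := Real.sin_nonneg_of_nonneg_of_le_pi h0 (by linarith)
    -- up to the crossing time the increments deviate from `θ'` by at most `1`, so that `0` is the
    -- only multiple of `2π` they can approach
    have h3 : B * Real.sin (δ * (k + 1 / 2)) ≤ 1 := by
      calc B * Real.sin (δ * (k + 1 / 2)) ≤ (T * δ) * (δ * b) := by
            gcongr
            exact (Real.sin_le h0).trans h1
        _ = t * b / (2 * R ^ 2) := by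
            have : (T * δ) * (δ * b) = (T * δ ^ 2) * b := by ring
            rw [this, hTδ]; ring
        _ ≤ 1 := by
            rw [div_le_one (by positivity)]
            calc t * b ≤ t * (R * N) := by gcongr
              _ = R * (t * N) := by ring
              _ ≤ R * (2 * R) := by gcongr
              _ = 2 * R ^ 2 := by ring
    have h4 : 0 ≤ B * Real.sin (δ * (k + 1 / 2)) := by positivity
    have h5 := abs_le.1 hθ'abs
    rw [abs_le]
    constructor <;> linarith
  · intro k l _ hkl hl hk1 hl1
    rw [hincr, abs_lt] at hk1 hl1
    have h1 := sq_div_le_sin_sub_sin (show 0 ≤ δ * ((k : ℝ) + 1 / 2) by positivity) (hmono k l hkl)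
      (hrange l hl) (by positivity) hδb
    have h2 : B * ((δ * (l + 1 / 2) - δ * (k + 1 / 2)) ^ 2 / (Real.pi * (δ * b))) ≤
        2 * (1 / (R * ρ)) := by
      have := mul_le_mul_of_nonneg_left h1 hB0.le
      linarith [hk1.1, hk1.2, hl1.1, hl1.2]
    have e : δ * ((l : ℝ) + 1 / 2) - δ * ((k : ℝ) + 1 / 2) = δ * ((l : ℝ) - k) := by ring
    rw [e] at h2
    exact sublevel_length_le hR' hρ0 hb0 hδ0 ht hTδ hB2 hbN hρt h2
  · have e : 40 / (1 / (R * ρ)) = 40 * (R * ρ) := by field_simp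
    rw [e]
    linarith

/-- Bound for the exponential sum over all frequencies `1, …, n` with `n ≤ R N`. -/
theorem norm_sum_cos_phase_le (K R n : ℕ) (hK : 0 < K) (hR : 0 < R) (N t θ : ℝ) (hN : 1 ≤ N)
    (hn : n < 2 * (K * R)) (hnN : (n : ℝ) ≤ R * N) (ht : 0 < t) (htN : t * N ≤ R) :
    ‖∑ k ∈ Finset.Ico 1 (n + 1), Complex.exp (((θ * k + 2 * t * K ^ 2 / Real.pi ^ 2 *
        Real.cos (Real.pi * k / (2 * K * R)) : ℝ) : ℂ) * Complex.I)‖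
      ≤ 192 * (R * (N / t) ^ ((1 : ℝ) / 3)) := by
  have hK' : (0 : ℝ) < K := by exact_mod_cast hK
  have hR' : (0 : ℝ) < R := by exact_mod_cast hR
  have hR1 : (1 : ℝ) ≤ R := by exact_mod_cast hR
  set ρ : ℝ := (N / t) ^ ((1 : ℝ) / 3) with hρ
  have hρ0 : 0 < ρ := by positivity
  have hρ2 : (2 * N / t) ^ ((1 : ℝ) / 3) ≤ 2 * ρ := by
    rw [mul_div_assoc, Real.mul_rpow (by norm_num) (by positivity), ← hρ]
    gcongr
    exact (Real.rpow_le_rpow_of_exponent_le (by norm_num) (by norm_num)).trans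
      (le_of_eq (Real.rpow_one 2))
  have hone : 1 ≤ 2 * (R * ρ) := one_le_mul_rpow_third hR1 hN ht (by linarith)
  have half : ∀ (a b : ℕ) (φ : ℝ), b ≤ K * R → b ≤ n + 1 →
      ‖∑ k ∈ Finset.Ico a b, Complex.exp (((φ * k + 2 * t * K ^ 2 / Real.pi ^ 2 *
        Real.cos (Real.pi * k / (2 * K * R)) : ℝ) : ℂ) * Complex.I)‖ ≤ 94 * (R * ρ) := by
    intro a b φ hb hbn
    rcases Nat.lt_or_ge a b with hab | hab
    swap
    · rw [Finset.Ico_eq_empty_of_le hab]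
      simp only [Finset.sum_empty, norm_zero]
      positivity
    -- the factor `2` absorbs the off-by-one in `b ≤ n + 1`
    have hbN : (b : ℝ) ≤ R * (2 * N) := by
      have h1 : (b : ℝ) ≤ n + 1 := by exact_mod_cast hbn
      nlinarith
    refine (norm_sum_cos_phase_half_le K R a b hK hR (2 * N) t φ (by linarith) hb hbN ht
      (by linarith)).trans ?_
    have := mul_le_mul_of_nonneg_left hρ2 hR'.le
    linarith
  rcases Nat.lt_or_ge n (K * R) with hlt | hge
  · refine (half 1 (n + 1) θ hlt le_rfl).trans ?_
    nlinarith
  have hKR : 0 < K * R := Nat.mul_pos hK hR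
  rw [← Finset.sum_Ico_consecutive _ (show 1 ≤ K * R by omega) (show K * R ≤ n + 1 by omega),
    Finset.sum_eq_sum_Ico_succ_bot (show K * R < n + 1 by omega)]
  have e1 : n + 1 = 2 * (K * R) + 1 - (2 * (K * R) - n) := by omega
  have e2 : K * R + 1 = 2 * (K * R) + 1 - K * R := by omega
  -- the reflection `k ↦ 2KR - k` maps the upper half of the spectrum to the lower half
  have upper : ‖∑ k ∈ Finset.Ico (K * R + 1) (n + 1), Complex.exp (((θ * k +
      2 * t * K ^ 2 / Real.pi ^ 2 * Real.cos (Real.pi * k / (2 * K * R)) : ℝ) : ℂ) * Complex.I)‖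
      ≤ 94 * (R * ρ) := by
    rw [e1, e2, ← Finset.sum_Ico_reflect _ _ (by omega : K * R ≤ 2 * (K * R) + 1)]
    refine le_trans (le_of_eq ?_) (half (2 * (K * R) - n) (K * R) θ le_rfl (by omega))
    rw [← Complex.norm_conj (∑ k ∈ Finset.Ico (2 * (K * R) - n) (K * R), _),
      ← one_mul ‖starRingEnd ℂ _‖,
      ← Complex.norm_exp_ofReal_mul_I (θ * (2 * K * R)), ← norm_mul, map_sum, Finset.mul_sum]
    congr 1
    refine Finset.sum_congr rfl fun k hk => ?_
    rw [Finset.mem_Ico] at hk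
    rw [← Complex.exp_conj, ← Complex.exp_add]
    congr 1
    rw [map_mul, Complex.conj_I, Complex.conj_ofReal, Nat.cast_sub (by omega)]
    have e3 : Real.pi * (((2 * (K * R) : ℕ) : ℝ) - k) / (2 * K * R) =
        Real.pi - Real.pi * k / (2 * K * R) := by
      push_cast
      field_simp
    rw [e3, Real.cos_pi_sub]
    push_cast
    ring
  have lower := half 1 (K * R) θ le_rfl (by omega)
  refine (norm_add_le _ _).trans ((add_le_add lower ((norm_add_le _ _).trans
    (add_le_add (le_of_eq (Complex.norm_exp_ofReal_mul_I _)) upper))).trans ?_)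
  linarith

/-- The one-dimensional Dirichlet kernel of the lattice Schrödinger flow, restricted to
the frequencies `1, …, n`, is dispersive for times up to the crossing time `R / N`. -/
theorem norm_sum_sin_mul_sin_le (K R n : ℕ) (hK : 0 < K) (hR : 0 < R) (N t x y : ℝ) (hN : 1 ≤ N)
    (hn : n < 2 * (K * R)) (hnN : (n : ℝ) ≤ R * N) (ht : t ≠ 0) (htN : |t| * N ≤ R) :
    ‖∑ k ∈ Finset.Icc 1 n, ((Real.sin (Real.pi * k * x / (2 * K * R)) : ℝ) : ℂ) *
        ((Real.sin (Real.pi * k * y / (2 * K * R)) : ℝ) : ℂ) *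
        Complex.exp (((-t * ((2 - 2 * Real.cos (Real.pi * k / (2 * K * R))) * K ^ 2 / Real.pi ^ 2)
          : ℝ) : ℂ) * Complex.I)‖
      ≤ 192 * (R * (N / |t|) ^ ((1 : ℝ) / 3)) := by
  set L : ℝ := 2 * K * R with hL
  set bd : ℝ := 192 * (R * (N / |t|) ^ ((1 : ℝ) / 3)) with hbd
  set T : ℝ := 2 * t * K ^ 2 / Real.pi ^ 2 with hT
  have hst : ∀ φ : ℝ, ‖∑ k ∈ Finset.Icc 1 n, Complex.exp (((φ * k + T *
      Real.cos (Real.pi * k / L) : ℝ) : ℂ) * Complex.I)‖ ≤ bd := by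
    intro φ
    rw [show Finset.Icc 1 n = Finset.Ico 1 (n + 1) from rfl]
    rcases lt_or_gt_of_ne ht with h | h
    · rw [← Complex.norm_conj, map_sum]
      have := norm_sum_cos_phase_le K R n hK hR N |t| (-φ) hN hn hnN (abs_pos.2 ht) htN
      refine le_trans (le_of_eq ?_) this
      congr 1
      refine Finset.sum_congr rfl fun k _ => ?_
      rw [← Complex.exp_conj, map_mul, Complex.conj_I, Complex.conj_ofReal, abs_of_neg h, hT, hL]
      congr 1
      push_cast
      ring
    · have := norm_sum_cos_phase_le K R n hK hR N |t| φ hN hn hnN (abs_pos.2 ht) htN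
      rw [hbd, hT]
      rwa [abs_of_pos h] at this ⊢
  have e : ∀ k : ℕ, ((Real.sin (Real.pi * k * x / L) : ℝ) : ℂ) *
        ((Real.sin (Real.pi * k * y / L) : ℝ) : ℂ) *
        Complex.exp (((-t * ((2 - 2 * Real.cos (Real.pi * k / L)) * K ^ 2 / Real.pi ^ 2)
          : ℝ) : ℂ) * Complex.I) =
      Complex.exp (((-T : ℝ) : ℂ) * Complex.I) * ((1 / 4) *
        (Complex.exp (((Real.pi * (x - y) / L * k + T * Real.cos (Real.pi * k / L) : ℝ) : ℂ)
          * Complex.I)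
        + Complex.exp (((-(Real.pi * (x - y) / L) * k + T * Real.cos (Real.pi * k / L) : ℝ) : ℂ)
          * Complex.I)
        - Complex.exp (((Real.pi * (x + y) / L * k + T * Real.cos (Real.pi * k / L) : ℝ) : ℂ)
          * Complex.I)
        - Complex.exp (((-(Real.pi * (x + y) / L) * k + T * Real.cos (Real.pi * k / L) : ℝ) : ℂ)
          * Complex.I))) := by
    intro k
    have a1 : ((-t * ((2 - 2 * Real.cos (Real.pi * k / L)) * K ^ 2 / Real.pi ^ 2) : ℝ) : ℂ)
        * Complex.I = ((-T : ℝ) : ℂ) * Complex.I +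
          ((T * Real.cos (Real.pi * k / L) : ℝ) : ℂ) * Complex.I := by
      rw [hT]; push_cast; ring
    have a2 : ∀ φ : ℝ, Complex.exp (((φ * k + T * Real.cos (Real.pi * k / L) : ℝ) : ℂ)
        * Complex.I) = Complex.exp (((φ * k : ℝ) : ℂ) * Complex.I) *
          Complex.exp (((T * Real.cos (Real.pi * k / L) : ℝ) : ℂ) * Complex.I) := by
      intro φ
      rw [← Complex.exp_add]; congr 1; push_cast; ring
    rw [a1, Complex.exp_add, a2, a2, a2, a2, Complex.ofReal_sin, Complex.ofReal_sin, Complex.sin,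
      Complex.sin]
    have b1 : ((Real.pi * (x - y) / L * k : ℝ) : ℂ) * Complex.I =
        ((Real.pi * k * x / L : ℝ) : ℂ) * Complex.I + (-((Real.pi * k * y / L : ℝ) : ℂ)) * Complex.I
        := by push_cast; ring
    have b2 : ((-(Real.pi * (x - y) / L) * k : ℝ) : ℂ) * Complex.I =
        (-((Real.pi * k * x / L : ℝ) : ℂ)) * Complex.I + ((Real.pi * k * y / L : ℝ) : ℂ) * Complex.I
        := by push_cast; ring
    have b3 : ((Real.pi * (x + y) / L * k : ℝ) : ℂ) * Complex.I =
        ((Real.pi * k * x / L : ℝ) : ℂ) * Complex.I + ((Real.pi * k * y / L : ℝ) : ℂ) * Complex.I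
        := by push_cast; ring
    have b4 : ((-(Real.pi * (x + y) / L) * k : ℝ) : ℂ) * Complex.I =
        (-((Real.pi * k * x / L : ℝ) : ℂ)) * Complex.I +
          (-((Real.pi * k * y / L : ℝ) : ℂ)) * Complex.I
        := by push_cast; ring
    rw [b1, b2, b3, b4, Complex.exp_add, Complex.exp_add, Complex.exp_add, Complex.exp_add]
    generalize Complex.exp (-((Real.pi * k * x / L : ℝ) : ℂ) * Complex.I) = p
    generalize Complex.exp (((Real.pi * k * x / L : ℝ) : ℂ) * Complex.I) = p'
    generalize Complex.exp (-((Real.pi * k * y / L : ℝ) : ℂ) * Complex.I) = q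
    generalize Complex.exp (((Real.pi * k * y / L : ℝ) : ℂ) * Complex.I) = q'
    linear_combination ((p - p') * (q - q') / 4 * Complex.exp (((-T : ℝ) : ℂ) * Complex.I) *
      Complex.exp (((T * Real.cos (Real.pi * k / L) : ℝ) : ℂ) * Complex.I)) * Complex.I_sq
  rw [Finset.sum_congr rfl fun k _ => e k, ← Finset.mul_sum, ← Finset.mul_sum, norm_mul,
    Complex.norm_exp_ofReal_mul_I, one_mul, norm_mul, Finset.sum_sub_distrib,
    Finset.sum_sub_distrib, Finset.sum_add_distrib]
  have h1 := hst (Real.pi * (x - y) / L)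
  have h2 := hst (-(Real.pi * (x - y) / L))
  have h3 := hst (Real.pi * (x + y) / L)
  have h4 := hst (-(Real.pi * (x + y) / L))
  have h5 : ‖(1 / 4 : ℂ)‖ = 1 / 4 := by norm_num
  rw [h5]
  refine le_trans (mul_le_mul_of_nonneg_left ((norm_sub_le _ _).trans (add_le_add
    ((norm_sub_le _ _).trans (add_le_add ((norm_add_le _ _).trans (add_le_add h1 h2)) h3)) h4))
    (by norm_num)) ?_
  linarith

/-! ### The sine basis -/

theorem sum_cos_mul (L : ℕ) (hL : 0 < L) (m : ℤ) (hm : ¬ (2 * L : ℤ) ∣ m) :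
    ∑ k ∈ Finset.Icc 1 (L - 1), Real.cos (Real.pi * k * m / L) = (-(-1) ^ m.natAbs - 1) / 2 := by
  have hL' : (L : ℝ) ≠ 0 := by exact_mod_cast hL.ne'
  have hπ := Real.pi_pos
  set φ : ℝ := Real.pi * m / L with hφ
  have hs : Real.sin (φ / 2) ≠ 0 := by
    rw [Ne, Real.sin_eq_zero_iff]
    rintro ⟨n, hn⟩
    apply hm
    refine ⟨n, ?_⟩
    have h1 : (m : ℝ) = 2 * L * n := by
      rw [hφ] at hn
      field_simp at hn
      linarith
    exact_mod_cast h1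
  have key : ∀ n : ℕ, 2 * Real.sin (φ / 2) * ∑ k ∈ Finset.Icc 1 n, Real.cos (Real.pi * k * m / L) =
      Real.sin ((n + 1 / 2) * φ) - Real.sin (φ / 2) := by
    intro n
    induction n with
    | zero => simp [show (2 : ℝ)⁻¹ * φ = φ / 2 by ring]
    | succ n ih =>
      rw [Finset.sum_Icc_succ_top (by omega), mul_add, ih]
      have h1 := Real.sin_sub_sin ((((n + 1 : ℕ) : ℝ) + 1 / 2) * φ) ((n + 1 / 2) * φ)
      have e1 : ((((n + 1 : ℕ) : ℝ) + 1 / 2) * φ - (n + 1 / 2) * φ) / 2 = φ / 2 := by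
        push_cast; ring
      have e2 : ((((n + 1 : ℕ) : ℝ) + 1 / 2) * φ + (n + 1 / 2) * φ) / 2 =
          Real.pi * ((n + 1 : ℕ) : ℝ) * m / L := by
        rw [hφ]; push_cast; ring
      rw [e1, e2] at h1
      linarith
  have h1 := key (L - 1)
  have h2 : Real.sin ((((L - 1 : ℕ) : ℝ) + 1 / 2) * φ) = -(-1) ^ m.natAbs * Real.sin (φ / 2) := by
    have e : (((L - 1 : ℕ) : ℝ) + 1 / 2) * φ = m * Real.pi - φ / 2 := by
      rw [Nat.cast_sub hL, hφ]
      field_simp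
      push_cast
      ring
    rw [e, Real.sin_sub, Real.sin_int_mul_pi, Real.cos_int_mul_pi]
    have : ((-1 : ℝ)) ^ m = (-1) ^ m.natAbs := by
      rcases Int.even_or_odd m with h | h
      · rw [h.neg_one_zpow, (Int.natAbs_even.2 h).neg_one_pow]
      · rw [h.neg_one_zpow, (Int.natAbs_odd.2 h).neg_one_pow]
    rw [this]
    ring
  rw [h2] at h1
  have h3 : 2 * Real.sin (φ / 2) * (∑ k ∈ Finset.Icc 1 (L - 1), Real.cos (Real.pi * k * m / L)
      - (-(-1) ^ m.natAbs - 1) / 2) = 0 := by linarith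
  have h4 := (mul_eq_zero.1 h3).resolve_left (by simpa using hs)
  linarith

/-- The normalized one-dimensional Dirichlet eigenfunctions `M ^ (-1/2) sin (π k (m + M) / (2 M))`
on `[-M, M]`. -/
def sineMode (M k : ℕ) (m : ℤ) : ℝ :=
  (√M)⁻¹ * Real.sin (Real.pi * k * (m + M) / (2 * M))

/-- Completeness relation of the sine basis. -/
theorem sum_sineMode_mul (M : ℕ) (j l : ℤ) (hj : |j| < M) (hl : |l| < M) :
    ∑ k ∈ Finset.Icc 1 (2 * M - 1), sineMode M k j * sineMode M k l = if j = l then 1 else 0 := by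
  rw [abs_lt] at hj hl
  have hM : 0 < M := by omega
  have hM' : (0 : ℝ) < M := by exact_mod_cast hM
  have e : ∀ k : ℕ, sineMode M k j * sineMode M k l = (2 * M : ℝ)⁻¹ *
      (Real.cos (Real.pi * k * ((j - l : ℤ) : ℝ) / ((2 * M : ℕ) : ℝ)) -
        Real.cos (Real.pi * k * ((j + l + 2 * M : ℤ) : ℝ) / ((2 * M : ℕ) : ℝ))) := by
    intro k
    have e1 : Real.pi * k * ((j - l : ℤ) : ℝ) / ((2 * M : ℕ) : ℝ) =
        Real.pi * k * (j + M) / (2 * M) - Real.pi * k * (l + M) / (2 * M) := by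
      push_cast; ring
    have e2 : Real.pi * k * ((j + l + 2 * M : ℤ) : ℝ) / ((2 * M : ℕ) : ℝ) =
        Real.pi * k * (j + M) / (2 * M) + Real.pi * k * (l + M) / (2 * M) := by
      push_cast; ring
    have e3 : (√(M : ℝ))⁻¹ * (√(M : ℝ))⁻¹ = (M : ℝ)⁻¹ := by
      rw [← mul_inv, Real.mul_self_sqrt hM'.le]
    rw [e1, e2, Real.cos_sub, Real.cos_add, sineMode, sineMode, mul_inv]
    linear_combination (Real.sin (Real.pi * k * (j + M) / (2 * M)) *
      Real.sin (Real.pi * k * (l + M) / (2 * M))) * e3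
  rw [Finset.sum_congr rfl fun k _ => e k, ← Finset.mul_sum, Finset.sum_sub_distrib]
  have hb : ¬ (2 * (2 * M : ℕ) : ℤ) ∣ (j + l + 2 * M) := by
    rintro ⟨c, hc⟩
    push_cast at hc
    rcases lt_trichotomy c 0 with h | h | h
    · nlinarith
    · subst h; omega
    · nlinarith
  rw [sum_cos_mul (2 * M) (by omega) _ hb]
  split_ifs with hjl
  · subst hjl
    have e4 : (-1 : ℝ) ^ (j + j + 2 * M).natAbs = 1 := by
      rw [Even.neg_one_pow]
      rw [Int.natAbs_even]
      exact ⟨j + M, by ring⟩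
    rw [e4]
    simp only [sub_self, Int.cast_zero, mul_zero, zero_div, Real.cos_zero, Finset.sum_const,
      Nat.card_Icc, nsmul_eq_mul, mul_one]
    rw [show 2 * M - 1 + 1 - 1 = 2 * M - 1 by omega, Nat.cast_sub (by omega)]
    push_cast
    field_simp
    ring
  · have ha : ¬ (2 * (2 * M : ℕ) : ℤ) ∣ (j - l) := by
      rintro ⟨c, hc⟩
      push_cast at hc
      rcases lt_trichotomy c 0 with h | h | h
      · nlinarith
      · subst h; omega
      · nlinarith
    rw [sum_cos_mul (2 * M) (by omega) _ ha]
    have e4 : (-1 : ℝ) ^ (j + l + 2 * M).natAbs = (-1) ^ (j - l).natAbs := by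
      rcases Int.even_or_odd (j - l) with h | h
      · rw [(Int.natAbs_even.2 h).neg_one_pow, Even.neg_one_pow]
        rw [Int.natAbs_even]
        obtain ⟨c, hc⟩ := h
        exact ⟨c + l + M, by omega⟩
      · rw [(Int.natAbs_odd.2 h).neg_one_pow, Odd.neg_one_pow]
        rw [Int.natAbs_odd]
        obtain ⟨c, hc⟩ := h
        exact ⟨c + l + M, by omega⟩
    rw [e4]
    ring

theorem sineMode_neg_self (M k : ℕ) : sineMode M k (-(M : ℤ)) = 0 := by
  simp [sineMode]

theorem sineMode_self (M k : ℕ) : sineMode M k M = 0 := by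
  rcases Nat.eq_zero_or_pos M with h | h
  · simp [sineMode, h]
  · have : Real.pi * k * (((M : ℤ) : ℝ) + M) / (2 * M) = k * Real.pi := by
      have : (M : ℝ) ≠ 0 := by exact_mod_cast h.ne'
      push_cast
      field_simp
      ring
    rw [sineMode, this, Real.sin_nat_mul_pi, mul_zero]

/-- The Dirichlet eigenfunction of frequency `k` on the lattice cube. -/
def mode (d M : ℕ) (k : Fin d → ℕ) : DirichletFun d M :=
  ⟨WithLp.toLp 2 fun x => ((∏ i, sineMode M (k i) (x.1 i) : ℝ) : ℂ), by
    rintro x ⟨j, hj | hj⟩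
    · change ((∏ i, sineMode M (k i) (x.1 i) : ℝ) : ℂ) = 0
      rw [Finset.prod_eq_zero (Finset.mem_univ j) (by rw [hj, sineMode_self]), Complex.ofReal_zero]
    · change ((∏ i, sineMode M (k i) (x.1 i) : ℝ) : ℂ) = 0
      rw [Finset.prod_eq_zero (Finset.mem_univ j) (by rw [hj, sineMode_neg_self]),
        Complex.ofReal_zero]⟩

theorem mode_val (d M : ℕ) (k : Fin d → ℕ) (x : Site d M) :
    (mode d M k).val x = ((∏ i, sineMode M (k i) (x.1 i) : ℝ) : ℂ) := rfl

/-- The frequencies with all coordinates in `{1, …, n}`. -/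
def modes (d n : ℕ) : Finset (Fin d → ℕ) := Fintype.piFinset fun _ => Finset.Icc 1 n

theorem mem_modes {d n : ℕ} {k : Fin d → ℕ} : k ∈ modes d n ↔ ∀ i, 1 ≤ k i ∧ k i ≤ n := by
  simp [modes]

theorem modes_mono {d n m : ℕ} (hnm : n ≤ m) : modes d n ⊆ modes d m := fun _ hk =>
  mem_modes.2 fun i => ⟨(mem_modes.1 hk i).1, (mem_modes.1 hk i).2.trans hnm⟩

theorem site_abs_le {d M : ℕ} (x : Site d M) (i : Fin d) : |x.1 i| ≤ M := by
  have := Finset.mem_Icc.1 x.2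
  rw [abs_le]
  exact ⟨this.1 i, this.2 i⟩

theorem abs_lt_of_notMem_boundary {d M : ℕ} {x : Site d M} (hx : x ∉ boundary d M) (i : Fin d) :
    |x.1 i| < M := by
  have h1 := abs_le.1 (site_abs_le x i)
  have h2 : ¬ ∃ j, x.1 j = (M : ℤ) ∨ x.1 j = -(M : ℤ) := hx
  push Not at h2
  have h3 := h2 i
  rw [abs_lt]
  omega

theorem sum_mode_mul {d M : ℕ} {x y : Site d M} (hx : x ∉ boundary d M) (hy : y ∉ boundary d M) :
    ∑ k ∈ modes d (2 * M - 1), (mode d M k).val x * (mode d M k).val y =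
      if x = y then 1 else 0 := by
  have h1 : ∑ k ∈ modes d (2 * M - 1), ∏ i, (sineMode M (k i) (x.1 i) * sineMode M (k i) (y.1 i)) =
      ∏ i, if x.1 i = y.1 i then (1 : ℝ) else 0 := by
    refine (Finset.prod_univ_sum (fun _ => Finset.Icc 1 (2 * M - 1))
      fun i n => sineMode M n (x.1 i) * sineMode M n (y.1 i)).symm.trans ?_
    refine Finset.prod_congr rfl fun i _ => ?_
    exact sum_sineMode_mul M _ _ (abs_lt_of_notMem_boundary hx i) (abs_lt_of_notMem_boundary hy i)
  have h2 : ∑ k ∈ modes d (2 * M - 1), (mode d M k).val x * (mode d M k).val y =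
      ((∑ k ∈ modes d (2 * M - 1), ∏ i, (sineMode M (k i) (x.1 i) * sineMode M (k i) (y.1 i)) : ℝ)
        : ℂ) := by
    rw [Complex.ofReal_sum]
    refine Finset.sum_congr rfl fun k _ => ?_
    rw [mode_val, mode_val, Finset.prod_mul_distrib, Complex.ofReal_mul]
  rw [h2, h1]
  split_ifs with hxy
  · subst hxy; simp
  · obtain ⟨i, hi⟩ : ∃ i, x.1 i ≠ y.1 i := by
      by_contra hcon
      push Not at hcon
      exact hxy (Subtype.ext (funext hcon))
    rw [Finset.prod_eq_zero (Finset.mem_univ i) (by simp [hi]), Complex.ofReal_zero]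

theorem conj_mode_val (d M : ℕ) (k : Fin d → ℕ) (x : Site d M) :
    starRingEnd ℂ ((mode d M k).val x) = (mode d M k).val x := by
  rw [mode_val, Complex.conj_ofReal]

theorem val_sum {d M : ℕ} {ι : Type*} (s : Finset ι) (f : ι → DirichletFun d M) (x : Site d M) :
    (∑ i ∈ s, f i).val x = ∑ i ∈ s, (f i).val x := by
  classical
  induction s using Finset.induction_on with
  | empty => rfl
  | insert i s hi ih => rw [Finset.sum_insert hi, Finset.sum_insert hi, val_add, ih]

theorem inner_mode {d M : ℕ} (k : Fin d → ℕ) (f : DirichletFun d M) :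
    inner ℂ (mode d M k) f = ∑ x : Site d M, (mode d M k).val x * f.val x := by
  rw [inner_eq_sum]
  refine Finset.sum_congr rfl fun x _ => ?_
  rw [conj_mode_val, mul_comm]

/-- Every function on the cube with zero boundary values is the sum of its sine series. -/
theorem sum_inner_mode_smul {d M : ℕ} (f : DirichletFun d M) :
    ∑ k ∈ modes d (2 * M - 1), (inner ℂ (mode d M k) f : ℂ) • mode d M k = f := by
  refine ext_val fun x => ?_
  rw [val_sum]
  by_cases hx : x ∈ boundary d M
  · rw [val_boundary f x hx]
    exact Finset.sum_eq_zero fun k _ => val_boundary _ x hx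
  · simp only [val_smul, inner_mode, Finset.sum_mul]
    rw [Finset.sum_comm, Finset.sum_eq_single x]
    · have := sum_mode_mul hx hx
      rw [if_pos rfl] at this
      calc _ = (∑ k ∈ modes d (2 * M - 1), (mode d M k).val x * (mode d M k).val x) * f.val x := by
            rw [Finset.sum_mul]
            exact Finset.sum_congr rfl fun k _ => by ring
        _ = f.val x := by rw [this, one_mul]
    · intro y _ hyx
      by_cases hy : y ∈ boundary d M
      · rw [val_boundary f y hy]; simp
      · have := sum_mode_mul hy hx
        rw [if_neg hyx] at this
        calc _ = (∑ k ∈ modes d (2 * M - 1), (mode d M k).val y * (mode d M k).val x) * f.val y := by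
              rw [Finset.sum_mul]
              exact Finset.sum_congr rfl fun k _ => by ring
          _ = 0 := by rw [this, zero_mul]
    · intro h; exact absurd (Finset.mem_univ x) h

/-- Parseval's identity for the sine basis. -/
theorem sum_norm_inner_mode_sq {d M : ℕ} (f : DirichletFun d M) :
    ∑ k ∈ modes d (2 * M - 1), ‖(inner ℂ (mode d M k) f : ℂ)‖ ^ 2 =
      ∑ x : Site d M, ‖f.val x‖ ^ 2 := by
  have h1 : (inner ℂ f f : ℂ) = ((∑ x : Site d M, ‖f.val x‖ ^ 2 : ℝ) : ℂ) := by
    rw [inner_eq_sum, Complex.ofReal_sum]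
    refine Finset.sum_congr rfl fun x _ => ?_
    rw [Complex.mul_conj, Complex.normSq_eq_norm_sq]
  have h2 : (inner ℂ f f : ℂ) =
      ((∑ k ∈ modes d (2 * M - 1), ‖(inner ℂ (mode d M k) f : ℂ)‖ ^ 2 : ℝ) : ℂ) := by
    nth_rewrite 2 [← sum_inner_mode_smul f]
    rw [inner_sum, Complex.ofReal_sum]
    refine Finset.sum_congr rfl fun k _ => ?_
    rw [inner_smul_right, ← inner_conj_symm f, Complex.mul_conj, Complex.normSq_eq_norm_sq]
  exact_mod_cast h2.symm.trans h1

/-- Bessel's inequality, for functions on the cube with arbitrary boundary values. -/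
theorem sum_norm_sum_mode_mul_sq_le {d M n : ℕ} (hn : n ≤ 2 * M - 1) (g : Site d M → ℂ) :
    ∑ k ∈ modes d n, ‖∑ x : Site d M, (mode d M k).val x * g x‖ ^ 2 ≤
      ∑ x : Site d M, ‖g x‖ ^ 2 := by
  classical
  let f : DirichletFun d M := ⟨WithLp.toLp 2 fun x => if x ∈ boundary d M then 0 else g x,
    fun x hx => by simp [hx]⟩
  have hf : ∀ x, f.val x = if x ∈ boundary d M then 0 else g x := fun x => rfl
  have h1 : ∀ k, (inner ℂ (mode d M k) f : ℂ) = ∑ x : Site d M, (mode d M k).val x * g x := by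
    intro k
    rw [inner_mode]
    refine Finset.sum_congr rfl fun x _ => ?_
    rw [hf]
    split_ifs with hx
    · rw [val_boundary _ x hx]; simp
    · rfl
  calc ∑ k ∈ modes d n, ‖∑ x : Site d M, (mode d M k).val x * g x‖ ^ 2
      ≤ ∑ k ∈ modes d (2 * M - 1), ‖∑ x : Site d M, (mode d M k).val x * g x‖ ^ 2 :=
        Finset.sum_le_sum_of_subset_of_nonneg (modes_mono hn) fun _ _ _ => by positivity
    _ = ∑ x : Site d M, ‖f.val x‖ ^ 2 := by
        rw [← sum_norm_inner_mode_sq]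
        exact Finset.sum_congr rfl fun k _ => by rw [h1]
    _ ≤ ∑ x : Site d M, ‖g x‖ ^ 2 := by
        refine Finset.sum_le_sum fun x _ => ?_
        rw [hf]
        split_ifs
        · simp
        · rfl

/-! ### Functions of the Dirichlet Laplacian -/

/-- The eigenvalue of `-Δ_Ω` at the frequency `k`. -/
def energy {d : ℕ} (M : ℕ) (h : ℝ) (k : Fin d → ℕ) : ℝ :=
  ∑ i, (2 - 2 * Real.cos (Real.pi * k i / (2 * M))) / h ^ 2

theorem energy_nonneg {d : ℕ} (M : ℕ) (h : ℝ) (k : Fin d → ℕ) : 0 ≤ energy M h k :=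
  Finset.sum_nonneg fun i _ => div_nonneg
    (by linarith [Real.cos_le_one (Real.pi * k i / (2 * M))]) (sq_nonneg h)

theorem sineMode_add_sub (M k : ℕ) (m : ℤ) : sineMode M k (m + 1) + sineMode M k (m - 1) =
    2 * Real.cos (Real.pi * k / (2 * M)) * sineMode M k m := by
  have e1 : Real.pi * k * (((m + 1 : ℤ) : ℝ) + M) / (2 * M) =
      Real.pi * k * (m + M) / (2 * M) + Real.pi * k / (2 * M) := by push_cast; ring
  have e2 : Real.pi * k * (((m - 1 : ℤ) : ℝ) + M) / (2 * M) =
      Real.pi * k * (m + M) / (2 * M) - Real.pi * k / (2 * M) := by push_cast; ring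
  rw [sineMode, sineMode, sineMode, e1, e2, Real.sin_add, Real.sin_sub]
  ring

theorem extend_mode {d M : ℕ} (k : Fin d → ℕ) (m : Fin d → ℤ) (hm : ∀ i, |m i| ≤ M) :
    extend (mode d M k) m = ((∏ i, sineMode M (k i) (m i) : ℝ) : ℂ) := by
  have hm' : m ∈ Finset.Icc (fun _ : Fin d => -(M : ℤ)) (fun _ : Fin d => (M : ℤ)) := by
    rw [Finset.mem_Icc]
    exact ⟨fun i => (abs_le.1 (hm i)).1, fun i => (abs_le.1 (hm i)).2⟩
  rw [extend, dif_pos hm', mode_val]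

theorem lap_mode (d M : ℕ) (h : ℝ) (k : Fin d → ℕ) :
    lap d M h (mode d M k) = ((-energy M h k : ℝ) : ℂ) • mode d M k := by
  refine ext_val fun x => ?_
  rw [lap_val, val_smul]
  by_cases hx : x ∈ boundary d M
  · rw [val_boundary _ x hx, mul_zero, lapValue, if_pos hx]
  rw [lapValue, if_neg hx]
  have hlt := abs_lt_of_notMem_boundary hx
  have key : ∀ j : Fin d, extend (mode d M k) (x.1 + Pi.single j 1) +
      extend (mode d M k) (x.1 - Pi.single j 1) - 2 * (mode d M k).val x =
      ((-(2 - 2 * Real.cos (Real.pi * k j / (2 * M))) : ℝ) : ℂ) * (mode d M k).val x := by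
    intro j
    have e : ∀ (m : Fin d → ℤ), (∀ i, i ≠ j → m i = x.1 i) → ∏ i, sineMode M (k i) (m i) =
        sineMode M (k j) (m j) * ∏ i ∈ Finset.univ.erase j, sineMode M (k i) (x.1 i) := by
      intro m hm
      rw [← Finset.mul_prod_erase _ _ (Finset.mem_univ j)]
      congr 1
      exact Finset.prod_congr rfl fun i hi => by rw [hm i (Finset.ne_of_mem_erase hi)]
    rw [extend_mode, extend_mode, mode_val, e (x.1 + Pi.single j 1), e (x.1 - Pi.single j 1),
      e x.1]
    · have := sineMode_add_sub M (k j) (x.1 j)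
      simp only [Pi.add_apply, Pi.sub_apply, Pi.single_eq_same]
      have this' := congrArg (fun r : ℝ => (r : ℂ)) this
      push_cast at this' ⊢
      linear_combination (∏ i ∈ Finset.univ.erase j, (sineMode M (k i) (x.1 i) : ℂ)) * this'
    · exact fun i _ => rfl
    · intro i hi; simp [hi]
    · intro i hi; simp [hi]
    · intro i
      have h1 := abs_lt.1 (hlt i)
      rw [abs_le]
      by_cases hij : i = j
      · subst hij; simp; omega
      · simp [hij]; omega
    · intro i
      have h1 := abs_lt.1 (hlt i)
      rw [abs_le]
      by_cases hij : i = j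
      · subst hij; simp; omega
      · simp [hij]; omega
  rw [Finset.sum_congr rfl fun j _ => key j, ← Finset.sum_mul, ← mul_assoc]
  congr 1
  rw [energy]
  push_cast
  rw [Finset.mul_sum, ← Finset.sum_neg_distrib]
  exact Finset.sum_congr rfl fun i _ => by ring

/-- The exponential of an operator acts on eigenvectors by the exponential of the eigenvalue. -/
theorem exp_apply_of_apply_eq_smul {E : Type*} [NormedAddCommGroup E] [NormedSpace ℂ E]
    [CompleteSpace E] (A : E →L[ℂ] E) {v : E} {c : ℂ} (hv : A v = c • v) :
    NormedSpace.exp A v = Complex.exp c • v := by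
  have hpow : ∀ n : ℕ, (A ^ n) v = c ^ n • v := by
    intro n
    induction n with
    | zero => simp
    | succ n ih => rw [pow_succ, mul_apply_eq_comp, hv, map_smul, ih, smul_smul,
        pow_succ, mul_comm]
  have h1 := (NormedSpace.exp_series_hasSum_exp' (𝕂 := ℂ) A).mapL
    (ContinuousLinearMap.apply ℂ E v)
  have h2 := (NormedSpace.exp_series_hasSum_exp' (𝕂 := ℂ) c).smul_const v
  rw [← Complex.exp_eq_exp_ℂ] at h2
  refine h1.unique ?_
  convert h2 using 2 with n
  simp [hpow, smul_smul]

/-- A function of a self-adjoint operator on a finite-dimensional space acts on eigenvectors by the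
value of the function at the eigenvalue. -/
theorem cfc_apply_of_apply_eq_smul {E : Type*} [NormedAddCommGroup E] [InnerProductSpace ℂ E]
    [FiniteDimensional ℂ E] [CompleteSpace E] (A : E →L[ℂ] E) (hA : IsSelfAdjoint A) (f : ℝ → ℝ)
    {v : E} {c : ℝ} (hv : A v = (c : ℂ) • v) : cfc f A v = ((f c : ℝ) : ℂ) • v := by
  classical
  rcases eq_or_ne v 0 with rfl | hv0
  · simp
  have hfin : (spectrum ℝ A).Finite := by
    have h1 : (spectrum ℂ A).Finite := by
      refine (Module.End.finite_spectrum (A : E →ₗ[ℂ] E)).subset fun z hz => ?_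
      rw [spectrum.mem_iff] at hz ⊢
      rw [ContinuousLinearMap.isUnit_iff_bijective] at hz
      rw [Module.End.isUnit_iff]
      exact hz
    have h2 : spectrum ℝ A = (algebraMap ℝ ℂ) ⁻¹' spectrum ℂ A :=
      (spectrum.preimage_algebraMap ℂ).symm
    rw [h2]
    exact h1.preimage (FaithfulSMul.algebraMap_injective ℝ ℂ).injOn
  have hc : c ∈ spectrum ℝ A := by
    rw [spectrum.mem_iff]
    intro hu
    rw [ContinuousLinearMap.isUnit_iff_bijective] at hu
    apply hv0
    apply hu.1
    rw [map_zero]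
    change (algebraMap ℝ (E →L[ℂ] E) c) v - A v = 0
    rw [hv, sub_eq_zero, Algebra.algebraMap_eq_smul_one]
    simp
  set p := Lagrange.interpolate hfin.toFinset id f with hp
  have heval : ∀ x ∈ spectrum ℝ A, p.eval x = f x := fun x hx =>
    Lagrange.eval_interpolate_at_node f Function.injective_id.injOn (hfin.mem_toFinset.2 hx)
  have h1 : cfc f A = Polynomial.aeval A p := by
    rw [← cfc_polynomial p A hA]
    exact cfc_congr fun x hx => (heval x hx).symm
  rw [h1, ← heval c hc]
  have hpow : ∀ q : Polynomial ℝ, (Polynomial.aeval A q) v = ((q.eval c : ℝ) : ℂ) • v := by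
    intro q
    induction q using Polynomial.induction_on with
    | C a =>
      simp [Algebra.algebraMap_eq_smul_one]
    | add q₁ q₂ h₁ h₂ => simp [h₁, h₂, add_smul]
    | monomial n a ih =>
      rw [pow_succ, ← mul_assoc, map_mul, Polynomial.aeval_X, mul_apply_eq_comp, hv, map_smul, ih,
        smul_smul]
      congr 1
      simp
      ring
  exact hpow p

theorem propagator_mode (d M : ℕ) (h t : ℝ) (k : Fin d → ℕ) :
    propagator d M h t (mode d M k) =
      Complex.exp (((-t * energy M h k : ℝ) : ℂ) * Complex.I) • mode d M k := by
  refine exp_apply_of_apply_eq_smul _ ?_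
  rw [smul_apply, lap_mode, smul_smul]
  congr 1
  push_cast
  ring

theorem besselPotential_mode (d M : ℕ) (h s : ℝ) (k : Fin d → ℕ) :
    besselPotential d M h s (mode d M k) =
      (((1 + energy M h k) ^ (s / 2) : ℝ) : ℂ) • mode d M k := by
  refine cfc_apply_of_apply_eq_smul _ (isSelfAdjoint_one_sub_lap d M h) _ ?_
  rw [sub_apply, lap_mode]
  simp [add_smul, sub_eq_add_neg]

theorem inner_mode_besselPotential (d M : ℕ) (h s : ℝ) (k : Fin d → ℕ) (w : DirichletFun d M) :
    (inner ℂ (mode d M k) (besselPotential d M h s w) : ℂ) =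
      (((1 + energy M h k) ^ (s / 2) : ℝ) : ℂ) * inner ℂ (mode d M k) w := by
  have hsa : IsSelfAdjoint (besselPotential d M h s) := cfc_predicate _ _
  rw [ContinuousLinearMap.isSelfAdjoint_iff_isSymmetric] at hsa
  have h1 : (inner ℂ (besselPotential d M h s (mode d M k)) w : ℂ) =
    inner ℂ (mode d M k) (besselPotential d M h s w) := hsa _ _
  rw [← h1, besselPotential_mode, inner_smul_left, Complex.conj_ofReal]

/-- The Schrödinger flow in the sine basis. -/
theorem propagator_val {d M : ℕ} (h t : ℝ) (w : DirichletFun d M) (x : Site d M) :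
    (propagator d M h t w).val x = ∑ k ∈ modes d (2 * M - 1), (inner ℂ (mode d M k) w : ℂ) *
      (Complex.exp (((-t * energy M h k : ℝ) : ℂ) * Complex.I) * (mode d M k).val x) := by
  nth_rewrite 1 [← sum_inner_mode_smul w]
  rw [map_sum, val_sum]
  refine Finset.sum_congr rfl fun k _ => ?_
  rw [map_smul, propagator_mode, val_smul, val_smul]

theorem sum_norm_besselPotential_sq {d M : ℕ} (h s : ℝ) (w : DirichletFun d M) :
    ∑ x : Site d M, ‖(besselPotential d M h s w).val x‖ ^ 2 =
      ∑ k ∈ modes d (2 * M - 1), (1 + energy M h k) ^ s * ‖(inner ℂ (mode d M k) w : ℂ)‖ ^ 2 := by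
  rw [← sum_norm_inner_mode_sq]
  refine Finset.sum_congr rfl fun k _ => ?_
  have h1 : 0 ≤ 1 + energy M h k := by linarith [energy_nonneg M h k]
  rw [inner_mode_besselPotential, norm_mul, Complex.norm_real, mul_pow, Real.norm_eq_abs, sq_abs,
    ← Real.rpow_natCast, ← Real.rpow_mul h1]
  norm_num

/-- The energy controls the square of each frequency, by `sin x ≥ 2 x / π` on `[0, π / 2]`. -/
theorem sq_le_energy {d : ℕ} {K R : ℕ} (hK : 0 < K) (hR : 0 < R) {h : ℝ} (hh : h = Real.pi / K)
    {k : Fin d → ℕ} (hk : k ∈ modes d (2 * (K * R) - 1)) (i : Fin d) :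
    ((k i : ℝ) / (Real.pi * R)) ^ 2 ≤ energy (K * R) h k := by
  have hπ := Real.pi_pos
  have hK' : (0 : ℝ) < K := by exact_mod_cast hK
  have hR' : (0 : ℝ) < R := by exact_mod_cast hR
  have hterm : ∀ j : Fin d, 0 ≤ (2 - 2 * Real.cos (Real.pi * k j / (2 * ((K * R : ℕ) : ℝ)))) / h ^ 2
    := fun j => div_nonneg
      (by linarith [Real.cos_le_one (Real.pi * k j / (2 * ((K * R : ℕ) : ℝ)))]) (sq_nonneg h)
  refine le_trans ?_ (Finset.single_le_sum (fun j _ => hterm j) (Finset.mem_univ i))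
  set y : ℝ := Real.pi * k i / (2 * ((K * R : ℕ) : ℝ)) with hy
  have hy0 : 0 ≤ y := by positivity
  have hyπ : y / 2 ≤ Real.pi / 2 := by
    have h1 : (k i : ℝ) ≤ 2 * ((K * R : ℕ) : ℝ) := by
      have := (mem_modes.1 hk i).2
      exact_mod_cast (by omega : k i ≤ 2 * (K * R))
    have h2 : (0 : ℝ) < ((K * R : ℕ) : ℝ) := by push_cast; positivity
    have : y ≤ Real.pi := by
      rw [hy, div_le_iff₀ (by positivity)]
      gcongr
    linarith
  have h1 : 2 - 2 * Real.cos y = 4 * Real.sin (y / 2) ^ 2 := by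
    have h5 := Real.cos_sq (y / 2)
    rw [mul_div_cancel₀ y (two_ne_zero)] at h5
    have := Real.sin_sq_add_cos_sq (y / 2)
    nlinarith
  have h2 := Real.mul_le_sin (by positivity) hyπ
  have h3 : (2 / Real.pi * (y / 2)) ^ 2 ≤ Real.sin (y / 2) ^ 2 := by gcongr
  rw [h1, le_div_iff₀ (by rw [hh]; positivity)]
  refine le_trans (le_of_eq ?_) (mul_le_mul_of_nonneg_left h3 (by norm_num : (0 : ℝ) ≤ 4))
  rw [hy, hh]
  push_cast
  field_simp
  norm_num

/-- Dispersive estimate for the frequencies in `{1, …, n}ᵈ`, `n ≤ R N`, up to the crossing time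
`R / N`: the kernel factors into one-dimensional ones. -/
theorem norm_kernel_le {d : ℕ} {K R n : ℕ} (hK : 0 < K) (hR : 0 < R) {h N t : ℝ}
    (hh : h = Real.pi / K) (hN : 1 ≤ N) (hn : n ≤ 2 * (K * R) - 1) (hnN : (n : ℝ) ≤ R * N)
    (ht : t ≠ 0) (htN : |t| * N ≤ R) (x y : Site d (K * R)) :
    ‖∑ k ∈ modes d n, Complex.exp (((-t * energy (K * R) h k : ℝ) : ℂ) * Complex.I) *
        ((mode d (K * R) k).val x * (mode d (K * R) k).val y)‖ ≤
      (192 * h * (N / |t|) ^ ((1 : ℝ) / 3)) ^ d := by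
  have hπ := Real.pi_gt_three
  have hK' : (0 : ℝ) < K := by exact_mod_cast hK
  have hR' : (0 : ℝ) < R := by exact_mod_cast hR
  have hKR : 0 < K * R := Nat.mul_pos hK hR
  set L : ℝ := 2 * K * R with hL
  let φ : Fin d → ℕ → ℂ := fun i k => ((K : ℂ) * R)⁻¹ *
    (((Real.sin (Real.pi * k * (x.1 i + ((K * R : ℕ) : ℝ)) / L) : ℝ) : ℂ) *
        ((Real.sin (Real.pi * k * (y.1 i + ((K * R : ℕ) : ℝ)) / L) : ℝ) : ℂ) *
        Complex.exp (((-t * ((2 - 2 * Real.cos (Real.pi * k / L)) * K ^ 2 / Real.pi ^ 2)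
          : ℝ) : ℂ) * Complex.I))
  have hprod : ∑ k ∈ modes d n, Complex.exp (((-t * energy (K * R) h k : ℝ) : ℂ) * Complex.I) *
        ((mode d (K * R) k).val x * (mode d (K * R) k).val y) =
      ∏ i, ∑ k ∈ Finset.Icc 1 n, φ i k := by
    rw [Finset.prod_univ_sum]
    refine Finset.sum_congr rfl fun k _ => ?_
    rw [mode_val, mode_val, energy, Finset.mul_sum]
    push_cast
    rw [Finset.sum_mul, Complex.exp_sum, ← Finset.prod_mul_distrib, ← Finset.prod_mul_distrib]
    refine Finset.prod_congr rfl fun i _ => ?_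
    have e1 : (√((K * R : ℕ) : ℝ))⁻¹ * (√((K * R : ℕ) : ℝ))⁻¹ = ((K : ℝ) * R)⁻¹ := by
      rw [← mul_inv, Real.mul_self_sqrt (by positivity), Nat.cast_mul]
    have e2 : (2 : ℝ) * ((K * R : ℕ) : ℝ) = L := by rw [hL]; push_cast; ring
    have e1' := congrArg (fun r : ℝ => (r : ℂ)) e1
    simp only [φ, sineMode, e2, hh, Complex.ofReal_mul, Complex.ofReal_inv,
      Complex.ofReal_natCast] at e1' ⊢
    have e3 : ((-t : ℝ) : ℂ) *
        (((2 - 2 * Real.cos (Real.pi * k i / L)) * K ^ 2 / Real.pi ^ 2 : ℝ) : ℂ) =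
        -(t : ℂ) * ((2 - 2 * Complex.cos (Real.pi * k i / (2 * (K * R)))) /
          ((Real.pi / K : ℝ) : ℂ) ^ 2) := by
      rw [hL]
      push_cast
      rw [mul_assoc 2 (K : ℂ) R]
      field_simp
    rw [e3, ← e1']
    ring
  rw [hprod, norm_prod]
  refine (Finset.prod_le_prod (g := fun _ => 192 * h * (N / |t|) ^ ((1 : ℝ) / 3))
    (fun i _ => norm_nonneg _) fun i _ => ?_).trans (by simp)
  rw [← Finset.mul_sum, norm_mul]
  have h1 := norm_sum_sin_mul_sin_le K R n hK hR N t (x.1 i + ((K * R : ℕ) : ℝ))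
    (y.1 i + ((K * R : ℕ) : ℝ)) hN (by omega) hnN ht htN
  refine (mul_le_mul_of_nonneg_left h1 (norm_nonneg _)).trans ?_
  have e5 : ‖((K : ℂ) * R)⁻¹‖ = ((K : ℝ) * R)⁻¹ := by simp
  rw [e5, hh]
  have hρ : 0 ≤ (N / |t|) ^ ((1 : ℝ) / 3) := by positivity
  calc ((K : ℝ) * R)⁻¹ * (192 * (R * (N / |t|) ^ ((1 : ℝ) / 3)))
      = 192 * (1 / K) * (N / |t|) ^ ((1 : ℝ) / 3) := by field_simp
    _ ≤ 192 * (Real.pi / K) * (N / |t|) ^ ((1 : ℝ) / 3) := by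
      gcongr
      linarith [hπ]

/-! ### Interpolation between the dispersive and the energy estimate -/

theorem intervalIntegral_indicator_rpow {e G u : ℝ} (he : -1 < e) (hu : 0 ≤ u) (huG : u ≤ G) (c : ℝ) :
    IntervalIntegrable ({v | v ≤ u}.indicator fun v : ℝ => c * v ^ e) MeasureTheory.volume 0 G ∧
      ∫ v in (0 : ℝ)..G, {v | v ≤ u}.indicator (fun v : ℝ => c * v ^ e) v =
        c * (u ^ (e + 1) / (e + 1)) := by
  constructor
  · have h1 : IntervalIntegrable (fun v : ℝ => c * v ^ e) MeasureTheory.volume 0 G :=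
      (intervalIntegral.intervalIntegrable_rpow' he).const_mul c
    rw [intervalIntegrable_iff] at h1 ⊢
    exact h1.indicator measurableSet_Iic
  · rw [intervalIntegral.integral_indicator ⟨hu, huG⟩, intervalIntegral.integral_const_mul,
      integral_rpow (Or.inl he), Real.zero_rpow (by linarith), sub_zero]

/-- Marcinkiewicz interpolation between an `ℓ¹ → ℓ^∞` and an `ℓ² → ℓ²` bound of a finite matrix. At
each level `v`, the part of `f` on which `2 S D |f| ^ (1 - p) < v` contributes at most `v / 2` by
the first bound, and the rest is estimated by the second one and Chebyshev's inequality. -/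
theorem sum_norm_rpow_le_of_bounds {ι : Type*} [Fintype ι] (A : ι → ι → ℂ) {D r : ℝ} (hD : 0 < D)
    (hr : 2 < r) (hA : ∀ x y, ‖A x y‖ ≤ D)
    (hA2 : ∀ f : ι → ℂ, ∑ x, ‖∑ y, A x y * f y‖ ^ 2 ≤ ∑ y, ‖f y‖ ^ 2) (f : ι → ℂ) :
    ∑ x, ‖∑ y, A x y * f y‖ ^ r ≤
      4 * r / (r - 2) * (2 * D) ^ (r - 2) * (∑ y, ‖f y‖ ^ (r / (r - 1))) ^ (r - 1) := by
  classical
  set p : ℝ := r / (r - 1) with hp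
  have hp0 : 0 < p := div_pos (by linarith) (by linarith)
  set S : ℝ := ∑ y, ‖f y‖ ^ p with hS
  have hS0 : 0 ≤ S := Finset.sum_nonneg fun y _ => by positivity
  have hr2 : 0 < r - 2 := by linarith
  rcases hS0.eq_or_lt with hSz | hSpos
  · have hf : ∀ y, f y = 0 := by
      intro y
      have h1 := (Finset.sum_eq_zero_iff_of_nonneg (fun y _ => by positivity)).1 hSz.symm y
        (Finset.mem_univ y)
      rwa [Real.rpow_eq_zero (norm_nonneg _) hp0.ne', norm_eq_zero] at h1
    simp only [hf, mul_zero, Finset.sum_const_zero, norm_zero, Real.zero_rpow (by linarith : r ≠ 0)]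
    positivity
  set g : ι → ℝ := fun x => ‖∑ y, A x y * f y‖ with hg
  set Λ : ι → ℝ := fun y => 2 * S * D * ‖f y‖ ^ (1 - p) with hΛ
  have hΛ0 : ∀ y, 0 ≤ Λ y := fun y => by positivity
  have hg0 : ∀ x, 0 ≤ g x := fun x => norm_nonneg _
  -- all layer-cake integrals can be taken over `[0, G]`
  set G : ℝ := ∑ x, g x + ∑ y, Λ y with hG
  have hgG : ∀ x, g x ≤ G := fun x =>
    (Finset.single_le_sum (fun x _ => hg0 x) (Finset.mem_univ x)).trans
      (le_add_of_nonneg_right (Finset.sum_nonneg fun y _ => hΛ0 y))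
  have hΛG : ∀ y, Λ y ≤ G := fun y =>
    (Finset.single_le_sum (fun y _ => hΛ0 y) (Finset.mem_univ y)).trans
      (le_add_of_nonneg_left (Finset.sum_nonneg fun x _ => hg0 x))
  have hG0 : 0 ≤ G := add_nonneg (Finset.sum_nonneg fun x _ => hg0 x)
    (Finset.sum_nonneg fun y _ => hΛ0 y)
  -- the pointwise inequality between the distribution functions
  have hpt : ∀ v : ℝ, 0 < v →
      ∑ x, {v | v ≤ g x}.indicator (fun v : ℝ => r * v ^ (r - 1)) v ≤
        ∑ y, {v | v ≤ Λ y}.indicator (fun v : ℝ => 4 * r * ‖f y‖ ^ 2 * v ^ (r - 3)) v := by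
    intro v hv
    set fs : ι → ℂ := fun y => if v ≤ Λ y then f y else 0 with hfs
    set fl : ι → ℂ := fun y => if v ≤ Λ y then 0 else f y with hfl
    have hsplit : ∀ x, ∑ y, A x y * f y = ∑ y, A x y * fs y + ∑ y, A x y * fl y := by
      intro x
      rw [← Finset.sum_add_distrib]
      refine Finset.sum_congr rfl fun y _ => ?_
      simp only [hfs, hfl]
      split_ifs <;> ring
    have hlarge : ∀ x, ‖∑ y, A x y * fl y‖ ≤ v / 2 := by
      intro x
      calc ‖∑ y, A x y * fl y‖ ≤ ∑ y, D * ‖fl y‖ := by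
            refine (norm_sum_le _ _).trans (Finset.sum_le_sum fun y _ => ?_)
            rw [norm_mul]
            exact mul_le_mul_of_nonneg_right (hA x y) (norm_nonneg _)
        _ ≤ ∑ y, v / (2 * S) * ‖f y‖ ^ p := by
            refine Finset.sum_le_sum fun y _ => ?_
            simp only [hfl]
            split_ifs with h
            · simp only [norm_zero, mul_zero]; positivity
            · push Not at h
              rcases eq_or_ne (f y) 0 with h0 | h0
              · rw [h0, norm_zero, mul_zero]; positivity
              · have h1 : 0 < ‖f y‖ := norm_pos_iff.2 h0
                have h2 : ‖f y‖ = ‖f y‖ ^ (1 - p) * ‖f y‖ ^ p := by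
                  rw [← Real.rpow_add h1]; simp
                have h3 : D * ‖f y‖ = Λ y / (2 * S) * ‖f y‖ ^ p := by
                  nth_rewrite 1 [h2]
                  simp only [hΛ]
                  field_simp
                rw [h3]
                gcongr
        _ = v / 2 := by
            rw [← Finset.mul_sum, ← hS]
            field_simp
    have hcheb : ∀ x, {v | v ≤ g x}.indicator (fun v : ℝ => r * v ^ (r - 1)) v ≤
        4 * r * v ^ (r - 3) * ‖∑ y, A x y * fs y‖ ^ 2 := by
      intro x
      rw [Set.indicator_apply]
      split_ifs with h
      · have h1 : v ≤ ‖∑ y, A x y * fs y‖ + ‖∑ y, A x y * fl y‖ := by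
          have h2 : v ≤ ‖∑ y, A x y * f y‖ := h
          rw [hsplit] at h2
          exact h2.trans (norm_add_le _ _)
        have h3 : v / 2 ≤ ‖∑ y, A x y * fs y‖ := by linarith [hlarge x]
        have h4 : (v / 2) ^ 2 ≤ ‖∑ y, A x y * fs y‖ ^ 2 := by gcongr
        have h5 : v ^ (r - 1) = v ^ (r - 3) * v ^ 2 := by
          rw [← Real.rpow_natCast, ← Real.rpow_add hv]
          congr 1
          norm_num
          ring
        have h6 : 0 ≤ 4 * r * v ^ (r - 3) := by positivity
        calc r * v ^ (r - 1) = 4 * r * v ^ (r - 3) * (v / 2) ^ 2 := by rw [h5]; ring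
          _ ≤ _ := mul_le_mul_of_nonneg_left h4 h6
      · positivity
    calc ∑ x, {v | v ≤ g x}.indicator (fun v : ℝ => r * v ^ (r - 1)) v
        ≤ ∑ x, 4 * r * v ^ (r - 3) * ‖∑ y, A x y * fs y‖ ^ 2 :=
          Finset.sum_le_sum fun x _ => hcheb x
      _ ≤ 4 * r * v ^ (r - 3) * ∑ y, ‖fs y‖ ^ 2 := by
          rw [← Finset.mul_sum]
          exact mul_le_mul_of_nonneg_left (hA2 fs) (by positivity)
      _ = _ := by
          rw [Finset.mul_sum]
          refine Finset.sum_congr rfl fun y _ => ?_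
          rw [Set.indicator_apply]
          simp only [hfs, Set.mem_ofPred_eq]
          split_ifs
          · ring
          · simp
  have hI1 := fun x => intervalIntegral_indicator_rpow (e := r - 1) (by linarith) (hg0 x) (hgG x) r
  have hI2 := fun y => intervalIntegral_indicator_rpow (e := r - 3) (by linarith) (hΛ0 y) (hΛG y)
    (4 * r * ‖f y‖ ^ 2)
  have hint : ∑ x, ‖∑ y, A x y * f y‖ ^ r ≤
      ∑ y, 4 * r * ‖f y‖ ^ 2 * (Λ y ^ (r - 3 + 1) / (r - 3 + 1)) := by
    calc ∑ x, ‖∑ y, A x y * f y‖ ^ r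
        = ∑ x, ∫ v in (0 : ℝ)..G, {v | v ≤ g x}.indicator (fun v : ℝ => r * v ^ (r - 1)) v := by
          refine Finset.sum_congr rfl fun x _ => ?_
          rw [(hI1 x).2, sub_add_cancel]
          field_simp
          rfl
      _ = ∫ v in (0 : ℝ)..G, ∑ x, {v | v ≤ g x}.indicator (fun v : ℝ => r * v ^ (r - 1)) v :=
          (intervalIntegral.integral_finsetSum fun x _ => (hI1 x).1).symm
      _ ≤ ∫ v in (0 : ℝ)..G,
          ∑ y, {v | v ≤ Λ y}.indicator (fun v : ℝ => 4 * r * ‖f y‖ ^ 2 * v ^ (r - 3)) v := by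
          refine intervalIntegral.integral_mono_on_of_le_Ioo hG0 ?_ ?_ fun v hv => hpt v hv.1
          · have := IntervalIntegrable.sum Finset.univ (fun x _ => (hI1 x).1)
            simpa only [Finset.sum_fn] using this
          · have := IntervalIntegrable.sum Finset.univ (fun y _ => (hI2 y).1)
            simpa only [Finset.sum_fn] using this
      _ = ∑ y, ∫ v in (0 : ℝ)..G,
          {v | v ≤ Λ y}.indicator (fun v : ℝ => 4 * r * ‖f y‖ ^ 2 * v ^ (r - 3)) v :=
          intervalIntegral.integral_finsetSum fun y _ => (hI2 y).1
      _ = _ := Finset.sum_congr rfl fun y _ => (hI2 y).2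
  refine hint.trans (le_of_eq ?_)
  have hexp : ∀ y, 4 * r * ‖f y‖ ^ 2 * (Λ y ^ (r - 3 + 1) / (r - 3 + 1)) =
      4 * r / (r - 2) * (2 * D) ^ (r - 2) * S ^ (r - 2) * ‖f y‖ ^ p := by
    intro y
    rw [show r - 3 + 1 = r - 2 by ring]
    rcases eq_or_ne (f y) 0 with h0 | h0
    · rw [h0, norm_zero, Real.zero_rpow hp0.ne']; ring
    have h1 : 0 < ‖f y‖ := norm_pos_iff.2 h0
    have h2 : Λ y ^ (r - 2) = (2 * D) ^ (r - 2) * S ^ (r - 2) * ‖f y‖ ^ ((1 - p) * (r - 2)) := by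
      simp only [hΛ]
      rw [Real.rpow_mul h1.le, ← Real.mul_rpow (by positivity) (by positivity),
        ← Real.mul_rpow (by positivity) (by positivity)]
      congr 1
      ring
    have h3 : ‖f y‖ ^ p = ‖f y‖ ^ 2 * ‖f y‖ ^ ((1 - p) * (r - 2)) := by
      rw [← Real.rpow_natCast, ← Real.rpow_add h1]
      congr 1
      rw [hp]
      have : r - 1 ≠ 0 := by linarith
      push_cast
      field_simp
      ring
    rw [h2, h3]
    ring
  rw [Finset.sum_congr rfl fun y _ => hexp y, ← Finset.mul_sum, ← hS]
  have : S ^ (r - 1) = S ^ (r - 2) * S := by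
    rw [← Real.rpow_add_one hSpos.ne']
    congr 1
    ring
  rw [this]
  ring

/-! ### Fractional integration in time -/

theorem lintegral_comp_abs_sub_le (f : ℝ → ℝ≥0∞) (t : ℝ) :
    ∫⁻ s, f |t - s| ≤ 2 * ∫⁻ s in Set.Ioi 0, f s := by
  have h1 : ∫⁻ s, f |t - s| = ∫⁻ s, f |s| :=
    MeasureTheory.lintegral_sub_left_eq_self (fun s => f |s|) t
  have h2 : ∫⁻ s in Set.Ioi (0 : ℝ), f |s| = ∫⁻ s in Set.Ioi 0, f s :=
    MeasureTheory.setLIntegral_congr_fun measurableSet_Ioi fun s hs => by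
      simp only [abs_of_pos (Set.mem_Ioi.1 hs)]
  have h3 : ∫⁻ s in Set.Iic (0 : ℝ), f |s| = ∫⁻ s in Set.Ioi 0, f |s| := by
    have h4 := (MeasureTheory.Measure.measurePreserving_neg
      (MeasureTheory.volume : MeasureTheory.Measure ℝ)).setLIntegral_comp_preimage_emb
        (MeasurableEquiv.neg ℝ).measurableEmbedding (fun s => f |s|) (Set.Ici 0)
    rw [MeasureTheory.setLIntegral_congr MeasureTheory.Ioi_ae_eq_Ici, ← h4]
    simp
  rw [h1, ← MeasureTheory.lintegral_add_compl _ (measurableSet_Iic (a := (0 : ℝ))), Set.compl_Iic,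
    h3, h2, two_mul]

theorem lintegral_near_le {γ ρ : ℝ} (hγ1 : γ < 1) (hρ : 0 < ρ) (t : ℝ) :
    ∫⁻ s, {u : ℝ | u ≤ ρ}.indicator (fun u => ENNReal.ofReal (u ^ (-γ))) |t - s| ≤
      ENNReal.ofReal (2 / (1 - γ) * ρ ^ (1 - γ)) := by
  refine (lintegral_comp_abs_sub_le _ t).trans ?_
  have hg : MeasureTheory.IntegrableOn (fun u : ℝ => u ^ (-γ)) (Set.Ioc 0 ρ) :=
    (intervalIntegrable_iff_integrableOn_Ioc_of_le hρ.le).1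
      (intervalIntegral.intervalIntegrable_rpow' (by linarith))
  have h1 : ∫⁻ s in Set.Ioi (0 : ℝ), {u : ℝ | u ≤ ρ}.indicator
      (fun u => ENNReal.ofReal (u ^ (-γ))) s = ∫⁻ s in Set.Ioc 0 ρ, ENNReal.ofReal (s ^ (-γ)) := by
    have : MeasurableSet {u : ℝ | u ≤ ρ} := measurableSet_Iic
    rw [MeasureTheory.lintegral_indicator this, MeasureTheory.Measure.restrict_restrict this]
    congr 2
    ext u
    simp [and_comm]
  rw [h1, ← MeasureTheory.ofReal_integral_eq_lintegral_ofReal hg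
    ((MeasureTheory.ae_restrict_iff' measurableSet_Ioc).2 (Filter.Eventually.of_forall
      fun u hu => Real.rpow_nonneg hu.1.le _)), ← intervalIntegral.integral_of_le hρ.le,
    integral_rpow (Or.inl (by linarith)), Real.zero_rpow (by linarith),
    ← ENNReal.ofReal_ofNat 2, ← ENNReal.ofReal_mul (by norm_num)]
  refine ENNReal.ofReal_le_ofReal (le_of_eq ?_)
  rw [show -γ + 1 = 1 - γ by ring]
  ring

theorem lintegral_far_le {γ ρ : ℝ} (hγ : 0 < γ) (hρ : 0 < ρ) (t : ℝ) :
    ∫⁻ s, ({u : ℝ | ρ < u}.indicator (fun u => ENNReal.ofReal (u ^ (-γ))) |t - s|) ^ (2 / γ) ≤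
      ENNReal.ofReal (2 / ρ) := by
  refine (lintegral_comp_abs_sub_le (fun u => ({u : ℝ | ρ < u}.indicator
    (fun u => ENNReal.ofReal (u ^ (-γ))) u) ^ (2 / γ)) t).trans ?_
  have hg : MeasureTheory.IntegrableOn (fun u : ℝ => u ^ (-2 : ℝ)) (Set.Ioi ρ) :=
    integrableOn_Ioi_rpow_of_lt (by norm_num) hρ
  have h1 : ∫⁻ s in Set.Ioi (0 : ℝ), ({u : ℝ | ρ < u}.indicator
      (fun u => ENNReal.ofReal (u ^ (-γ))) s) ^ (2 / γ) =
      ∫⁻ s in Set.Ioi ρ, ENNReal.ofReal (s ^ (-2 : ℝ)) := by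
    have hm : MeasurableSet {u : ℝ | ρ < u} := measurableSet_Ioi
    have e : ∀ s : ℝ, ({u : ℝ | ρ < u}.indicator (fun u => ENNReal.ofReal (u ^ (-γ))) s) ^ (2 / γ) =
        {u : ℝ | ρ < u}.indicator (fun u => ENNReal.ofReal (u ^ (-2 : ℝ))) s := by
      intro s
      rw [Set.indicator_apply, Set.indicator_apply]
      split_ifs with h
      · have hs : 0 < s := hρ.trans h
        rw [ENNReal.ofReal_rpow_of_pos (by positivity), ← Real.rpow_mul hs.le]
        congr 2
        field_simp
      · rw [ENNReal.zero_rpow_of_pos (by positivity)]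
    simp only [e]
    rw [MeasureTheory.lintegral_indicator hm, MeasureTheory.Measure.restrict_restrict hm]
    congr 2
    ext u
    simp only [Set.mem_inter_iff, Set.mem_Ioi]
    exact ⟨fun h => h.1, fun h => ⟨h, hρ.trans h⟩⟩
  rw [h1, ← MeasureTheory.ofReal_integral_eq_lintegral_ofReal hg
    ((MeasureTheory.ae_restrict_iff' measurableSet_Ioi).2 (Filter.Eventually.of_forall
      fun u hu => Real.rpow_nonneg (hρ.trans hu).le _)), integral_Ioi_rpow_of_lt (by norm_num) hρ,
    ← ENNReal.ofReal_ofNat 2, ← ENNReal.ofReal_mul (by norm_num)]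
  refine ENNReal.ofReal_le_ofReal (le_of_eq ?_)
  norm_num
  rw [Real.rpow_neg_one]
  field_simp

/-- The part of the fractional integral of `φ` where `φ` is at most `a`: for `|t - s| ≤ ρ` bound
`φ` by `a`, for `|t - s| > ρ` use Hölder's inequality, with `ρ = S a ^ (-p)`. -/
theorem lintegral_sublevel_mul_le {γ : ℝ} (hγ : 0 < γ) (hγ1 : γ < 1) {φ : ℝ → ℝ}
    (hφ : Measurable φ) (hφ0 : ∀ t, 0 ≤ φ t) {S : ℝ} (hS : 0 < S)
    (hφS : ∫⁻ t, ENNReal.ofReal (φ t ^ (2 / (2 - γ))) = ENNReal.ofReal S) {a : ℝ} (ha : 0 < a)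
    (t : ℝ) :
    ∫⁻ s, {s | φ s ≤ a}.indicator (fun s => ENNReal.ofReal (φ s * |t - s| ^ (-γ))) s ≤
      ENNReal.ofReal ((2 / (1 - γ) + 2) * S ^ (1 - γ) * a ^ (γ / (2 - γ))) := by
  set p : ℝ := 2 / (2 - γ) with hp
  have h2γ : 0 < 2 - γ := by linarith
  have hp0 : 0 < p := by positivity
  set ρ : ℝ := S * a ^ (-p) with hρ
  have hρ0 : 0 < ρ := by positivity
  have hconj : p.HolderConjugate (2 / γ) := by
    rw [Real.holderConjugate_iff]
    constructor
    · rw [hp, lt_div_iff₀ h2γ]; linarith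
    · rw [hp]; field_simp; ring
  have hk : Measurable fun s : ℝ => {u : ℝ | ρ < u}.indicator
      (fun u => ENNReal.ofReal (u ^ (-γ))) |t - s| := by
    have h1 : Measurable ({u : ℝ | ρ < u}.indicator (fun u : ℝ => ENNReal.ofReal (u ^ (-γ)))) :=
      Measurable.indicator (by fun_prop) measurableSet_Ioi
    exact h1.comp (by fun_prop)
  have hpt : ∀ s, {s | φ s ≤ a}.indicator (fun s => ENNReal.ofReal (φ s * |t - s| ^ (-γ))) s ≤
      ENNReal.ofReal a * {u : ℝ | u ≤ ρ}.indicator (fun u => ENNReal.ofReal (u ^ (-γ))) |t - s| +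
      ENNReal.ofReal (φ s) *
        {u : ℝ | ρ < u}.indicator (fun u => ENNReal.ofReal (u ^ (-γ))) |t - s| := by
    intro s
    by_cases hs : φ s ≤ a
    · rw [Set.indicator_of_mem (by exact hs), ENNReal.ofReal_mul (hφ0 s)]
      rcases le_or_gt |t - s| ρ with h | h
      · rw [Set.indicator_of_mem (show |t - s| ∈ {u : ℝ | u ≤ ρ} from h)]
        exact le_add_right (mul_le_mul_left (ENNReal.ofReal_le_ofReal hs) _)
      · rw [Set.indicator_of_mem (show |t - s| ∈ {u : ℝ | ρ < u} from h)]
        exact le_add_left le_rfl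
    · rw [Set.indicator_of_notMem (by exact hs)]
      exact zero_le
  refine (MeasureTheory.lintegral_mono hpt).trans ?_
  have hm : Measurable fun s => ENNReal.ofReal (φ s) *
      {u : ℝ | ρ < u}.indicator (fun u => ENNReal.ofReal (u ^ (-γ))) |t - s| :=
    (hφ.ennreal_ofReal).mul hk
  rw [MeasureTheory.lintegral_add_right _ hm,
    MeasureTheory.lintegral_const_mul' _ _ ENNReal.ofReal_ne_top]
  have hnear := mul_le_mul_right (lintegral_near_le hγ1 hρ0 t) (ENNReal.ofReal a)
  have hfar := ENNReal.lintegral_mul_le_Lp_mul_Lq MeasureTheory.volume hconj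
    hφ.ennreal_ofReal.aemeasurable hk.aemeasurable
  have hφS' : ∫⁻ t, ENNReal.ofReal (φ t) ^ p = ENNReal.ofReal S := by
    rw [← hφS]
    exact MeasureTheory.lintegral_congr fun t => ENNReal.ofReal_rpow_of_nonneg (hφ0 t) hp0.le
  rw [hφS'] at hfar
  have hfar2 := hfar.trans (mul_le_mul_right (ENNReal.rpow_le_rpow (lintegral_far_le hγ hρ0 t)
    (show 0 ≤ 1 / (2 / γ) by positivity)) _)
  rw [ENNReal.ofReal_rpow_of_pos hS, ENNReal.ofReal_rpow_of_pos (by positivity),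
    ← ENNReal.ofReal_mul (by positivity)] at hfar2
  rw [← ENNReal.ofReal_mul ha.le] at hnear
  refine (add_le_add hnear hfar2).trans ?_
  have h1γ : 0 < 1 - γ := by linarith
  rw [← ENNReal.ofReal_add (by positivity) (by positivity)]
  refine ENNReal.ofReal_le_ofReal ?_
  -- the choice of `ρ` gives both parts the same size
  have e1 : a * ρ ^ (1 - γ) = S ^ (1 - γ) * a ^ (γ / (2 - γ)) := by
    rw [hρ, Real.mul_rpow hS.le (by positivity), ← Real.rpow_mul ha.le]
    nth_rewrite 1 [← Real.rpow_one a]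
    rw [mul_left_comm, ← Real.rpow_add ha]
    congr 2
    rw [hp]
    field_simp
    ring
  have e2 : S ^ (1 / p) * (1 / ρ) ^ (1 / (2 / γ)) = S ^ (1 - γ) * a ^ (γ / (2 - γ)) := by
    rw [one_div ρ, Real.inv_rpow hρ0.le, ← Real.rpow_neg hρ0.le, hρ,
      Real.mul_rpow hS.le (by positivity), ← Real.rpow_mul ha.le, ← mul_assoc, ← Real.rpow_add hS]
    congr 2
    · rw [hp]; field_simp; ring
    · rw [hp]; field_simp
  have e3 : (2 / ρ) ^ (1 / (2 / γ)) ≤ 2 * (1 / ρ) ^ (1 / (2 / γ)) := by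
    rw [show 2 / ρ = 2 * (1 / ρ) by ring, Real.mul_rpow (by norm_num) (by positivity)]
    gcongr
    refine (Real.rpow_le_rpow_of_exponent_le (by norm_num) (?_ : 1 / (2 / γ) ≤ 1)).trans
      (le_of_eq (Real.rpow_one 2))
    rw [one_div_div]
    linarith
  have e4 : 0 ≤ S ^ (1 / p) := by positivity
  calc a * (2 / (1 - γ) * ρ ^ (1 - γ)) + S ^ (1 / p) * (2 / ρ) ^ (1 / (2 / γ))
      ≤ 2 / (1 - γ) * (a * ρ ^ (1 - γ)) + 2 * (S ^ (1 / p) * (1 / ρ) ^ (1 / (2 / γ))) := by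
        have := mul_le_mul_of_nonneg_left e3 e4
        linarith
    _ = _ := by rw [e1, e2]; ring

/-- The diagonal case of the Hardy–Littlewood–Sobolev inequality on the line. By symmetry it
suffices to integrate over `φ s ≤ φ t`. -/
theorem lintegral_lintegral_mul_rpow_le {γ : ℝ} (hγ : 0 < γ) (hγ1 : γ < 1) {φ : ℝ → ℝ}
    (hφ : Measurable φ) (hφ0 : ∀ t, 0 ≤ φ t) {S : ℝ} (hS : 0 < S)
    (hφS : ∫⁻ t, ENNReal.ofReal (φ t ^ (2 / (2 - γ))) = ENNReal.ofReal S) :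
    ∫⁻ t, ∫⁻ s, ENNReal.ofReal (φ t * φ s * |t - s| ^ (-γ)) ≤
      ENNReal.ofReal (2 * (2 / (1 - γ) + 2) * S ^ (2 - γ)) := by
  have h1γ : 0 < 1 - γ := by linarith
  have h2γ : 0 < 2 - γ := by linarith
  set Φ : ℝ → ℝ → ℝ≥0∞ := fun t s =>
    {s | φ s ≤ φ t}.indicator (fun s => ENNReal.ofReal (φ t * φ s * |t - s| ^ (-γ))) s with hΦ
  have hΦm : Measurable (Function.uncurry Φ) := by
    have e : Function.uncurry Φ = {z : ℝ × ℝ | φ z.2 ≤ φ z.1}.indicator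
        (fun z => ENNReal.ofReal (φ z.1 * φ z.2 * |z.1 - z.2| ^ (-γ))) := by
      ext ⟨t, s⟩
      simp only [Function.uncurry, hΦ, Set.indicator_apply, Set.mem_ofPred_eq]
    rw [e]
    exact Measurable.indicator (by fun_prop) (measurableSet_le (by fun_prop) (by fun_prop))
  have hle : ∀ t s, ENNReal.ofReal (φ t * φ s * |t - s| ^ (-γ)) ≤ Φ t s + Φ s t := by
    intro t s
    rcases le_total (φ s) (φ t) with h | h
    · have : Φ t s = ENNReal.ofReal (φ t * φ s * |t - s| ^ (-γ)) :=
        Set.indicator_of_mem (show s ∈ {s | φ s ≤ φ t} from h) _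
      rw [this]
      exact le_self_add
    · have : Φ s t = ENNReal.ofReal (φ s * φ t * |s - t| ^ (-γ)) :=
        Set.indicator_of_mem (show t ∈ {t | φ t ≤ φ s} from h) _
      rw [this, abs_sub_comm, mul_comm (φ s)]
      exact le_add_self
  have hhalf : ∫⁻ t, ∫⁻ s, Φ t s ≤ ENNReal.ofReal ((2 / (1 - γ) + 2) * S ^ (2 - γ)) := by
    have h1 : ∀ t, ∫⁻ s, Φ t s ≤ ENNReal.ofReal ((2 / (1 - γ) + 2) * S ^ (1 - γ)) *
        ENNReal.ofReal (φ t ^ (2 / (2 - γ))) := by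
      intro t
      rcases (hφ0 t).eq_or_lt with h | h
      · have : ∀ s, Φ t s = 0 := by
          intro s
          simp only [hΦ, ← h, zero_mul, ENNReal.ofReal_zero, Set.indicator_zero]
        simp [this]
      · have h2 := mul_le_mul_right (lintegral_sublevel_mul_le hγ hγ1 hφ hφ0 hS hφS h t)
          (ENNReal.ofReal (φ t))
        rw [← MeasureTheory.lintegral_const_mul' _ _ ENNReal.ofReal_ne_top] at h2
        refine le_trans (le_of_eq ?_) (h2.trans (le_of_eq ?_))
        · refine MeasureTheory.lintegral_congr fun s => ?_
          simp only [hΦ, Set.indicator_apply]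
          split_ifs
          · rw [← ENNReal.ofReal_mul h.le, mul_assoc]
          · simp
        · rw [← ENNReal.ofReal_mul h.le, ← ENNReal.ofReal_mul (by positivity)]
          congr 1
          have : φ t ^ (2 / (2 - γ)) = φ t * φ t ^ (γ / (2 - γ)) := by
            nth_rewrite 2 [← Real.rpow_one (φ t)]
            rw [← Real.rpow_add h]
            congr 1
            field_simp
            ring
          rw [this]
          ring
    refine (MeasureTheory.lintegral_mono h1).trans ?_
    rw [MeasureTheory.lintegral_const_mul' _ _ ENNReal.ofReal_ne_top, hφS,
      ← ENNReal.ofReal_mul (by positivity)]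
    refine ENNReal.ofReal_le_ofReal (le_of_eq ?_)
    have : S ^ (2 - γ) = S ^ (1 - γ) * S := by
      rw [← Real.rpow_add_one hS.ne']; congr 1; ring
    rw [this]
    ring
  calc ∫⁻ t, ∫⁻ s, ENNReal.ofReal (φ t * φ s * |t - s| ^ (-γ))
      ≤ ∫⁻ t, ∫⁻ s, (Φ t s + Φ s t) :=
        MeasureTheory.lintegral_mono fun t => MeasureTheory.lintegral_mono fun s => hle t s
    _ = ∫⁻ t, ((∫⁻ s, Φ t s) + ∫⁻ s, Φ s t) := by
        refine MeasureTheory.lintegral_congr fun t => ?_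
        exact MeasureTheory.lintegral_add_left (hΦm.comp (measurable_const.prodMk measurable_id)) _
    _ = (∫⁻ t, ∫⁻ s, Φ t s) + ∫⁻ t, ∫⁻ s, Φ s t :=
        MeasureTheory.lintegral_add_left hΦm.lintegral_prod_right _
    _ = (∫⁻ t, ∫⁻ s, Φ t s) + ∫⁻ t, ∫⁻ s, Φ t s := by
        congr 1
        exact (MeasureTheory.lintegral_lintegral_swap hΦm.aemeasurable).symm
    _ ≤ _ := by
        refine (add_le_add hhalf hhalf).trans (le_of_eq ?_)
        rw [← ENNReal.ofReal_add (by positivity) (by positivity)]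
        congr 1
        ring

/-- The `TT*` argument. Here `c` is the datum, `n t` the norm of the solution at time `t`, and
`G t` the image under the adjoint flow of a functional norming the solution. -/
theorem lintegral_rpow_le_of_inner {H : Type*} [NormedAddCommGroup H] [InnerProductSpace ℂ H]
    [CompleteSpace H] {q B : ℝ} (hq : 2 < q) (hB : 0 < B) {I : Set ℝ} (hI : MeasurableSet I)
    {n : ℝ → ℝ} (hn : Measurable n) (hn0 : ∀ t, 0 ≤ n t)
    (hnq : MeasureTheory.IntegrableOn (fun t => n t ^ q) I) {G : ℝ → H}
    (hG : MeasureTheory.IntegrableOn G I) (c : H)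
    (hpair : ∀ t ∈ I, (inner ℂ c (G t) : ℂ) = ((n t ^ q : ℝ) : ℂ))
    (hker : ∀ t ∈ I, ∀ s ∈ I, t ≠ s → ‖(inner ℂ (G t) (G s) : ℂ)‖ ≤
      B * (n t ^ (q - 1) * n s ^ (q - 1) * |t - s| ^ (-(2 / q)))) :
    ∫⁻ t in I, ENNReal.ofReal (n t ^ q) ≤
      ENNReal.ofReal ((2 * (2 / (1 - 2 / q) + 2) * B) ^ (q / 2) * ‖c‖ ^ q) := by
  classical
  have hq0 : 0 < q := by linarith
  have hγ1 : 2 / q < 1 := by rw [div_lt_one hq0]; exact hq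
  have h1γ : 0 < 1 - 2 / q := by linarith
  set A : ℝ := 2 * (2 / (1 - 2 / q) + 2) with hA
  have hA0 : 0 < A := by positivity
  set S : ℝ := ∫ t in I, n t ^ q with hS
  have hS0 : 0 ≤ S := MeasureTheory.integral_nonneg fun t => Real.rpow_nonneg (hn0 t) _
  have hlS : ∫⁻ t in I, ENNReal.ofReal (n t ^ q) = ENNReal.ofReal S :=
    (MeasureTheory.ofReal_integral_eq_lintegral_ofReal hnq
      (Filter.Eventually.of_forall fun t => Real.rpow_nonneg (hn0 t) _)).symm
  rw [hlS]
  refine ENNReal.ofReal_le_ofReal ?_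
  rcases hS0.eq_or_lt with h | hSpos
  · rw [← h]; positivity
  set φ : ℝ → ℝ := I.indicator fun t => n t ^ (q - 1) with hφ
  have hφ0 : ∀ t, 0 ≤ φ t := fun t => Set.indicator_nonneg (fun t _ => Real.rpow_nonneg (hn0 t) _) t
  have hφm : Measurable φ := (hn.pow_const _).indicator hI
  have hφS : ∫⁻ t, ENNReal.ofReal (φ t ^ (2 / (2 - 2 / q))) = ENNReal.ofReal S := by
    rw [← hlS, ← MeasureTheory.lintegral_indicator hI]
    refine MeasureTheory.lintegral_congr fun t => ?_
    have hq1 : 2 / (2 - 2 / q) = q / (q - 1) := by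
      have : q - 1 ≠ 0 := by linarith
      have : 2 - 2 / q ≠ 0 := by linarith
      field_simp
    have hq1' : 0 < q - 1 := by linarith
    rw [hq1]
    simp only [hφ, Set.indicator_apply]
    split_ifs
    · rw [← Real.rpow_mul (hn0 t)]
      congr 2
      field_simp
    · rw [Real.zero_rpow (by positivity), ENNReal.ofReal_zero]
  have hHLS := lintegral_lintegral_mul_rpow_le (by positivity : 0 < 2 / q) hγ1 hφm hφ0 hSpos hφS
  set V : H := ∫ t in I, G t with hV
  -- pairing the datum with the time average `V` of the norming functionals recovers `S`
  have hSV : S ≤ ‖c‖ * ‖V‖ := by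
    have h1 : (inner ℂ c V : ℂ) = (S : ℂ) := by
      rw [hV, ← integral_inner hG, hS]
      exact (MeasureTheory.setIntegral_congr_fun hI hpair).trans (integral_ofReal (𝕜 := ℂ))
    have h2 := norm_inner_le_norm (𝕜 := ℂ) c V
    rw [h1, Complex.norm_real, Real.norm_eq_abs, abs_of_pos hSpos] at h2
    exact h2
  have hVV : ‖V‖ ^ 2 ≤ B * (A * S ^ (2 - 2 / q)) := by
    have h1 : ENNReal.ofReal (‖V‖ ^ 2) = ‖(inner ℂ V V : ℂ)‖ₑ := by
      rw [← ofReal_norm, inner_self_eq_norm_sq_to_K, norm_pow]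
      simp
    have h2 : ‖(inner ℂ V V : ℂ)‖ₑ ≤ ∫⁻ t in I, ∫⁻ s in I, ‖(inner ℂ (G t) (G s) : ℂ)‖ₑ := by
      nth_rewrite 2 [hV]
      rw [← integral_inner hG]
      refine (MeasureTheory.enorm_integral_le_lintegral_enorm _).trans
        (MeasureTheory.lintegral_mono fun t => ?_)
      rw [← inner_conj_symm, RCLike.enorm_conj, hV, ← integral_inner hG]
      exact MeasureTheory.enorm_integral_le_lintegral_enorm _
    have h3 : ∫⁻ t in I, ∫⁻ s in I, ‖(inner ℂ (G t) (G s) : ℂ)‖ₑ ≤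
        ENNReal.ofReal B * ∫⁻ t, ∫⁻ s, ENNReal.ofReal (φ t * φ s * |t - s| ^ (-(2 / q))) := by
      rw [← MeasureTheory.lintegral_const_mul' _ _ ENNReal.ofReal_ne_top,
        ← MeasureTheory.lintegral_indicator hI]
      refine MeasureTheory.lintegral_mono fun t => ?_
      rw [Set.indicator_apply]
      split_ifs with ht
      · rw [← MeasureTheory.lintegral_const_mul' _ _ ENNReal.ofReal_ne_top,
          ← MeasureTheory.lintegral_indicator hI]
        refine MeasureTheory.lintegral_mono_ae ?_
        filter_upwards [MeasureTheory.Measure.ae_ne MeasureTheory.volume t] with s hst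
        rw [Set.indicator_apply]
        split_ifs with hs
        · rw [← ENNReal.ofReal_mul hB.le, ← ofReal_norm]
          refine ENNReal.ofReal_le_ofReal ?_
          simp only [hφ, Set.indicator_of_mem ht, Set.indicator_of_mem hs]
          exact hker t ht s hs (Ne.symm hst)
        · exact zero_le
      · exact zero_le
    have h4 := h1.le.trans (h2.trans (h3.trans (mul_le_mul_right hHLS _)))
    rw [← ENNReal.ofReal_mul hB.le] at h4
    exact (ENNReal.ofReal_le_ofReal_iff (by positivity)).1 h4
  -- since `S` is finite, its power on the right can be absorbed
  have hfin : S ^ (2 / q) ≤ A * B * ‖c‖ ^ 2 := by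
    have h1 : S ^ 2 ≤ ‖c‖ ^ 2 * (B * (A * S ^ (2 - 2 / q))) := by
      calc S ^ 2 ≤ (‖c‖ * ‖V‖) ^ 2 := by gcongr
        _ = ‖c‖ ^ 2 * ‖V‖ ^ 2 := by ring
        _ ≤ _ := by gcongr
    have h2 : S ^ 2 = S ^ (2 / q) * S ^ (2 - 2 / q) := by
      rw [← Real.rpow_add hSpos, ← Real.rpow_natCast]
      congr 1
      push_cast
      ring
    have h3 : 0 < S ^ (2 - 2 / q) := by positivity
    refine le_of_mul_le_mul_right ?_ h3
    rw [← h2]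
    linarith
  calc S = (S ^ (2 / q)) ^ (q / 2) := by
        rw [← Real.rpow_mul hS0]
        have : 2 / q * (q / 2) = 1 := by field_simp
        rw [this, Real.rpow_one]
    _ ≤ (A * B * ‖c‖ ^ 2) ^ (q / 2) := by gcongr
    _ = (A * B) ^ (q / 2) * ‖c‖ ^ q := by
        rw [Real.mul_rpow (by positivity) (by positivity), ← Real.rpow_natCast,
          ← Real.rpow_mul (norm_nonneg c)]
        congr 2
        push_cast
        field_simp

/-! ### Frequency-localized estimates up to the crossing time -/

/-- The kernel of the Schrödinger flow restricted to the frequencies in `{1, …, n}ᵈ`. -/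
def kernel (d M : ℕ) (h : ℝ) (n : ℕ) (t : ℝ) (x y : Site d M) : ℂ :=
  ∑ k ∈ modes d n, Complex.exp (((-t * energy M h k : ℝ) : ℂ) * Complex.I) *
    ((mode d M k).val x * (mode d M k).val y)

/-- The solution of the Schrödinger equation whose initial datum has the coefficients `a k` on the
frequencies in `{1, …, n}ᵈ`. -/
def flow (d M : ℕ) (h : ℝ) (n : ℕ) (a : (Fin d → ℕ) → ℂ) (t : ℝ) (x : Site d M) : ℂ :=
  ∑ k ∈ modes d n, a k * (Complex.exp (((-t * energy M h k : ℝ) : ℂ) * Complex.I) *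
    (mode d M k).val x)

theorem continuous_flow (d M : ℕ) (h : ℝ) (n : ℕ) (a : (Fin d → ℕ) → ℂ) (x : Site d M) :
    Continuous fun t => flow d M h n a t x := by
  unfold flow
  fun_prop

theorem sum_mul_kernel_mul {d M : ℕ} (h : ℝ) (n : ℕ) (t : ℝ) (g f : Site d M → ℂ) :
    ∑ x, g x * ∑ y, kernel d M h n t x y * f y =
      ∑ k ∈ modes d n, Complex.exp (((-t * energy M h k : ℝ) : ℂ) * Complex.I) *
        ((∑ x, (mode d M k).val x * g x) * ∑ y, (mode d M k).val y * f y) := by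
  simp only [kernel, Finset.sum_mul, Finset.mul_sum]
  rw [Finset.sum_comm' (t' := Finset.univ) (s' := fun _ => Finset.univ) (by simp)]
  rw [Finset.sum_congr rfl fun y _ => Finset.sum_comm]
  rw [Finset.sum_comm]
  refine Finset.sum_congr rfl fun k _ => Finset.sum_congr rfl fun y _ =>
    Finset.sum_congr rfl fun x _ => ?_
  ring

theorem norm_sum_mul_kernel_mul_sq_le {d M n : ℕ} (hn : n ≤ 2 * M - 1) (h t : ℝ)
    (g f : Site d M → ℂ) :
    ‖∑ x, g x * ∑ y, kernel d M h n t x y * f y‖ ^ 2 ≤ (∑ x, ‖g x‖ ^ 2) * ∑ y, ‖f y‖ ^ 2 := by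
  rw [sum_mul_kernel_mul]
  calc _ ≤ (∑ k ∈ modes d n, ‖∑ x, (mode d M k).val x * g x‖ *
        ‖∑ y, (mode d M k).val y * f y‖) ^ 2 := by
        gcongr
        refine (norm_sum_le _ _).trans (Finset.sum_le_sum fun k _ => ?_)
        rw [norm_mul, Complex.norm_exp_ofReal_mul_I, one_mul, norm_mul]
    _ ≤ (∑ k ∈ modes d n, ‖∑ x, (mode d M k).val x * g x‖ ^ 2) *
        ∑ k ∈ modes d n, ‖∑ y, (mode d M k).val y * f y‖ ^ 2 :=
        Finset.sum_mul_sq_le_sq_mul_sq _ _ _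
    _ ≤ _ := mul_le_mul (sum_norm_sum_mode_mul_sq_le hn g) (sum_norm_sum_mode_mul_sq_le hn f)
        (Finset.sum_nonneg fun _ _ => by positivity) (Finset.sum_nonneg fun _ _ => by positivity)

/-- The frequency-localized flow is a contraction of `ℓ²`. -/
theorem sum_norm_kernel_sq_le {d M n : ℕ} (hn : n ≤ 2 * M - 1) (h t : ℝ) (f : Site d M → ℂ) :
    ∑ x, ‖∑ y, kernel d M h n t x y * f y‖ ^ 2 ≤ ∑ y, ‖f y‖ ^ 2 := by
  set g : Site d M → ℂ := fun x => ∑ y, kernel d M h n t x y * f y with hg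
  have h1 := norm_sum_mul_kernel_mul_sq_le hn h t (fun x => starRingEnd ℂ (g x)) f
  have h2 : ∑ x, starRingEnd ℂ (g x) * ∑ y, kernel d M h n t x y * f y =
      ((∑ x, ‖g x‖ ^ 2 : ℝ) : ℂ) := by
    rw [Complex.ofReal_sum]
    refine Finset.sum_congr rfl fun x _ => ?_
    rw [mul_comm, Complex.mul_conj, Complex.normSq_eq_norm_sq]
  rw [h2, Complex.norm_real, Real.norm_eq_abs, sq_abs] at h1
  simp only [RCLike.norm_conj] at h1
  have h3 : 0 ≤ ∑ x, ‖g x‖ ^ 2 := Finset.sum_nonneg fun _ _ => by positivity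
  rcases h3.eq_or_lt with h4 | h4
  · rw [← h4]
    exact Finset.sum_nonneg fun _ _ => by positivity
  · rw [sq] at h1
    exact le_of_mul_le_mul_left h1 h4

/-- The `TT*` argument for the lattice flow, given functionals `F t` norming the solution. -/
theorem lintegral_rpow_le_of_norming {d M n : ℕ} (h : ℝ) (a : (Fin d → ℕ) → ℂ) {q B : ℝ}
    (hq : 2 < q) (hB : 0 < B) {α β : ℝ} {N : ℝ → ℝ} (hN : Continuous N) (hN0 : ∀ t, 0 ≤ N t)
    {F : ℝ → Site d M → ℂ} (hF : ∀ x, Measurable fun t => F t x)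
    (hFN : ∀ t x, ‖F t x‖ ≤ N t ^ (q - 1))
    (hpair : ∀ t, ∑ x, starRingEnd ℂ (flow d M h n a t x) * F t x = ((N t ^ q : ℝ) : ℂ))
    (hker : ∀ t ∈ Set.Icc α β, ∀ s ∈ Set.Icc α β, t ≠ s →
      ‖∑ x, starRingEnd ℂ (F t x) * ∑ y, kernel d M h n (t - s) x y * F s y‖ ≤
        B * (N t ^ (q - 1) * N s ^ (q - 1) * |t - s| ^ (-(2 / q)))) :
    ∫⁻ t in Set.Icc α β, ENNReal.ofReal (N t ^ q) ≤
      ENNReal.ofReal ((2 * (2 / (1 - 2 / q) + 2) * B) ^ (q / 2) *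
        (∑ k ∈ modes d n, ‖a k‖ ^ 2) ^ (q / 2)) := by
  have hq1 : 0 ≤ q - 1 := by linarith
  let c : EuclideanSpace ℂ (modes d n) := WithLp.toLp 2 fun k => a k.1
  let G : ℝ → EuclideanSpace ℂ (modes d n) := fun t => WithLp.toLp 2 fun k =>
    Complex.exp (((t * energy M h k.1 : ℝ) : ℂ) * Complex.I) *
      ∑ x, (mode d M k.1).val x * F t x
  have hc : ‖c‖ ^ q = (∑ k ∈ modes d n, ‖a k‖ ^ 2) ^ (q / 2) := by
    rw [EuclideanSpace.norm_eq, Real.sqrt_eq_rpow, ← Real.rpow_mul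
      (Finset.sum_nonneg fun _ _ => by positivity)]
    have e1 : ∑ k : modes d n, ‖c k‖ ^ 2 = ∑ k ∈ modes d n, ‖a k‖ ^ 2 :=
      Finset.sum_coe_sort (modes d n) fun k => ‖a k‖ ^ 2
    rw [e1]
    congr 1
    ring
  have hGm : Measurable G := by
    refine (WithLp.measurable_toLp 2 _).comp (measurable_pi_lambda _ fun k => ?_)
    exact Measurable.mul (by fun_prop) (Finset.measurable_sum _ fun x _ => (hF x).const_mul _)
  obtain ⟨b, hb⟩ := (isCompact_Icc (a := α) (b := β)).bddAbove_image
    (hN.rpow_const fun _ => Or.inr hq1).continuousOn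
  have hGI : MeasureTheory.IntegrableOn G (Set.Icc α β) := by
    refine MeasureTheory.Measure.integrableOn_of_bounded (M := ∑ k : modes d n,
      ∑ x, ‖(mode d M k.1).val x‖ * b) (by simp) hGm.aestronglyMeasurable
      ((MeasureTheory.ae_restrict_iff' measurableSet_Icc).2
        (Filter.Eventually.of_forall fun t ht => ?_))
    have h1 : ∀ x, ‖F t x‖ ≤ b := fun x => (hFN t x).trans (hb ⟨t, ht, rfl⟩)
    have h2 : ‖G t‖ ≤ ∑ k : modes d n, ‖G t k‖ := by
      rw [EuclideanSpace.norm_eq]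
      refine Real.sqrt_le_iff.2 ⟨Finset.sum_nonneg fun _ _ => norm_nonneg _, ?_⟩
      exact Finset.sum_sq_le_sq_sum_of_nonneg fun _ _ => norm_nonneg _
    refine h2.trans (Finset.sum_le_sum fun k _ => ?_)
    change ‖Complex.exp (((t * energy M h k.1 : ℝ) : ℂ) * Complex.I) *
      ∑ x, (mode d M k.1).val x * F t x‖ ≤ _
    rw [norm_mul, Complex.norm_exp_ofReal_mul_I, one_mul]
    refine (norm_sum_le _ _).trans (Finset.sum_le_sum fun x _ => ?_)
    rw [norm_mul]
    exact mul_le_mul_of_nonneg_left (h1 x) (norm_nonneg _)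
  rw [← hc]
  refine lintegral_rpow_le_of_inner hq hB measurableSet_Icc hN.measurable hN0
    ((hN.rpow_const fun _ => Or.inr (by linarith)).continuousOn.integrableOn_Icc) hGI c ?_ ?_
  · intro t _
    rw [← hpair t, PiLp.inner_apply]
    change ∑ k : modes d n, (Complex.exp (((t * energy M h k.1 : ℝ) : ℂ) * Complex.I) *
      ∑ x, (mode d M k.1).val x * F t x) * starRingEnd ℂ (a k.1) = _
    rw [Finset.sum_coe_sort (modes d n) fun k =>
      (Complex.exp (((t * energy M h k : ℝ) : ℂ) * Complex.I) *
      ∑ x, (mode d M k).val x * F t x) * starRingEnd ℂ (a k)]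
    simp only [flow, map_sum, Finset.sum_mul, Finset.mul_sum]
    rw [Finset.sum_comm]
    refine Finset.sum_congr rfl fun x _ => Finset.sum_congr rfl fun k _ => ?_
    rw [map_mul, map_mul, conj_mode_val, ← Complex.exp_conj, map_mul, Complex.conj_I,
      Complex.conj_ofReal]
    have : ((-t * energy M h k : ℝ) : ℂ) * -Complex.I = ((t * energy M h k : ℝ) : ℂ) * Complex.I := by
      push_cast; ring
    rw [this]
    ring
  · intro t ht s hs hts
    refine le_trans (le_of_eq ?_) (hker t ht s hs hts)
    rw [sum_mul_kernel_mul, PiLp.inner_apply]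
    change ‖∑ k : modes d n, (Complex.exp (((s * energy M h k.1 : ℝ) : ℂ) * Complex.I) *
      ∑ x, (mode d M k.1).val x * F s x) *
      starRingEnd ℂ (Complex.exp (((t * energy M h k.1 : ℝ) : ℂ) * Complex.I) *
      ∑ x, (mode d M k.1).val x * F t x)‖ = _
    rw [Finset.sum_coe_sort (modes d n) fun k =>
      (Complex.exp (((s * energy M h k : ℝ) : ℂ) * Complex.I) *
      ∑ x, (mode d M k).val x * F s x) *
      starRingEnd ℂ (Complex.exp (((t * energy M h k : ℝ) : ℂ) * Complex.I) *
      ∑ x, (mode d M k).val x * F t x)]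
    congr 1
    refine Finset.sum_congr rfl fun k _ => ?_
    rw [map_mul, ← Complex.exp_conj, map_mul, Complex.conj_I, Complex.conj_ofReal, map_sum]
    simp only [map_mul, conj_mode_val]
    have : Complex.exp (((-(t - s) * energy M h k : ℝ) : ℂ) * Complex.I) =
        Complex.exp (((s * energy M h k : ℝ) : ℂ) * Complex.I) *
          Complex.exp (((t * energy M h k : ℝ) : ℂ) * -Complex.I) := by
      rw [← Complex.exp_add]
      congr 1
      push_cast
      ring
    rw [this]
    ring

/-- The bilinear form of the interpolation between `ℓ¹ → ℓ^∞` and `ℓ² → ℓ²`. -/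
theorem norm_sum_mul_le_of_bounds {ι : Type*} [Fintype ι] (A : ι → ι → ℂ) {D r : ℝ} (hD : 0 < D)
    (hr : 2 < r) (hA : ∀ x y, ‖A x y‖ ≤ D)
    (hA2 : ∀ f : ι → ℂ, ∑ x, ‖∑ y, A x y * f y‖ ^ 2 ≤ ∑ y, ‖f y‖ ^ 2) (g f : ι → ℂ) :
    ‖∑ x, g x * ∑ y, A x y * f y‖ ≤
      ((4 * r / (r - 2)) ^ (1 / r) * (2 * D) ^ (1 - 2 / r)) *
        ((∑ x, ‖g x‖ ^ (r / (r - 1))) ^ ((r - 1) / r) *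
          (∑ x, ‖f x‖ ^ (r / (r - 1))) ^ ((r - 1) / r)) := by
  have hr1 : 0 < r - 1 := by linarith
  have hr2 : 0 < r - 2 := by linarith
  have hr0 : 0 < r := by linarith
  have hconj : (r / (r - 1)).HolderConjugate r := by
    rw [Real.holderConjugate_iff]
    constructor
    · rw [lt_div_iff₀ hr1]; linarith
    · field_simp; ring
  have h1 := Real.inner_le_Lp_mul_Lq_of_nonneg Finset.univ hconj (f := fun x => ‖g x‖)
    (g := fun x => ‖∑ y, A x y * f y‖) (fun _ _ => norm_nonneg _) (fun _ _ => norm_nonneg _)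
  have hS : 0 ≤ ∑ x, ‖f x‖ ^ (r / (r - 1)) := Finset.sum_nonneg fun _ _ => by positivity
  have hS' : 0 ≤ ∑ x, ‖g x‖ ^ (r / (r - 1)) := Finset.sum_nonneg fun _ _ => by positivity
  have h2 : (∑ x, ‖∑ y, A x y * f y‖ ^ r) ^ (1 / r) ≤
      (4 * r / (r - 2)) ^ (1 / r) * (2 * D) ^ (1 - 2 / r) *
        (∑ x, ‖f x‖ ^ (r / (r - 1))) ^ ((r - 1) / r) := by
    refine (Real.rpow_le_rpow (Finset.sum_nonneg fun _ _ => by positivity)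
      (sum_norm_rpow_le_of_bounds A hD hr hA hA2 f) (by positivity)).trans (le_of_eq ?_)
    rw [Real.mul_rpow (by positivity) (by positivity), Real.mul_rpow (by positivity) (by positivity),
      ← Real.rpow_mul (by positivity), ← Real.rpow_mul hS]
    congr 3
    · field_simp
    · field_simp
  have h3 : 1 / (r / (r - 1)) = (r - 1) / r := one_div_div _ _
  rw [h3] at h1
  calc ‖∑ x, g x * ∑ y, A x y * f y‖ ≤ ∑ x, ‖g x‖ * ‖∑ y, A x y * f y‖ :=
        (norm_sum_le _ _).trans (le_of_eq (Finset.sum_congr rfl fun _ _ => norm_mul _ _))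
    _ ≤ _ := h1
    _ ≤ _ := mul_le_mul_of_nonneg_left h2 (by positivity)
    _ = _ := by ring

/-- The functional norming `u` in `ℓ^r`, scaled by the power `q - 1` of the norm. -/
theorem norming_rpow {ι : Type*} [Fintype ι] {q r N : ℝ} (hq : 2 < q) (hr : 2 < r) (u : ι → ℂ)
    (hN : N = (∑ x, ‖u x‖ ^ r) ^ (1 / r)) (F : ι → ℂ)
    (hF : ∀ x, F x = ((N ^ (q - r) * ‖u x‖ ^ (r - 2) : ℝ) : ℂ) * u x) :
    ∑ x, starRingEnd ℂ (u x) * F x = ((N ^ q : ℝ) : ℂ) ∧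
      (∑ x, ‖F x‖ ^ (r / (r - 1))) ^ ((r - 1) / r) = N ^ (q - 1) ∧ ∀ x, ‖F x‖ ≤ N ^ (q - 1) := by
  have hr1 : 0 < r - 1 := by linarith
  have hr0 : 0 < r := by linarith
  have hS0 : 0 ≤ ∑ x, ‖u x‖ ^ r := Finset.sum_nonneg fun _ _ => by positivity
  have hN0 : 0 ≤ N := by rw [hN]; positivity
  have hNr : N ^ r = ∑ x, ‖u x‖ ^ r := by
    rw [hN, ← Real.rpow_mul hS0]
    have : 1 / r * r = 1 := by field_simp
    rw [this, Real.rpow_one]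
  have hpow : ∀ x, ‖u x‖ ^ (r - 2) * ‖u x‖ ^ 2 = ‖u x‖ ^ r := by
    intro x
    rw [← Real.rpow_natCast, ← Real.rpow_add_of_nonneg (norm_nonneg _) (by linarith) (by norm_num)]
    congr 1
    push_cast
    ring
  have hpow1 : ∀ x, ‖u x‖ ^ (r - 2) * ‖u x‖ = ‖u x‖ ^ (r - 1) := by
    intro x
    nth_rewrite 2 [← Real.rpow_one ‖u x‖]
    rw [← Real.rpow_add_of_nonneg (norm_nonneg _) (by linarith) (by norm_num)]
    congr 1
    ring
  have hcombine : ∀ e : ℝ, 0 < e → 0 < q - r + e → N ^ (q - r) * N ^ e = N ^ (q - r + e) := by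
    intro e he he'
    rcases hN0.eq_or_lt with h | h
    · rw [← h, Real.zero_rpow he.ne', Real.zero_rpow he'.ne', mul_zero]
    · rw [Real.rpow_add h]
  have h1 : ∑ x, starRingEnd ℂ (u x) * F x = ((N ^ q : ℝ) : ℂ) := by
    have : ((N ^ q : ℝ) : ℂ) = ((∑ x, N ^ (q - r) * ‖u x‖ ^ r : ℝ) : ℂ) := by
      rw [← Finset.mul_sum, ← hNr, hcombine r hr0 (by linarith), sub_add_cancel]
    rw [this, Complex.ofReal_sum]
    refine Finset.sum_congr rfl fun x _ => ?_
    rw [hF, mul_left_comm, mul_comm (starRingEnd ℂ _), Complex.mul_conj, Complex.normSq_eq_norm_sq,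
      ← Complex.ofReal_mul, mul_assoc, hpow]
  have hFn : ∀ x, ‖F x‖ = N ^ (q - r) * ‖u x‖ ^ (r - 1) := by
    intro x
    rw [hF, norm_mul, Complex.norm_real, Real.norm_eq_abs, abs_of_nonneg (by positivity), mul_assoc,
      hpow1]
  have h2 : (∑ x, ‖F x‖ ^ (r / (r - 1))) ^ ((r - 1) / r) = N ^ (q - 1) := by
    have e : ∀ x, ‖F x‖ ^ (r / (r - 1)) = N ^ ((q - r) * (r / (r - 1))) * ‖u x‖ ^ r := by
      intro x
      rw [hFn, Real.mul_rpow (by positivity) (by positivity), ← Real.rpow_mul hN0,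
        ← Real.rpow_mul (norm_nonneg _)]
      congr 2
      field_simp
    rw [Finset.sum_congr rfl fun x _ => e x, ← Finset.mul_sum, ← hNr,
      Real.mul_rpow (by positivity) (by positivity), ← Real.rpow_mul hN0, ← Real.rpow_mul hN0]
    have e1 : (q - r) * (r / (r - 1)) * ((r - 1) / r) = q - r := by field_simp
    have e2 : r * ((r - 1) / r) = r - 1 := by field_simp
    rw [e1, e2, hcombine (r - 1) hr1 (by linarith)]
    congr 1
    ring
  refine ⟨h1, h2, fun x => ?_⟩
  rw [← h2]
  have h3 := Finset.single_le_sum (f := fun x => ‖F x‖ ^ (r / (r - 1)))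
    (fun x _ => by positivity) (Finset.mem_univ x)
  have h4 : (‖F x‖ ^ (r / (r - 1))) ^ ((r - 1) / r) = ‖F x‖ := by
    rw [← Real.rpow_mul (norm_nonneg _)]
    have : r / (r - 1) * ((r - 1) / r) = 1 := by field_simp
    rw [this, Real.rpow_one]
  rw [← h4]
  exact Real.rpow_le_rpow (by positivity) h3 (by positivity)

open Classical in
/-- The functional norming `u` in `ℓ^∞`, scaled by the power `q - 1` of the norm: an average of
evaluations at the points where the maximum is attained. -/
theorem norming_iSup {ι : Type*} [Fintype ι] [Nonempty ι] {q N : ℝ} (hq : 2 < q) (u : ι → ℂ)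
    (hN : N = ⨆ x, ‖u x‖) (F : ι → ℂ)
    (hF : ∀ x, F x = if ‖u x‖ = N then
      ((N ^ (q - 2) / ∑ y, (if ‖u y‖ = N then 1 else 0) : ℝ) : ℂ) * u x else 0) :
    ∑ x, starRingEnd ℂ (u x) * F x = ((N ^ q : ℝ) : ℂ) ∧
      ∑ x, ‖F x‖ = N ^ (q - 1) ∧ ∀ x, ‖F x‖ ≤ N ^ (q - 1) := by
  set m : ℝ := ∑ y, (if ‖u y‖ = N then 1 else 0) with hm
  obtain ⟨x₀, hx₀⟩ := exists_eq_ciSup_of_finite (f := fun x => ‖u x‖)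
  have hx₀N : ‖u x₀‖ = N := by rw [hN]; exact hx₀
  have hN0 : 0 ≤ N := by rw [← hx₀N]; exact norm_nonneg _
  have hm0 : 0 < m := by
    have h1 := Finset.single_le_sum (f := fun y => if ‖u y‖ = N then (1 : ℝ) else 0)
      (fun y _ => by positivity) (Finset.mem_univ x₀)
    simp only [hx₀N, if_true] at h1
    linarith
  have hp1 : N ^ (q - 2) * N = N ^ (q - 1) := by
    nth_rewrite 2 [← Real.rpow_one N]
    rw [← Real.rpow_add_of_nonneg hN0 (by linarith) (by norm_num)]
    congr 1
    ring
  have hp2 : N ^ (q - 2) * N ^ 2 = N ^ q := by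
    rw [← Real.rpow_natCast, ← Real.rpow_add_of_nonneg hN0 (by linarith) (by norm_num)]
    congr 1
    push_cast
    ring
  have h2 : ∑ x, ‖F x‖ = N ^ (q - 1) := by
    have e : ∀ x, ‖F x‖ = N ^ (q - 1) / m * (if ‖u x‖ = N then 1 else 0) := by
      intro x
      rw [hF]
      split_ifs with h
      · rw [norm_mul, Complex.norm_real, Real.norm_eq_abs, abs_of_nonneg (by positivity), h, mul_one,
          ← hp1]
        ring
      · simp
    rw [Finset.sum_congr rfl fun x _ => e x, ← Finset.mul_sum, ← hm]
    field_simp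
  refine ⟨?_, h2, fun x => ?_⟩
  · have e : ∀ x, starRingEnd ℂ (u x) * F x =
        ((N ^ q / m * (if ‖u x‖ = N then 1 else 0) : ℝ) : ℂ) := by
      intro x
      rw [hF]
      split_ifs with h
      · rw [mul_left_comm, mul_comm (starRingEnd ℂ _), Complex.mul_conj, Complex.normSq_eq_norm_sq,
          ← Complex.ofReal_mul, h, ← hp2]
        congr 1
        ring
      · simp
    rw [Finset.sum_congr rfl fun x _ => e x, ← Complex.ofReal_sum, ← Finset.mul_sum, ← hm]
    congr 1
    field_simp
  · rw [← h2]
    exact Finset.single_le_sum (f := fun x => ‖F x‖) (fun x _ => norm_nonneg _) (Finset.mem_univ x)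

/-- Strichartz estimate with finite space exponent on a time interval not longer than the crossing
time `R / N`, for frequencies at most `R N`. -/
theorem exists_lintegral_flow_le {d : ℕ} {q r : ℝ} (hq : 2 < q) (hr : 2 < r)
    (hqr : 3 / q + d / r = d / 2) :
    ∃ C : ℝ, 0 < C ∧ ∀ (K R n : ℕ) (h N α β : ℝ) (a : (Fin d → ℕ) → ℂ), 0 < K → 0 < R →
      h = Real.pi / K → 1 ≤ N → n ≤ 2 * (K * R) - 1 → (n : ℝ) ≤ R * N → (β - α) * N ≤ R →
      ∫⁻ t in Set.Icc α β, ENNReal.ofReal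
        (((h ^ d * ∑ x, ‖flow d (K * R) h n a t x‖ ^ r) ^ (1 / r)) ^ q) ≤
        ENNReal.ofReal (C * N * (h ^ d * ∑ k ∈ modes d n, ‖a k‖ ^ 2) ^ (q / 2)) := by
  have hq0 : 0 < q := by linarith
  have hr0 : 0 < r := by linarith
  have hr2 : 0 < r - 2 := by linarith
  have hγ1 : 2 / q < 1 := by rw [div_lt_one hq0]; exact hq
  have h1γ : 0 < 1 - 2 / q := by linarith
  set A : ℝ := 2 * (2 / (1 - 2 / q) + 2) with hA
  have hA0 : 0 < A := by positivity
  set θ : ℝ := 1 - 2 / r with hθ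
  have hθ0 : 0 < θ := by
    have : 2 / r < 1 := by rw [div_lt_one hr0]; exact hr
    linarith
  -- interpolation turns the decay exponent `d / 3` of the kernel into the exponent `2 / q` of the
  -- fractional integration in time
  have hdθ : (d : ℝ) / 3 * θ = 2 / q := by
    rw [hθ]
    have : (d : ℝ) / r = d / 2 - 3 / q := by linarith
    have e : (d : ℝ) / 3 * (1 - 2 / r) = d / 3 - 2 / 3 * (d / r) := by ring
    rw [e, this]
    ring
  set c₀ : ℝ := (4 * r / (r - 2)) ^ (1 / r) * (2 * 192 ^ d) ^ θ with hc₀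
  have hc₀0 : 0 < c₀ := by positivity
  refine ⟨(A * c₀) ^ (q / 2), by positivity, ?_⟩
  intro K R n h N α β a hK hR hh hN hn hnN hαβ
  have hK' : (0 : ℝ) < K := by exact_mod_cast hK
  have hh0 : 0 < h := by rw [hh]; positivity
  have hN0 : 0 < N := by linarith
  set u := flow d (K * R) h n a with hu
  set n' : ℝ → ℝ := fun t => (∑ x, ‖u t x‖ ^ r) ^ (1 / r) with hn'
  have hn'0 : ∀ t, 0 ≤ n' t := fun t => by positivity
  have hn'c : Continuous n' := by
    refine Continuous.rpow_const ?_ fun _ => Or.inr (by positivity)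
    exact continuous_finsetSum _ fun x _ =>
      (continuous_flow d (K * R) h n a x).norm.rpow_const fun _ => Or.inr hr0.le
  set F : ℝ → Site d (K * R) → ℂ := fun t x =>
    ((n' t ^ (q - r) * ‖u t x‖ ^ (r - 2) : ℝ) : ℂ) * u t x with hF
  have hnorm := fun t => norming_rpow hq hr (u t) (N := n' t) rfl (F t) fun x => rfl
  have hFm : ∀ x, Measurable fun t => F t x := by
    intro x
    have h1 : Measurable fun t => u t x := (continuous_flow d (K * R) h n a x).measurable
    exact (Complex.measurable_ofReal.comp ((hn'c.measurable.pow_const _).mul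
      (h1.norm.pow_const _))).mul h1
  set B : ℝ := c₀ * (h ^ d) ^ θ * N ^ (2 / q) with hB
  have hB0 : 0 < B := by positivity
  have hker : ∀ t ∈ Set.Icc α β, ∀ s ∈ Set.Icc α β, t ≠ s →
      ‖∑ x, starRingEnd ℂ (F t x) * ∑ y, kernel d (K * R) h n (t - s) x y * F s y‖ ≤
        B * (n' t ^ (q - 1) * n' s ^ (q - 1) * |t - s| ^ (-(2 / q))) := by
    intro t ht s hs hts
    have hts0 : t - s ≠ 0 := sub_ne_zero.2 hts
    have hts1 : 0 < |t - s| := abs_pos.2 hts0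
    have hts2 : |t - s| * N ≤ R := by
      refine le_trans (mul_le_mul_of_nonneg_right ?_ hN0.le) hαβ
      rw [abs_le]
      constructor <;> linarith [ht.1, ht.2, hs.1, hs.2]
    have hmain := norm_sum_mul_le_of_bounds (kernel d (K * R) h n (t - s))
      (D := (192 * h * (N / |t - s|) ^ ((1 : ℝ) / 3)) ^ d) (by positivity) hr
      (fun x y => norm_kernel_le hK hR hh hN hn hnN hts0 hts2 x y)
      (sum_norm_kernel_sq_le hn h (t - s)) (fun x => starRingEnd ℂ (F t x)) (F s)
    simp only [RCLike.norm_conj] at hmain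
    rw [(hnorm t).2.1, (hnorm s).2.1] at hmain
    refine hmain.trans (le_of_eq ?_)
    have hD : (2 * (192 * h * (N / |t - s|) ^ ((1 : ℝ) / 3)) ^ d) ^ (1 - 2 / r) =
        (2 * 192 ^ d) ^ θ * (h ^ d) ^ θ * (N ^ (2 / q) * |t - s| ^ (-(2 / q))) := by
      rw [← hθ, mul_pow, mul_pow, ← mul_assoc, ← mul_assoc, Real.mul_rpow (by positivity)
        (by positivity), Real.mul_rpow (by positivity) (by positivity)]
      congr 1
      rw [← Real.rpow_natCast, ← Real.rpow_mul (by positivity), ← Real.rpow_mul (by positivity)]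
      have e : (1 : ℝ) / 3 * (d * θ) = 2 / q := by rw [← hdθ]; ring
      rw [e, Real.div_rpow hN0.le hts1.le, Real.rpow_neg hts1.le]
      rfl
    rw [hD, hB, hc₀]
    ring
  have hmain := lintegral_rpow_le_of_norming h a hq hB0 hn'c hn'0 hFm
    (fun t x => (hnorm t).2.2 x) (fun t => (hnorm t).1) hker
  have hS0 : 0 ≤ ∑ k ∈ modes d n, ‖a k‖ ^ 2 := Finset.sum_nonneg fun _ _ => by positivity
  have hscale : ∀ t, ((h ^ d * ∑ x, ‖u t x‖ ^ r) ^ (1 / r)) ^ q = (h ^ d) ^ (q / r) * n' t ^ q := by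
    intro t
    rw [Real.mul_rpow (by positivity) (Finset.sum_nonneg fun _ _ => by positivity),
      Real.mul_rpow (by positivity) (hn'0 t), ← Real.rpow_mul (by positivity)]
    congr 2
    ring
  simp only [hscale]
  have hsplit : ∀ t, ENNReal.ofReal ((h ^ d) ^ (q / r) * n' t ^ q) =
      ENNReal.ofReal ((h ^ d) ^ (q / r)) * ENNReal.ofReal (n' t ^ q) := fun t =>
    ENNReal.ofReal_mul (by positivity)
  simp only [hsplit]
  rw [MeasureTheory.lintegral_const_mul' _ _ ENNReal.ofReal_ne_top]
  refine (mul_le_mul_right hmain _).trans ?_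
  rw [← ENNReal.ofReal_mul (by positivity)]
  refine ENNReal.ofReal_le_ofReal (le_of_eq ?_)
  rw [← hA, hB, Real.mul_rpow (by positivity) hS0]
  have e1 : A * (c₀ * (h ^ d) ^ θ * N ^ (2 / q)) = (A * c₀) * ((h ^ d) ^ θ * N ^ (2 / q)) := by ring
  rw [e1, Real.mul_rpow (x := A * c₀) (by positivity) (by positivity),
    Real.mul_rpow (x := (h ^ d) ^ θ) (by positivity) (by positivity),
    ← Real.rpow_mul (by positivity), ← Real.rpow_mul (by positivity)]
  have e2 : 2 / q * (q / 2) = 1 := by field_simp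
  have e3 : (h ^ d) ^ (q / 2) = (h ^ d) ^ (q / r) * (h ^ d) ^ (θ * (q / 2)) := by
    rw [← Real.rpow_add (by positivity)]
    congr 1
    rw [hθ]
    field_simp
    ring
  rw [e2, Real.rpow_one, e3]
  ring

/-- Strichartz estimate with space exponent `∞` on a time interval not longer than the crossing
time `R / N`, for frequencies at most `R N`. -/
theorem exists_lintegral_flow_iSup_le {d : ℕ} {q : ℝ} (hq : 2 < q) (hqd : 3 / q = (d : ℝ) / 2) :
    ∃ C : ℝ, 0 < C ∧ ∀ (K R n : ℕ) (h N α β : ℝ) (a : (Fin d → ℕ) → ℂ), 0 < K → 0 < R →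
      h = Real.pi / K → 1 ≤ N → n ≤ 2 * (K * R) - 1 → (n : ℝ) ≤ R * N → (β - α) * N ≤ R →
      ∫⁻ t in Set.Icc α β, ENNReal.ofReal ((⨆ x, ‖flow d (K * R) h n a t x‖) ^ q) ≤
        ENNReal.ofReal (C * N * (h ^ d * ∑ k ∈ modes d n, ‖a k‖ ^ 2) ^ (q / 2)) := by
  classical
  have hq0 : 0 < q := by linarith
  have hγ1 : 2 / q < 1 := by rw [div_lt_one hq0]; exact hq
  have h1γ : 0 < 1 - 2 / q := by linarith
  set A : ℝ := 2 * (2 / (1 - 2 / q) + 2) with hA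
  have hA0 : 0 < A := by positivity
  have hdq : (d : ℝ) / 3 = 2 / q := by
    have : (d : ℝ) = 2 * (3 / q) := by linarith
    rw [this]; ring
  refine ⟨(A * 192 ^ d) ^ (q / 2), by positivity, ?_⟩
  intro K R n h N α β a hK hR hh hN hn hnN hαβ
  have hK' : (0 : ℝ) < K := by exact_mod_cast hK
  have hh0 : 0 < h := by rw [hh]; positivity
  have hN0 : 0 < N := by linarith
  have : Nonempty (Site d (K * R)) := ⟨⟨0, by
    rw [Finset.mem_Icc]; exact ⟨fun i => by simp; positivity, fun i => by simp; positivity⟩⟩⟩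
  set u := flow d (K * R) h n a with hu
  set n' : ℝ → ℝ := fun t => ⨆ x, ‖u t x‖ with hn'
  have hn'0 : ∀ t, 0 ≤ n' t := fun t => Real.iSup_nonneg fun x => norm_nonneg _
  have hn'c : Continuous n' := by
    have h1 : Continuous fun t => (WithLp.toLp ∞ (u t) : PiLp ∞ fun _ : Site d (K * R) => ℂ) :=
      (PiLp.continuous_toLp ∞ _).comp (continuous_pi fun x => continuous_flow d (K * R) h n a x)
    exact h1.norm
  set m : ℝ → ℝ := fun t => ∑ y, (if ‖u t y‖ = n' t then 1 else 0) with hm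
  set F : ℝ → Site d (K * R) → ℂ := fun t x => if ‖u t x‖ = n' t then
      ((n' t ^ (q - 2) / m t : ℝ) : ℂ) * u t x else 0 with hF
  have hnorm := fun t => norming_iSup hq (u t) (N := n' t) rfl (F t) fun x => rfl
  have hum : ∀ x, Measurable fun t => u t x := fun x =>
    (continuous_flow d (K * R) h n a x).measurable
  have hset : ∀ x, MeasurableSet {t | ‖u t x‖ = n' t} := fun x =>
    measurableSet_eq_fun (hum x).norm hn'c.measurable
  have hFm : ∀ x, Measurable fun t => F t x := by
    intro x
    have hmm : Measurable m := Finset.measurable_sum _ fun y _ =>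
      Measurable.ite (hset y) measurable_const measurable_const
    exact Measurable.ite (hset x) ((Complex.measurable_ofReal.comp
      ((hn'c.measurable.pow_const _).div hmm)).mul (hum x)) measurable_const
  set B : ℝ := 192 ^ d * h ^ d * N ^ (2 / q) with hB
  have hB0 : 0 < B := by positivity
  have hker : ∀ t ∈ Set.Icc α β, ∀ s ∈ Set.Icc α β, t ≠ s →
      ‖∑ x, starRingEnd ℂ (F t x) * ∑ y, kernel d (K * R) h n (t - s) x y * F s y‖ ≤
        B * (n' t ^ (q - 1) * n' s ^ (q - 1) * |t - s| ^ (-(2 / q))) := by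
    intro t ht s hs hts
    have hts0 : t - s ≠ 0 := sub_ne_zero.2 hts
    have hts1 : 0 < |t - s| := abs_pos.2 hts0
    have hts2 : |t - s| * N ≤ R := by
      refine le_trans (mul_le_mul_of_nonneg_right ?_ hN0.le) hαβ
      rw [abs_le]
      constructor <;> linarith [ht.1, ht.2, hs.1, hs.2]
    have hD : (192 * h * (N / |t - s|) ^ ((1 : ℝ) / 3)) ^ d = B * |t - s| ^ (-(2 / q)) := by
      rw [mul_pow, mul_pow, ← Real.rpow_natCast ((N / |t - s|) ^ ((1 : ℝ) / 3)),
        ← Real.rpow_mul (by positivity)]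
      have e : (1 : ℝ) / 3 * d = 2 / q := by rw [← hdq]; ring
      rw [e, Real.div_rpow hN0.le hts1.le, Real.rpow_neg hts1.le, hB]
      ring
    calc _ ≤ ∑ x, ‖F t x‖ * ∑ y, B * |t - s| ^ (-(2 / q)) * ‖F s y‖ := by
          refine (norm_sum_le _ _).trans (Finset.sum_le_sum fun x _ => ?_)
          rw [norm_mul, RCLike.norm_conj]
          refine mul_le_mul_of_nonneg_left ((norm_sum_le _ _).trans
            (Finset.sum_le_sum fun y _ => ?_)) (norm_nonneg _)
          rw [norm_mul, ← hD]
          exact mul_le_mul_of_nonneg_right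
            (norm_kernel_le hK hR hh hN hn hnN hts0 hts2 x y) (norm_nonneg _)
      _ = _ := by
          rw [← Finset.mul_sum, ← Finset.sum_mul, (hnorm t).2.1, (hnorm s).2.1]
          ring
  have hmain := lintegral_rpow_le_of_norming h a hq hB0 hn'c hn'0 hFm
    (fun t x => (hnorm t).2.2 x) (fun t => (hnorm t).1) hker
  have hS0 : 0 ≤ ∑ k ∈ modes d n, ‖a k‖ ^ 2 := Finset.sum_nonneg fun _ _ => by positivity
  refine hmain.trans (ENNReal.ofReal_le_ofReal (le_of_eq ?_))
  rw [← hA, hB, Real.mul_rpow (by positivity) hS0]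
  have e1 : A * (192 ^ d * h ^ d * N ^ (2 / q)) = (A * 192 ^ d) * (h ^ d * N ^ (2 / q)) := by ring
  rw [e1, Real.mul_rpow (x := A * 192 ^ d) (by positivity) (by positivity),
    Real.mul_rpow (x := h ^ d) (by positivity) (by positivity), ← Real.rpow_mul hN0.le]
  have e2 : 2 / q * (q / 2) = 1 := by field_simp
  rw [e2, Real.rpow_one]
  ring

/-! ### Norms of the flow -/

theorem lpNorm_nonneg {d M : ℕ} {h : ℝ} (hh : 0 ≤ h) (p : ℝ≥0∞) (f : DirichletFun d M) :
    0 ≤ lpNorm h p f := by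
  unfold lpNorm
  split_ifs
  · exact Real.iSup_nonneg fun x => norm_nonneg _
  · exact Real.rpow_nonneg (mul_nonneg (by positivity)
      (Finset.sum_nonneg fun _ _ => by positivity)) _

theorem lpNorm_two_sq {d M : ℕ} {h : ℝ} (hh : 0 ≤ h) (f : DirichletFun d M) :
    lpNorm h 2 f ^ 2 = h ^ d * ∑ x, ‖f.val x‖ ^ 2 := by
  have h1 : 0 ≤ h ^ d * ∑ x, ‖f.val x‖ ^ 2 :=
    mul_nonneg (by positivity) (Finset.sum_nonneg fun _ _ => by positivity)
  rw [lpNorm, if_neg ENNReal.ofNat_ne_top, ENNReal.toReal_ofNat]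
  simp only [Real.rpow_ofNat]
  rw [← Real.sqrt_eq_rpow, Real.sq_sqrt h1]

theorem lpNorm_add_le {d M : ℕ} {h : ℝ} (hh : 0 ≤ h) {p : ℝ≥0∞} (hp : 1 ≤ p)
    (f g : DirichletFun d M) : lpNorm h p (f + g) ≤ lpNorm h p f + lpNorm h p g := by
  unfold lpNorm
  split_ifs with hp'
  · refine Real.iSup_le (fun x => ?_) (add_nonneg (Real.iSup_nonneg fun x => norm_nonneg _)
      (Real.iSup_nonneg fun x => norm_nonneg _))
    rw [val_add]
    exact (norm_add_le _ _).trans (add_le_add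
      (le_ciSup (f := fun x => ‖f.val x‖) (Set.finite_range _).bddAbove x)
      (le_ciSup (f := fun x => ‖g.val x‖) (Set.finite_range _).bddAbove x))
  · have hp1 : 1 ≤ p.toReal := by
      rw [← ENNReal.toReal_one]
      exact ENNReal.toReal_mono hp' hp
    have h0 : 0 ≤ 1 / p.toReal := by positivity
    have hs : ∀ f : DirichletFun d M, 0 ≤ ∑ x, ‖f.val x‖ ^ p.toReal := fun f =>
      Finset.sum_nonneg fun _ _ => by positivity
    rw [Real.mul_rpow (by positivity) (hs _), Real.mul_rpow (by positivity) (hs _),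
      Real.mul_rpow (by positivity) (hs _), ← mul_add]
    refine mul_le_mul_of_nonneg_left ?_ (by positivity)
    have h1 := Real.Lp_add_le Finset.univ (fun x => ‖f.val x‖) (fun x => ‖g.val x‖) hp1
    simp only [abs_norm] at h1
    refine le_trans (Real.rpow_le_rpow (hs _) (Finset.sum_le_sum fun x _ => ?_) h0) h1
    rw [val_add]
    exact Real.rpow_le_rpow (norm_nonneg _) ((norm_add_le _ _).trans (le_abs_self _)) (by linarith)

theorem lpNorm_zero {d M : ℕ} (h : ℝ) {p : ℝ≥0∞} (hp : 1 ≤ p) :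
    lpNorm h p (0 : DirichletFun d M) = 0 := by
  have h0 : ∀ x, (0 : DirichletFun d M).val x = 0 := fun x => rfl
  unfold lpNorm
  split_ifs with hp'
  · simp [h0]
  · have hp1 : 0 < p.toReal := ENNReal.toReal_pos (by rintro rfl; simp at hp) hp'
    simp [h0, Real.zero_rpow hp1.ne', hp1.ne']

theorem lpNorm_sum_le {d M : ℕ} {h : ℝ} (hh : 0 ≤ h) {p : ℝ≥0∞} (hp : 1 ≤ p) {ι : Type*}
    (s : Finset ι) (f : ι → DirichletFun d M) :
    lpNorm h p (∑ i ∈ s, f i) ≤ ∑ i ∈ s, lpNorm h p (f i) :=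
  Finset.le_sum_of_subadditive (lpNorm h p) (lpNorm_zero h hp).le (lpNorm_add_le hh hp) s f

theorem continuous_lpNorm {d M : ℕ} (h : ℝ) (p : ℝ≥0∞) {w : ℝ → DirichletFun d M}
    (hw : ∀ x, Continuous fun t => (w t).val x) : Continuous fun t => lpNorm h p (w t) := by
  unfold lpNorm
  split_ifs with hp'
  · have h1 : Continuous fun t =>
        (WithLp.toLp ∞ (fun x => (w t).val x) : PiLp ∞ fun _ : Site d M => ℂ) :=
      (PiLp.continuous_toLp ∞ _).comp (continuous_pi hw)
    exact h1.norm
  · refine Continuous.rpow_const (continuous_const.mul (continuous_finsetSum _ fun x _ =>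
      (hw x).norm.rpow_const fun _ => Or.inr ENNReal.toReal_nonneg)) fun _ => Or.inr (by positivity)

theorem continuous_propagator_val {d M : ℕ} (h : ℝ) (w : DirichletFun d M) (x : Site d M) :
    Continuous fun t => (propagator d M h t w).val x := by
  simp only [propagator_val]
  fun_prop

/-- The flow is a contraction of `L²(Ω)`. -/
theorem lpNorm_propagator_le {d M : ℕ} {h : ℝ} (hh : 0 ≤ h) (t : ℝ) (w : DirichletFun d M) :
    lpNorm h 2 (propagator d M h t w) ≤ lpNorm h 2 w := by
  have h1 : ∀ x, (propagator d M h t w).val x =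
      ∑ y, kernel d M h (2 * M - 1) t x y * w.val y := by
    intro x
    rw [propagator_val]
    simp only [inner_mode, kernel, Finset.sum_mul]
    rw [Finset.sum_comm]
    refine Finset.sum_congr rfl fun y _ => Finset.sum_congr rfl fun k _ => ?_
    ring
  refine le_of_sq_le_sq ?_ (lpNorm_nonneg hh 2 w)
  rw [lpNorm_two_sq hh, lpNorm_two_sq hh]
  refine mul_le_mul_of_nonneg_left ?_ (by positivity)
  simp only [h1]
  exact sum_norm_kernel_sq_le le_rfl h t _

theorem lpNorm_le_lpNorm_besselPotential {d M : ℕ} {h s : ℝ} (hh : 0 ≤ h) (hs : 0 ≤ s)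
    (w : DirichletFun d M) : lpNorm h 2 w ≤ lpNorm h 2 (besselPotential d M h s w) := by
  refine le_of_sq_le_sq ?_ (lpNorm_nonneg hh 2 _)
  rw [lpNorm_two_sq hh, lpNorm_two_sq hh, sum_norm_besselPotential_sq, ← sum_norm_inner_mode_sq]
  refine mul_le_mul_of_nonneg_left (Finset.sum_le_sum fun k _ => ?_) (by positivity)
  have h1 : 1 ≤ (1 + energy M h k) ^ s :=
    Real.one_le_rpow (by linarith [energy_nonneg M h k]) hs
  nlinarith [sq_nonneg ‖(inner ℂ (mode d M k) w : ℂ)‖]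

/-! ### Dyadic decomposition -/

/-- The frequencies with all coordinates at most `2 ^ j R`. -/
def lowModes (d K R j : ℕ) : Finset (Fin d → ℕ) := modes d (min (R * 2 ^ j) (2 * (K * R) - 1))

/-- The dyadic frequency blocks: all coordinates are at most `2 ^ j R` and, if `j ≠ 0`, one of them
exceeds `2 ^ (j - 1) R`. -/
def block (d K R : ℕ) : ℕ → Finset (Fin d → ℕ)
  | 0 => lowModes d K R 0
  | j + 1 => lowModes d K R (j + 1) \ lowModes d K R j

theorem lowModes_mono (d K R : ℕ) {i j : ℕ} (hij : i ≤ j) : lowModes d K R i ⊆ lowModes d K R j :=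
  modes_mono (min_le_min_right _ (Nat.mul_le_mul_left _ (Nat.pow_le_pow_right (by norm_num) hij)))

theorem block_subset (d K R j : ℕ) : block d K R j ⊆ lowModes d K R j := by
  cases j with
  | zero => exact subset_rfl
  | succ j => exact Finset.sdiff_subset

theorem sum_block {E : Type*} [AddCommGroup E] (d K R J : ℕ) (f : (Fin d → ℕ) → E) :
    ∑ j ∈ Finset.range (J + 1), ∑ k ∈ block d K R j, f k = ∑ k ∈ lowModes d K R J, f k := by
  induction J with
  | zero => simp [block]
  | succ J ih =>
    rw [Finset.sum_range_succ, ih, block, add_comm,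
      Finset.sum_sdiff (lowModes_mono d K R (Nat.le_succ J))]

/-- On the block `j` the operator `(1 - Δ_Ω)^{1/2}` is at least a multiple of `2 ^ j`. -/
theorem rpow_le_of_mem_block {d K R j : ℕ} (hK : 0 < K) (hR : 0 < R) {h s : ℝ}
    (hh : h = Real.pi / K) (hs : 0 ≤ s) {k : Fin d → ℕ} (hk : k ∈ block d K R j) :
    1 ≤ (2 * Real.pi / 2 ^ j) ^ (2 * s) * (1 + energy (K * R) h k) ^ s := by
  have hπ := Real.pi_gt_three
  have hR' : (0 : ℝ) < R := by exact_mod_cast hR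
  have he := energy_nonneg (K * R) h k
  have key : 1 ≤ (2 * Real.pi / 2 ^ j) ^ 2 * (1 + energy (K * R) h k) := by
    cases j with
    | zero =>
      rw [pow_zero, div_one]
      nlinarith
    | succ j =>
      rw [block, Finset.mem_sdiff] at hk
      have h1 : k ∈ modes d (2 * (K * R) - 1) := modes_mono (min_le_right _ _) hk.1
      have h2 := mem_modes.1 h1
      have h3 : ∃ i, R * 2 ^ j < k i := by
        by_contra hcon
        push Not at hcon
        exact hk.2 (mem_modes.2 fun i => ⟨(h2 i).1, le_min (hcon i) (h2 i).2⟩)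
      obtain ⟨i, hi⟩ := h3
      have h4 := sq_le_energy hK hR hh h1 i
      have h5 : (2 : ℝ) ^ j / Real.pi ≤ k i / (Real.pi * R) := by
        have : (R : ℝ) * 2 ^ j ≤ k i := by exact_mod_cast hi.le
        rw [div_le_div_iff₀ (by positivity) (by positivity)]
        nlinarith
      have h6 : ((2 : ℝ) ^ j / Real.pi) ^ 2 ≤ 1 + energy (K * R) h k := by
        have : ((2 : ℝ) ^ j / Real.pi) ^ 2 ≤ (k i / (Real.pi * R)) ^ 2 := by gcongr
        linarith
      have h7 := mul_le_mul_of_nonneg_left h6 (sq_nonneg (2 * Real.pi / 2 ^ (j + 1)))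
      refine le_trans (le_of_eq ?_) h7
      rw [pow_succ]
      field_simp
      ring
  rw [Real.rpow_mul (by positivity), ← Real.mul_rpow (by positivity) (by linarith),
    Real.rpow_ofNat]
  exact Real.one_le_rpow key hs

/-- The part of `w` with frequencies in the dyadic block `j`. -/
def blockPart {d K R : ℕ} (w : DirichletFun d (K * R)) (j : ℕ) : DirichletFun d (K * R) :=
  ∑ k ∈ block d K R j, (inner ℂ (mode d (K * R) k) w : ℂ) • mode d (K * R) k

theorem sum_blockPart {d K R J : ℕ} (hJ : 2 * K ≤ 2 ^ J) (w : DirichletFun d (K * R)) :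
    ∑ j ∈ Finset.range (J + 1), blockPart w j = w := by
  unfold blockPart
  rw [sum_block, lowModes, min_eq_right, sum_inner_mode_smul]
  have : 2 * K * R ≤ 2 ^ J * R := Nat.mul_le_mul_right _ hJ
  rw [mul_comm R]
  rw [mul_assoc] at this
  omega

theorem propagator_blockPart_val {d K R : ℕ} (h t : ℝ) (w : DirichletFun d (K * R)) (j : ℕ)
    (x : Site d (K * R)) : (propagator d (K * R) h t (blockPart w j)).val x =
      flow d (K * R) h (min (R * 2 ^ j) (2 * (K * R) - 1)) (fun k => if k ∈ block d K R j then
        (inner ℂ (mode d (K * R) k) w : ℂ) else 0) t x := by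
  rw [blockPart, map_sum, val_sum, flow]
  have h1 := Finset.sum_filter_of_ne (s := lowModes d K R j) (p := fun k => k ∈ block d K R j)
    (f := fun k => (if k ∈ block d K R j then (inner ℂ (mode d (K * R) k) w : ℂ) else 0) *
      (Complex.exp (((-t * energy (K * R) h k : ℝ) : ℂ) * Complex.I) * (mode d (K * R) k).val x))
    (fun k _ hk => by
      by_contra hcon
      simp [hcon] at hk)
  have h2 : (lowModes d K R j).filter (fun k => k ∈ block d K R j) = block d K R j := by
    ext k
    rw [Finset.mem_filter]
    exact ⟨fun hk => hk.2, fun hk => ⟨block_subset d K R j hk, hk⟩⟩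
  refine Eq.trans ?_ h1
  rw [h2]
  refine Finset.sum_congr rfl fun k hk => ?_
  rw [map_smul, propagator_mode, val_smul, val_smul, if_pos hk]

theorem sum_blockPart_coeff_le {d K R : ℕ} (hK : 0 < K) (hR : 0 < R) {h s : ℝ}
    (hh : h = Real.pi / K) (hs : 0 ≤ s) (w : DirichletFun d (K * R)) (j : ℕ) :
    h ^ d * ∑ k ∈ modes d (min (R * 2 ^ j) (2 * (K * R) - 1)), ‖(if k ∈ block d K R j then
        (inner ℂ (mode d (K * R) k) w : ℂ) else 0)‖ ^ 2 ≤
      ((2 * Real.pi / 2 ^ j) ^ s * lpNorm h 2 (besselPotential d (K * R) h s w)) ^ 2 := by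
  have hh0 : 0 ≤ h := by rw [hh]; positivity
  rw [mul_pow, lpNorm_two_sq hh0, sum_norm_besselPotential_sq, mul_left_comm (_ ^ 2)]
  refine mul_le_mul_of_nonneg_left ?_ (pow_nonneg hh0 d)
  have e : ((2 * Real.pi / 2 ^ j) ^ s) ^ 2 = (2 * Real.pi / 2 ^ j) ^ (2 * s) := by
    rw [← Real.rpow_natCast, ← Real.rpow_mul (by positivity)]
    congr 1
    push_cast
    ring
  rw [e, Finset.mul_sum]
  refine le_trans (Finset.sum_le_sum fun k hk => ?_) (Finset.sum_le_sum_of_subset_of_nonneg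
    (modes_mono (min_le_right _ _)) fun k _ _ => ?_)
  · split_ifs with hb
    · have := rpow_le_of_mem_block hK hR hh hs hb
      rw [← mul_assoc]
      exact le_mul_of_one_le_left (sq_nonneg _) this
    · rw [norm_zero, zero_pow two_ne_zero]
      have := energy_nonneg (K * R) h k
      positivity
  · have := energy_nonneg (K * R) h k
    positivity

/-! ### Summation of the dyadic blocks -/

theorem sum_two_pow_rpow_neg_le {e : ℝ} (he : 0 < e) (n : ℕ) :
    ∑ j ∈ Finset.range n, ((2 : ℝ) ^ j) ^ (-e) ≤ 1 / (1 - 2 ^ (-e)) := by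
  have h1 : (2 : ℝ) ^ (-e) < 1 := Real.rpow_lt_one_of_one_lt_of_neg (by norm_num) (by linarith)
  have h0 : (0 : ℝ) < 2 ^ (-e) := by positivity
  have h2 : ∀ j : ℕ, ((2 : ℝ) ^ j) ^ (-e) = (2 ^ (-e)) ^ j := by
    intro j
    rw [← Real.rpow_natCast, ← Real.rpow_natCast, ← Real.rpow_mul (by norm_num),
      ← Real.rpow_mul (by norm_num), mul_comm]
  simp only [h2]
  rw [geom_sum_eq h1.ne, ← neg_div_neg_eq]
  have h3 : 0 < 1 - (2 : ℝ) ^ (-e) := by linarith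
  rw [neg_sub, neg_sub]
  gcongr
  have : 0 ≤ ((2 : ℝ) ^ (-e)) ^ n := by positivity
  linarith

theorem sum_two_pow_rpow_le {e : ℝ} (he : 0 < e) (J : ℕ) :
    ∑ j ∈ Finset.range (J + 1), ((2 : ℝ) ^ j) ^ e ≤ (2 ^ J) ^ e * (1 / (1 - 2 ^ (-e))) := by
  rw [← Finset.sum_range_reflect]
  refine le_trans (le_of_eq ?_)
    (mul_le_mul_of_nonneg_left (sum_two_pow_rpow_neg_le he (J + 1)) (by positivity))
  rw [Finset.mul_sum]
  refine Finset.sum_congr rfl fun j hj => ?_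
  rw [Finset.mem_range] at hj
  rw [Real.rpow_neg (by positivity), ← div_eq_mul_inv,
    ← Real.div_rpow (by positivity) (by positivity)]
  congr 1
  rw [eq_div_iff (by positivity), ← pow_add]
  congr 1
  omega

/-- The dyadic sum of the losses. The factor `2 ^ (j / q)` is the loss in the dispersive estimate,
and `(1 + 2 ^ j / R) ^ (1 / q)` comes from the number of crossing times in `[0, 1]`. -/
theorem exists_sum_loss_le {α c₁ q s : ℝ} (hα : 0 ≤ α) (hc₁ : 0 < c₁) (hq : 1 ≤ q)
    (hs₁ : 1 ≤ α → 1 / q < s) (hs₂ : 0 < α → α < 1 → s = (2 - α) / q) (hs₃ : α = 0 → 2 / q < s) :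
    ∃ C : ℝ, 0 < C ∧ ∀ (h : ℝ) (R J : ℕ), 0 < h → h ≤ 1 → 0 < R → c₁ * h ^ (-α) ≤ (R : ℝ) →
      (2 : ℝ) ^ J ≤ 4 * Real.pi / h →
      ∑ j ∈ Finset.range (J + 1),
        (2 ^ j) ^ (1 / q) * (1 + 2 ^ j / (R : ℝ)) ^ (1 / q) * (2 ^ j) ^ (-s) ≤ C := by
  have hπ := Real.pi_pos
  have hq0 : 0 < q := by linarith
  have hqi : 0 < 1 / q := by positivity
  have hG : ∀ e : ℝ, 0 < e → 0 < 1 / (1 - (2 : ℝ) ^ (-e)) := fun e he => by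
    have h1 : (2 : ℝ) ^ (-e) < 1 := Real.rpow_lt_one_of_one_lt_of_neg (by norm_num) (by linarith)
    exact one_div_pos.2 (by linarith)
  have hterm : ∀ (R : ℕ), 0 < R → ∀ j : ℕ,
      ((2 : ℝ) ^ j) ^ (1 / q) * (1 + 2 ^ j / (R : ℝ)) ^ (1 / q) * (2 ^ j) ^ (-s) ≤
        (2 ^ j) ^ (-(s - 1 / q)) + ((2 : ℝ) ^ j / R) ^ (1 / q) * (2 ^ j) ^ (-(s - 1 / q)) := by
    intro R hR j
    have hR' : (0 : ℝ) < R := by exact_mod_cast hR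
    have h1 : (1 + (2 : ℝ) ^ j / R) ^ (1 / q) ≤ 1 + ((2 : ℝ) ^ j / R) ^ (1 / q) := by
      have := Real.rpow_add_le_add_rpow (zero_le_one) (show 0 ≤ (2 : ℝ) ^ j / R by positivity)
        hqi.le (by rw [div_le_one hq0]; exact hq)
      rwa [Real.one_rpow] at this
    have h2 : ((2 : ℝ) ^ j) ^ (-(s - 1 / q)) = (2 ^ j) ^ (1 / q) * (2 ^ j) ^ (-s) := by
      rw [← Real.rpow_add (by positivity)]; congr 1; ring
    rw [h2]
    calc _ = (1 + (2 : ℝ) ^ j / R) ^ (1 / q) * ((2 ^ j) ^ (1 / q) * (2 ^ j) ^ (-s)) := by ring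
      _ ≤ (1 + ((2 : ℝ) ^ j / R) ^ (1 / q)) * ((2 ^ j) ^ (1 / q) * (2 ^ j) ^ (-s)) := by gcongr
      _ = _ := by ring
  rcases le_or_gt 1 α with h1α | hα1
  · have he : 0 < s - 1 / q := by linarith [hs₁ h1α]
    refine ⟨(1 + (4 * Real.pi / c₁) ^ (1 / q)) * (1 / (1 - 2 ^ (-(s - 1 / q)))),
      mul_pos (by positivity) (hG _ he), ?_⟩
    intro h R J hh0 hh1 hR hcR hJ
    have hR' : (0 : ℝ) < R := by exact_mod_cast hR
    refine le_trans (Finset.sum_le_sum fun j hj => ?_)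
      (le_trans (le_of_eq (Finset.mul_sum _ _ _).symm)
      (mul_le_mul_of_nonneg_left (sum_two_pow_rpow_neg_le he (J + 1)) (by positivity)))
    refine (hterm R hR j).trans ?_
    have h2 : (2 : ℝ) ^ j / R ≤ 4 * Real.pi / c₁ := by
      have h3 : (2 : ℝ) ^ j ≤ 2 ^ J :=
        pow_le_pow_right₀ (by norm_num) (by rw [Finset.mem_range] at hj; omega)
      have h4 : h⁻¹ ≤ h ^ (-α) := by
        rw [← Real.rpow_neg_one]
        exact Real.rpow_le_rpow_of_exponent_ge hh0 hh1 (by linarith)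
      have h5 : c₁ * h⁻¹ ≤ R := le_trans (by gcongr) hcR
      rw [div_le_div_iff₀ hR' hc₁]
      calc (2 : ℝ) ^ j * c₁ ≤ 4 * Real.pi / h * c₁ := by gcongr; exact h3.trans hJ
        _ = 4 * Real.pi * (c₁ * h⁻¹) := by field_simp
        _ ≤ 4 * Real.pi * R := by gcongr
    have h6 : ((2 : ℝ) ^ j / R) ^ (1 / q) ≤ (4 * Real.pi / c₁) ^ (1 / q) := by gcongr
    have h7 : 0 ≤ ((2 : ℝ) ^ j) ^ (-(s - 1 / q)) := by positivity
    nlinarith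
  have hs0 : 0 < s - 1 / q := by
    rcases hα.eq_or_lt with h | h
    · have := hs₃ h.symm
      have e : 2 / q = 1 / q + 1 / q := by ring
      linarith
    · rw [hs₂ h hα1]
      have e : (2 - α) / q - 1 / q = (1 - α) / q := by ring
      rw [e]
      exact div_pos (by linarith) hq0
  rcases hα.eq_or_lt with hα0 | hα0
  · have he : 0 < s - 2 / q := by linarith [hs₃ hα0.symm]
    refine ⟨1 / (1 - 2 ^ (-(s - 1 / q))) + 1 / (1 - 2 ^ (-(s - 2 / q))),
      add_pos (hG _ hs0) (hG _ he), ?_⟩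
    intro h R J hh0 hh1 hR hcR hJ
    have hR1 : (1 : ℝ) ≤ R := by exact_mod_cast hR
    refine le_trans (Finset.sum_le_sum fun j _ => hterm R hR j) ?_
    rw [Finset.sum_add_distrib]
    refine add_le_add (sum_two_pow_rpow_neg_le hs0 (J + 1))
      (le_trans (Finset.sum_le_sum fun j _ => ?_) (sum_two_pow_rpow_neg_le he (J + 1)))
    calc ((2 : ℝ) ^ j / R) ^ (1 / q) * (2 ^ j) ^ (-(s - 1 / q))
        ≤ ((2 : ℝ) ^ j) ^ (1 / q) * (2 ^ j) ^ (-(s - 1 / q)) := by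
          gcongr
          exact div_le_self (by positivity) hR1
      _ = ((2 : ℝ) ^ j) ^ (-(s - 2 / q)) := by
          rw [← Real.rpow_add (by positivity)]; congr 1; ring
  · have he : 0 < α / q := by positivity
    refine ⟨1 / (1 - 2 ^ (-(s - 1 / q))) +
      ((4 * Real.pi) ^ (α / q) * c₁ ^ (-(1 / q))) * (1 / (1 - 2 ^ (-(α / q)))),
      add_pos (hG _ hs0) (mul_pos (by positivity) (hG _ he)), ?_⟩
    intro h R J hh0 hh1 hR hcR hJ
    have hR' : (0 : ℝ) < R := by exact_mod_cast hR
    refine le_trans (Finset.sum_le_sum fun j _ => hterm R hR j) ?_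
    rw [Finset.sum_add_distrib]
    refine add_le_add (sum_two_pow_rpow_neg_le hs0 (J + 1)) ?_
    -- this sum is dominated by its last terms, where `2 ^ j` is comparable to `1 / h`
    have e1 : ∀ j : ℕ, ((2 : ℝ) ^ j / R) ^ (1 / q) * (2 ^ j) ^ (-(s - 1 / q)) =
        (R : ℝ) ^ (-(1 / q)) * (2 ^ j) ^ (α / q) := by
      intro j
      rw [Real.div_rpow (by positivity) hR'.le, Real.rpow_neg hR'.le, div_eq_mul_inv,
        mul_comm (((2 : ℝ) ^ j) ^ (1 / q)), mul_assoc, ← Real.rpow_add (by positivity),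
        hs₂ hα0 hα1]
      congr 2
      ring
    rw [Finset.sum_congr rfl fun j _ => e1 j, ← Finset.mul_sum]
    have h2 : (R : ℝ) ^ (-(1 / q)) ≤ c₁ ^ (-(1 / q)) * h ^ (α / q) := by
      calc (R : ℝ) ^ (-(1 / q)) ≤ (c₁ * h ^ (-α)) ^ (-(1 / q)) :=
            Real.rpow_le_rpow_of_nonpos (by positivity) hcR (by linarith)
        _ = c₁ ^ (-(1 / q)) * h ^ (α / q) := by
            rw [Real.mul_rpow hc₁.le (by positivity), ← Real.rpow_mul hh0.le]
            congr 2
            ring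
    have h3 : ((2 : ℝ) ^ J) ^ (α / q) ≤ (4 * Real.pi) ^ (α / q) * h ^ (-(α / q)) := by
      calc ((2 : ℝ) ^ J) ^ (α / q) ≤ (4 * Real.pi / h) ^ (α / q) := by gcongr
        _ = _ := by
            rw [Real.div_rpow (by positivity) hh0.le, Real.rpow_neg hh0.le]
            rfl
    have h4 : h ^ (α / q) * h ^ (-(α / q)) = 1 := by
      rw [← Real.rpow_add hh0]; simp
    have hg := hG _ he
    calc (R : ℝ) ^ (-(1 / q)) * ∑ j ∈ Finset.range (J + 1), ((2 : ℝ) ^ j) ^ (α / q)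
        ≤ (c₁ ^ (-(1 / q)) * h ^ (α / q)) *
          (((4 * Real.pi) ^ (α / q) * h ^ (-(α / q))) * (1 / (1 - 2 ^ (-(α / q))))) := by
          refine mul_le_mul h2 ((sum_two_pow_rpow_le he J).trans
            (mul_le_mul_of_nonneg_right h3 hg.le))
            (Finset.sum_nonneg fun _ _ => by positivity) (by positivity)
      _ = (h ^ (α / q) * h ^ (-(α / q))) * (((4 * Real.pi) ^ (α / q) * c₁ ^ (-(1 / q))) *
          (1 / (1 - 2 ^ (-(α / q))))) := by ring
      _ = _ := by rw [h4, one_mul]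

/-! ### The estimate on the unit time interval -/

theorem lintegral_Icc_le_nsmul {f : ℝ → ℝ≥0∞} {τ : ℝ} {b : ℝ≥0∞}
    (hf : ∀ i : ℕ, ∫⁻ t in Set.Icc (i * τ) ((i + 1) * τ), f t ≤ b) (m : ℕ) :
    ∫⁻ t in Set.Icc 0 (m * τ), f t ≤ m * b := by
  induction m with
  | zero => simp
  | succ m ih =>
    have hsub : Set.Icc 0 (((m + 1 : ℕ) : ℝ) * τ) ⊆
        Set.Icc 0 (m * τ) ∪ Set.Icc (m * τ) ((m + 1) * τ) := by
      intro t ht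
      push_cast at ht
      rcases le_total t (m * τ) with h | h
      · exact Or.inl ⟨ht.1, h⟩
      · exact Or.inr ⟨h, ht.2⟩
    refine (MeasureTheory.lintegral_mono_set hsub).trans
      ((MeasureTheory.lintegral_union_le _ _ _).trans ((add_le_add ih (hf m)).trans (le_of_eq ?_)))
    push_cast
    ring

/-- The frequency-localized estimate: on each interval of length `R / 2 ^ j` the estimate loses
`2 ^ (j / q)`, and `[0, 1]` is covered by at most `1 + 2 ^ j / R` of them. -/
theorem exists_strichartzNorm_blockPart_le {d : ℕ} {q r : ℝ≥0∞} (hq : 2 < q.toReal)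
    (hr : (r = ∞ ∧ 3 / q.toReal = (d : ℝ) / 2) ∨
      (r ≠ ∞ ∧ 2 < r.toReal ∧ 3 / q.toReal + d / r.toReal = (d : ℝ) / 2)) {s : ℝ} (hs : 0 ≤ s) :
    ∃ C : ℝ, 0 < C ∧ ∀ (h : ℝ) (K R j : ℕ), 0 < K → 0 < R → h = Real.pi / K →
      ∀ w : DirichletFun d (K * R),
        strichartzNorm h q r (fun t => propagator d (K * R) h t (blockPart w j)) ≤
          ENNReal.ofReal (C * lpNorm h 2 (besselPotential d (K * R) h s w) *
            ((2 ^ j) ^ (1 / q.toReal) * (1 + 2 ^ j / (R : ℝ)) ^ (1 / q.toReal) *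
              (2 ^ j) ^ (-s))) := by
  have hq0 : 0 < q.toReal := by linarith
  have hqne : q ≠ 0 := by rintro rfl; simp at hq0
  have hqtop : q ≠ ∞ := by rintro rfl; simp at hq0
  obtain ⟨C, hC, hmain⟩ : ∃ C : ℝ, 0 < C ∧ ∀ (K R j : ℕ) (h α β : ℝ), 0 < K → 0 < R →
      h = Real.pi / K → (β - α) * 2 ^ j ≤ R → ∀ w : DirichletFun d (K * R),
      ∫⁻ t in Set.Icc α β, ENNReal.ofReal
        (lpNorm h r (propagator d (K * R) h t (blockPart w j)) ^ q.toReal) ≤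
        ENNReal.ofReal (C * 2 ^ j * (h ^ d *
          ∑ k ∈ modes d (min (R * 2 ^ j) (2 * (K * R) - 1)), ‖(if k ∈ block d K R j then
          (inner ℂ (mode d (K * R) k) w : ℂ) else 0)‖ ^ 2) ^ (q.toReal / 2)) := by
    rcases hr with ⟨rfl, hqr⟩ | ⟨hrtop, hr2, hqr⟩
    · obtain ⟨C, hC, h1⟩ := exists_lintegral_flow_iSup_le hq hqr
      refine ⟨C, hC, fun K R j h α β hK hR hh hαβ w => ?_⟩
      have h2 := h1 K R (min (R * 2 ^ j) (2 * (K * R) - 1)) h (2 ^ j) α β (fun k =>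
        if k ∈ block d K R j then (inner ℂ (mode d (K * R) k) w : ℂ) else 0) hK hR hh
        (one_le_pow₀ (by norm_num)) (min_le_right _ _)
        ((Nat.cast_le.2 (min_le_left _ _)).trans (by push_cast; rfl)) hαβ
      refine le_trans (le_of_eq ?_) h2
      simp only [lpNorm, if_true, propagator_blockPart_val]
    · obtain ⟨C, hC, h1⟩ := exists_lintegral_flow_le hq hr2 hqr
      refine ⟨C, hC, fun K R j h α β hK hR hh hαβ w => ?_⟩
      have h2 := h1 K R (min (R * 2 ^ j) (2 * (K * R) - 1)) h (2 ^ j) α β (fun k =>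
        if k ∈ block d K R j then (inner ℂ (mode d (K * R) k) w : ℂ) else 0) hK hR hh
        (one_le_pow₀ (by norm_num)) (min_le_right _ _)
        ((Nat.cast_le.2 (min_le_left _ _)).trans (by push_cast; rfl)) hαβ
      refine le_trans (le_of_eq ?_) h2
      simp only [lpNorm, if_neg hrtop, propagator_blockPart_val]
  refine ⟨C ^ (1 / q.toReal) * (2 * Real.pi) ^ s, by positivity, ?_⟩
  intro h K R j hK hR hh w
  have hR' : (0 : ℝ) < R := by exact_mod_cast hR
  have hK' : (0 : ℝ) < K := by exact_mod_cast hK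
  have hh0 : 0 ≤ h := by rw [hh]; positivity
  set X : ℝ := lpNorm h 2 (besselPotential d (K * R) h s w) with hX
  have hX0 : 0 ≤ X := lpNorm_nonneg hh0 _ _
  set Q : ℝ := q.toReal with hQ
  set f : ℝ → ℝ≥0∞ := fun t =>
    ENNReal.ofReal (lpNorm h r (propagator d (K * R) h t (blockPart w j)) ^ Q) with hf
  set Z : ℝ := (2 * Real.pi / 2 ^ j) ^ s * X with hZ
  have hZ0 : 0 ≤ Z := by positivity
  set τ : ℝ := R / 2 ^ j with hτ
  have hτ0 : 0 < τ := by positivity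
  have hpiece : ∀ i : ℕ, ∫⁻ t in Set.Icc (i * τ) ((i + 1) * τ), f t ≤
      ENNReal.ofReal (C * 2 ^ j * Z ^ Q) := by
    intro i
    refine (hmain K R j h _ _ hK hR hh (le_of_eq ?_) w).trans (ENNReal.ofReal_le_ofReal ?_)
    · rw [hτ]; field_simp; ring
    · have h1 := sum_blockPart_coeff_le hK hR hh hs w j
      have h2 : (Z ^ 2) ^ (Q / 2) = Z ^ Q := by
        rw [← Real.rpow_natCast, ← Real.rpow_mul hZ0]
        congr 1
        push_cast
        ring
      rw [← h2]
      refine mul_le_mul_of_nonneg_left (Real.rpow_le_rpow ?_ h1 (by positivity)) (by positivity)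
      exact mul_nonneg (by positivity) (Finset.sum_nonneg fun _ _ => by positivity)
  set m : ℕ := ⌈(2 : ℝ) ^ j / R⌉₊ with hm
  have hm1 : 1 ≤ m * τ := by
    have := Nat.le_ceil ((2 : ℝ) ^ j / R)
    calc (1 : ℝ) = 2 ^ j / R * τ := by rw [hτ]; field_simp
      _ ≤ m * τ := by gcongr
  have hm2 : (m : ℝ) ≤ 1 + 2 ^ j / R := by
    have := Nat.ceil_lt_add_one (show 0 ≤ (2 : ℝ) ^ j / R by positivity)
    linarith
  have htotal : ∫⁻ t in Set.Icc (0 : ℝ) 1, f t ≤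
      ENNReal.ofReal ((1 + 2 ^ j / R) * (C * 2 ^ j * Z ^ Q)) := by
    refine (MeasureTheory.lintegral_mono_set (Set.Icc_subset_Icc_right hm1)).trans
      ((lintegral_Icc_le_nsmul hpiece m).trans ?_)
    rw [← ENNReal.ofReal_natCast, ← ENNReal.ofReal_mul (by positivity)]
    refine ENNReal.ofReal_le_ofReal ?_
    gcongr
  rw [strichartzNorm, MeasureTheory.eLpNorm_eq_lintegral_rpow_enorm_toReal hqne hqtop]
  have hint : ∀ t, ‖lpNorm h r (propagator d (K * R) h t (blockPart w j))‖ₑ ^ q.toReal = f t := by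
    intro t
    rw [Real.enorm_of_nonneg (lpNorm_nonneg hh0 _ _),
      ENNReal.ofReal_rpow_of_nonneg (lpNorm_nonneg hh0 _ _) hq0.le]
  simp only [hint]
  refine (ENNReal.rpow_le_rpow htotal (by positivity)).trans ?_
  rw [ENNReal.ofReal_rpow_of_nonneg (by positivity) (by positivity)]
  refine ENNReal.ofReal_le_ofReal (le_of_eq ?_)
  rw [← hQ, Real.mul_rpow (by positivity) (by positivity),
    Real.mul_rpow (x := C * 2 ^ j) (by positivity) (by positivity),
    Real.mul_rpow (x := C) (by positivity) (by positivity), ← Real.rpow_mul hZ0]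
  have e1 : Q * (1 / Q) = 1 := by field_simp
  rw [e1, Real.rpow_one, hZ, Real.div_rpow (by positivity) (by positivity),
    Real.rpow_neg (by positivity)]
  ring

/-- The `L^q_t L^r_x` norms obey the triangle inequality along the dyadic decomposition. -/
theorem strichartzNorm_propagator_le_sum {d K R J : ℕ} {h : ℝ} (hh : 0 ≤ h) {q r : ℝ≥0∞}
    (hq : 1 ≤ q) (hr : 1 ≤ r) (hJ : 2 * K ≤ 2 ^ J) (w : DirichletFun d (K * R)) :
    strichartzNorm h q r (fun t => propagator d (K * R) h t w) ≤
      ∑ j ∈ Finset.range (J + 1),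
        strichartzNorm h q r (fun t => propagator d (K * R) h t (blockPart w j)) := by
  unfold strichartzNorm
  refine le_trans (MeasureTheory.eLpNorm_mono_real fun t => ?_)
    (MeasureTheory.eLpNorm_sum_le (fun j _ => (continuous_lpNorm h r fun x =>
      continuous_propagator_val h (blockPart w j) x).aestronglyMeasurable) hq)
  rw [Real.norm_of_nonneg (lpNorm_nonneg hh _ _), Finset.sum_apply]
  refine le_trans (le_of_eq ?_) (lpNorm_sum_le hh hr _ _)
  rw [← map_sum, sum_blockPart hJ]

end FiniteLattice

end

theorem theorem1p2 (d : ℕ) (hd : d = 2 ∨ d = 3) (α : ℝ) (hα : 0 ≤ α)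
    (c₁ c₂ : ℝ) (hc₁ : 0 < c₁) (hc₂ : 0 < c₂)
    (q r : ℝ≥0∞) (hqr : FiniteLattice.LatticeAdmissible d q r) (s : ℝ)
    (hs₁ : 1 ≤ α → 1 / q.toReal < s)
    (hs₂ : 0 < α → α < 1 → s = (2 - α) / q.toReal)
    (hs₃ : α = 0 → 2 / q.toReal < s) :
    ∃ C : ℝ, 0 < C ∧
      ∀ (h : ℝ) (K R : ℕ), 0 < h → h ≤ 1 → (K : ℝ) = Real.pi / h →
        c₁ * h ^ (-α) ≤ (R : ℝ) → (R : ℝ) ≤ c₂ * h ^ (-α) →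
        ∀ w₀ : FiniteLattice.DirichletFun d (K * R),
          FiniteLattice.strichartzNorm h q r
              (fun t => FiniteLattice.propagator d (K * R) h t w₀) ≤
            ENNReal.ofReal
              (C * FiniteLattice.lpNorm h 2 (FiniteLattice.besselPotential d (K * R) h s w₀)) := by
  open FiniteLattice in
  obtain ⟨hq2, hr2, heq, hend⟩ := hqr
  have hd0 : (0 : ℝ) < d := by rcases hd with rfl | rfl <;> norm_num
  have hdne : (d : ℝ≥0∞) ≠ 0 := by rcases hd with rfl | rfl <;> norm_num
  have hqne : q ≠ 0 := by rintro rfl; simp at hq2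
  have hrne : r ≠ 0 := by rintro rfl; simp at hr2
  have hs0 : 0 ≤ s := by
    have h0 : 0 ≤ q.toReal := ENNReal.toReal_nonneg
    rcases le_or_gt 1 α with h | h
    · exact (lt_of_le_of_lt (by positivity) (hs₁ h)).le
    · rcases hα.eq_or_lt with h' | h'
      · exact (lt_of_le_of_lt (by positivity) (hs₃ h'.symm)).le
      · rw [hs₂ h' h]
        exact div_nonneg (by linarith) h0
  rcases eq_or_ne q ∞ with rfl | hqtop
  · have hr : r = 2 := by
      rw [ENNReal.div_top, zero_add] at heq
      have hrtop : r ≠ ∞ := by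
        rintro rfl
        rw [ENNReal.div_top] at heq
        exact (ENNReal.div_pos hdne (by simp)).ne heq
      have h1 := congrArg ENNReal.toReal heq
      simp only [ENNReal.toReal_div, ENNReal.toReal_ofNat, ENNReal.toReal_natCast] at h1
      have h2 : 0 < r.toReal := ENNReal.toReal_pos hrne hrtop
      have h3 : r.toReal = 2 := by
        rw [div_eq_div_iff h2.ne' two_ne_zero] at h1
        exact (mul_left_cancel₀ hd0.ne' h1).symm
      rw [← ENNReal.ofReal_toReal hrtop, h3]
      simp
    subst hr
    refine ⟨1, one_pos, fun h K R hh0 _ _ _ _ w => ?_⟩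
    rw [strichartzNorm, one_mul]
    refine (MeasureTheory.eLpNorm_le_of_ae_bound (C := lpNorm h 2 (besselPotential d (K * R) h s w))
      (Filter.Eventually.of_forall fun t => ?_)).trans (by simp)
    rw [Real.norm_of_nonneg (lpNorm_nonneg hh0.le _ _)]
    exact (lpNorm_propagator_le hh0.le t w).trans (lpNorm_le_lpNorm_besselPotential hh0.le hs0 w)
  have hqR : 2 ≤ q.toReal := by
    have := ENNReal.toReal_mono hqtop hq2
    simpa using this
  have hcase : 2 < q.toReal ∧ ((r = ∞ ∧ 3 / q.toReal = (d : ℝ) / 2) ∨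
      (r ≠ ∞ ∧ 2 < r.toReal ∧ 3 / q.toReal + d / r.toReal = (d : ℝ) / 2)) := by
    have heqR := congrArg ENNReal.toReal heq
    rw [ENNReal.toReal_add (ENNReal.div_ne_top (by simp) hqne) (ENNReal.div_ne_top (by simp) hrne)]
      at heqR
    simp only [ENNReal.toReal_div, ENNReal.toReal_ofNat, ENNReal.toReal_natCast] at heqR
    have h3q : 0 < 3 / q.toReal := by positivity
    rcases eq_or_ne r ∞ with rfl | hrtop
    · simp only [ENNReal.toReal_top, div_zero, add_zero] at heqR
      refine ⟨lt_of_le_of_ne hqR fun h2 => ?_, Or.inl ⟨rfl, heqR⟩⟩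
      rw [← h2] at heqR
      rcases hd with rfl | rfl
      · norm_num at heqR
      · refine hend ⟨?_, rfl, rfl⟩
        rw [← ENNReal.ofReal_toReal hqtop, ← h2]
        simp
    · have hrR : 2 ≤ r.toReal := by
        have := ENNReal.toReal_mono hrtop hr2
        simpa using this
      have hdr : 0 < d / r.toReal := by positivity
      refine ⟨lt_of_le_of_ne hqR fun h2 => ?_, Or.inr ⟨hrtop, lt_of_le_of_ne hrR fun h2 => ?_, heqR⟩⟩
      · rw [← h2] at heqR
        have hd3 : (d : ℝ) ≤ 3 := by rcases hd with rfl | rfl <;> norm_num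
        linarith
      · rw [← h2] at heqR
        linarith
  obtain ⟨C₁, hC₁, hblock⟩ := exists_strichartzNorm_blockPart_le hcase.1 hcase.2 hs0
  obtain ⟨C₂, hC₂, hsum⟩ := exists_sum_loss_le hα hc₁ (by linarith : 1 ≤ q.toReal) hs₁ hs₂ hs₃
  refine ⟨C₁ * C₂, mul_pos hC₁ hC₂, fun h K R hh0 hh1 hKh hcR _ w => ?_⟩
  have hπ := Real.pi_pos
  have hK' : (0 : ℝ) < K := by rw [hKh]; positivity
  have hR' : (0 : ℝ) < R := lt_of_lt_of_le (by positivity) hcR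
  have hK : 0 < K := by exact_mod_cast hK'
  have hR : 0 < R := by exact_mod_cast hR'
  have hh : h = Real.pi / K := by rw [hKh]; field_simp
  have hX0 := lpNorm_nonneg hh0.le 2 (besselPotential d (K * R) h s w)
  have hJ1 : 2 * K ≤ 2 ^ Nat.clog 2 (2 * K) := Nat.le_pow_clog (by norm_num) _
  have hJ2 : (2 : ℝ) ^ Nat.clog 2 (2 * K) ≤ 4 * Real.pi / h := by
    have h1 : 2 ^ (Nat.clog 2 (2 * K)).pred < 2 * K :=
      Nat.pow_pred_clog_lt_self (by norm_num) (by omega)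
    have h2 : 0 < Nat.clog 2 (2 * K) := Nat.clog_pos (by norm_num) (by omega)
    have h3 : 2 ^ Nat.clog 2 (2 * K) ≤ 4 * K := by
      obtain ⟨n, hn⟩ := Nat.exists_eq_succ_of_ne_zero h2.ne'
      rw [hn, Nat.pred_succ] at h1
      rw [hn, pow_succ]
      omega
    have h4 : 4 * Real.pi / h = 4 * K := by rw [hKh]; ring
    rw [h4]
    exact_mod_cast h3
  refine (strichartzNorm_propagator_le_sum hh0.le (le_trans (by norm_num) hq2)
    (le_trans (by norm_num) hr2) hJ1 w).trans ?_
  refine (Finset.sum_le_sum fun j _ => hblock h K R j hK hR hh w).trans ?_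
  rw [← ENNReal.ofReal_sum_of_nonneg fun j _ => by positivity, ← Finset.mul_sum]
  refine ENNReal.ofReal_le_ofReal ?_
  have := mul_le_mul_of_nonneg_left (hsum h R _ hh0 hh1 hR hcR hJ2) (mul_nonneg hC₁.le hX0)
  linarith
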